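/- Let $\mathbf H^3=\mathbf C\times(0,\infty)$ be hyperbolic $3$-space, with the hyperbolic metric $d$ given by $\cosh d\big((z,t),(w,s)\big)=1+\frac{|z-w|^2+(t-s)^2}{2ts}$, and let $I$ be the group of all isometries of $\mathbf H^3$. A \emph{nice lattice} is a discrete torsion-free subgroup $\Gamma\subset I$ (one that acts properly discontinuously on $\mathbf H^3$ and has no nontrivial element of finite order) whose quotient $\mathbf H^3/\Gamma$ is compact. A \emph{compact hyperbolic $3$-manifold} is a quotient $M=\mathbf H^3/\Gamma$ by a nice lattice, with covering map $\pi:\mathbf H^3\to M$, the smooth structure that makes $\pi$ a local diffeomorphism, and the metric $d_M(a,b)=\inf\{d(x,y):\pi(x)=a,\ \pi(y)=b\}$, for which $\pi$ is a local isometry. A map $f:X_1\to X_2$ of metric spaces is \emph{BL} (bi-Lipschitz) if it is a bijection and there is $K\ge 1$ such that $K^{-1}d_1(x,y)\le d_2(f(x),f(y))\le K\,d_1(x,y)$ for all $x,y\in X_1$. \textbf{Theorem (Mostow).} Let $M_1=\mathbf H^3/\Gamma_1$ and $M_2=\mathbf H^3/\Gamma_2$ be compact hyperbolic $3$-manifolds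 with covering maps $\pi_1,\pi_2$. (1) If $f:M_1\to M_2$ is BL, then there is an isometry (distance-preserving bijection) $g:M_1\to M_2$. Moreover, $f$ has an equivariant lift, that is, a BL map $H:\mathbf H^3\to\mathbf H^3$ with $\pi_2\circ H=f\circ\pi_1$ and $H\Gamma_1H^{-1}=\Gamma_2$; and every equivariant lift $H$ of $f$ extends continuously to a homeomorphism $h$ of the ideal boundary $\mathbf C\cup\{\infty\}$ of $\mathbf H^3$ which is a (possibly orientation-reversing) Möbius transformation, that is, of the form $z\mapsto\frac{az+b}{cz+d}$ or $z\mapsto\frac{a\bar z+b}{c\bar z+d}$ with $a,b,c,d\in\mathbf C$, $ad-bc\neq 0$. (2) If $M_1$ and $M_2$ are diffeomorphic, then they are isometric. -/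

import Mathlib

open Set Filter Topology Manifold
open scoped ContDiff MatrixGroups

noncomputable section

/-! ### Hyperbolic 3-space -/

/-- The upper half-space `ℂ × (0, ∞)`, the underlying set of hyperbolic `3`-space. -/
@[ext]
structure Hyp3 where
  /-- the horizontal coordinate -/
  z : ℂ
  /-- the height -/
  t : ℝ
  t_pos : 0 < t

namespace Hyp3

/-- The inclusion of hyperbolic space in `ℂ × ℝ`. -/
def coord (p : Hyp3) : ℂ × ℝ := (p.z, p.t)

instance : Nonempty Hyp3 := ⟨⟨0, 1, one_pos⟩⟩

instance : TopologicalSpace Hyp3 := TopologicalSpace.induced coord inferInstance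

theorem coord_injective : Function.Injective coord := by
  intro p q h
  simp only [coord, Prod.mk.injEq] at h
  exact Hyp3.ext h.1 h.2

theorem range_coord : range coord = {x : ℂ × ℝ | 0 < x.2} := by
  ext x
  constructor
  · rintro ⟨p, rfl⟩
    exact p.t_pos
  · intro hx
    exact ⟨⟨x.1, x.2, hx⟩, rfl⟩

theorem isOpenEmbedding_coord : IsOpenEmbedding coord where
  eq_induced := rfl
  injective := coord_injective
  isOpen_range := by
    rw [range_coord]
    exact isOpen_lt continuous_const continuous_snd

theorem continuous_z : Continuous Hyp3.z :=
  continuous_fst.comp isOpenEmbedding_coord.continuous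

theorem continuous_t : Continuous Hyp3.t :=
  continuous_snd.comp isOpenEmbedding_coord.continuous

/-- The hyperbolic distance (of the Riemannian metric `(|dz|² + dt²) / t²`): it satisfies
`sinh (d / 2) = |p - q| / (2 √(p.t q.t))`, with `|p - q|` the Euclidean distance. -/
instance : Dist Hyp3 :=
  ⟨fun p q => 2 * Real.arsinh
    (√(‖p.z - q.z‖ ^ 2 + (p.t - q.t) ^ 2) / (2 * √(p.t * q.t)))⟩

theorem dist_def (p q : Hyp3) : dist p q = 2 * Real.arsinh
    (√(‖p.z - q.z‖ ^ 2 + (p.t - q.t) ^ 2) / (2 * √(p.t * q.t))) := rfl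

theorem dist_eq_planar (p q : Hyp3) (x : ℝ) : dist p q =
    dist (UpperHalfPlane.mk ⟨x, p.t⟩ p.t_pos)
      (UpperHalfPlane.mk ⟨x + ‖p.z - q.z‖, q.t⟩ q.t_pos) := by
  rw [UpperHalfPlane.dist_eq, dist_def, Complex.dist_eq_re_im]
  simp

theorem planar_mono {t s : ℝ} (ht : 0 < t) (hs : 0 < s) {a b : ℝ} (ha : 0 ≤ a) (hab : a ≤ b) :
    dist (UpperHalfPlane.mk ⟨0, t⟩ ht) (UpperHalfPlane.mk ⟨0 + a, s⟩ hs) ≤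
      dist (UpperHalfPlane.mk ⟨0, t⟩ ht) (UpperHalfPlane.mk ⟨b, s⟩ hs) := by
  rw [UpperHalfPlane.dist_eq, UpperHalfPlane.dist_eq, Complex.dist_eq_re_im,
    Complex.dist_eq_re_im]
  simp only [UpperHalfPlane.mk_im, zero_add, zero_sub, neg_sq]
  gcongr

protected theorem dist_triangle (p q r : Hyp3) : dist p r ≤ dist p q + dist q r := by
  rw [dist_eq_planar p r 0, dist_eq_planar p q 0, dist_eq_planar q r (0 + ‖p.z - q.z‖)]
  refine le_trans (planar_mono p.t_pos r.t_pos (norm_nonneg _) ?_) (dist_triangle _ _ _)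
  rw [zero_add]
  exact norm_sub_le_norm_sub_add_norm_sub _ _ _

theorem cosh_dist (p q : Hyp3) : Real.cosh (dist p q) =
    (‖p.z - q.z‖ ^ 2 + p.t ^ 2 + q.t ^ 2) / (2 * p.t * q.t) := by
  rw [dist_eq_planar p q 0, UpperHalfPlane.cosh_dist']
  simp

/-- The hyperbolic metric, before its topology is identified with the Euclidean one. -/
@[reducible]
def metricSpaceAux : MetricSpace Hyp3 where
  dist := dist
  dist_self p := by simp [dist_def]
  dist_comm p q := by
    rw [dist_def, dist_def, norm_sub_rev, mul_comm p.t]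
    congr 4
    ring
  dist_triangle := Hyp3.dist_triangle
  eq_of_dist_eq_zero {p q} h := by
    have h1 := cosh_dist p q
    rw [h, Real.cosh_zero, eq_div_iff (by have := p.t_pos; have := q.t_pos; positivity)] at h1
    have hz : ‖p.z - q.z‖ = 0 := by nlinarith [sq_nonneg ‖p.z - q.z‖, sq_nonneg (p.t - q.t)]
    have ht : p.t - q.t = 0 := by nlinarith [sq_nonneg ‖p.z - q.z‖, sq_nonneg (p.t - q.t)]
    exact Hyp3.ext (sub_eq_zero.1 (norm_eq_zero.1 hz)) (sub_eq_zero.1 ht)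

theorem euclidean_le (p q : Hyp3) :
    dist p.coord q.coord ≤ q.t * (Real.exp (dist p q) - 1) := by
  have h := UpperHalfPlane.dist_coe_le (UpperHalfPlane.mk ⟨0, p.t⟩ p.t_pos)
    (UpperHalfPlane.mk ⟨0 + ‖p.z - q.z‖, q.t⟩ q.t_pos)
  rw [← dist_eq_planar p q 0] at h
  refine le_trans ?_ h
  rw [Prod.dist_eq]
  refine max_le ?_ ?_
  · have := Complex.abs_re_le_norm ((⟨0, p.t⟩ : ℂ) - ⟨0 + ‖p.z - q.z‖, q.t⟩)
    simpa [dist_eq_norm, coord] using this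
  · have := Complex.abs_im_le_norm ((⟨0, p.t⟩ : ℂ) - ⟨0 + ‖p.z - q.z‖, q.t⟩)
    simpa [dist_eq_norm, coord] using this

/-- Hyperbolic `3`-space as a metric space; its topology is the Euclidean one. -/
instance : MetricSpace Hyp3 :=
  metricSpaceAux.replaceTopology <| by
    refine le_antisymm (continuous_id_iff_le.1 ?_) ?_
    · refine (@continuous_iff_continuous_dist Hyp3 Hyp3
        metricSpaceAux.toPseudoMetricSpace _ _).2 ?_
      have h0 : ∀ x : Hyp3 × Hyp3, 2 * √(x.1.t * x.2.t) ≠ 0 := fun x => by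
        have := x.1.t_pos
        have := x.2.t_pos
        positivity
      have hz := continuous_z
      have ht := continuous_t
      change Continuous fun x : Hyp3 × Hyp3 => 2 * Real.arsinh
        (√(‖x.1.z - x.2.z‖ ^ 2 + (x.1.t - x.2.t) ^ 2) / (2 * √(x.1.t * x.2.t)))
      refine continuous_const.mul (Continuous.arsinh (Continuous.div ?_ ?_ h0)) <;> fun_prop
    · let : MetricSpace Hyp3 := metricSpaceAux
      refine le_of_nhds_le_nhds fun p => ?_
      rw [nhds_induced]
      refine (Metric.nhds_basis_ball.le_basis_iff (Metric.nhds_basis_ball.comap _)).2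
        fun R hR => ?_
      have h1 : 1 < R / p.t + 1 := lt_add_of_pos_left _ (div_pos hR p.t_pos)
      have h0 : 0 < R / p.t + 1 := one_pos.trans h1
      refine ⟨Real.log (R / p.t + 1), Real.log_pos h1, fun q hq => ?_⟩
      refine (euclidean_le q p).trans_lt ?_
      rwa [← lt_div_iff₀' p.t_pos, sub_lt_iff_lt_add, ← Real.lt_log_iff_exp_lt h0]

instance : LocallyCompactSpace Hyp3 := isOpenEmbedding_coord.locallyCompactSpace

/-- Hyperbolic space is a manifold with the single chart `coord`. -/
instance : ChartedSpace (ℂ × ℝ) Hyp3 := isOpenEmbedding_coord.singletonChartedSpace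

instance : IsManifold 𝓘(ℝ, ℂ × ℝ) ∞ Hyp3 := isOpenEmbedding_coord.isManifold_singleton

/-- The group of all isometries of hyperbolic space acts on it. -/
instance : MulAction (Hyp3 ≃ᵢ Hyp3) Hyp3 where
  smul φ p := φ p
  one_smul _ := rfl
  mul_smul _ _ _ := rfl

theorem smul_def (φ : Hyp3 ≃ᵢ Hyp3) (p : Hyp3) : φ • p = φ p := rfl

instance : IsIsometricSMul (Hyp3 ≃ᵢ Hyp3) Hyp3 := ⟨fun φ => φ.isometry⟩

theorem contDiffOn_cosh (p : Hyp3) : ContDiffOn ℝ ∞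
    (fun x : ℂ × ℝ => (‖x.1 - p.z‖ ^ 2 + x.2 ^ 2 + p.t ^ 2) / (2 * x.2 * p.t)) (range coord) := by
  rw [range_coord]
  refine ContDiffOn.div ?_ ?_ ?_
  · have : ContDiff ℝ ∞ fun x : ℂ × ℝ => ‖x.1 - p.z‖ ^ 2 :=
      (contDiff_fst.sub contDiff_const).norm_sq ℝ
    exact ((this.add (contDiff_snd.pow 2)).add contDiff_const).contDiffOn
  · exact ((contDiff_const.mul contDiff_snd).mul contDiff_const).contDiffOn
  · intro x hx
    have : 0 < x.2 := hx
    have := p.t_pos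
    positivity

/-- Isometries of hyperbolic space are smooth. -/
theorem contDiffOn_isometry (φ : Hyp3 ≃ᵢ Hyp3) (F : ℂ × ℝ → ℂ × ℝ)
    (hF : ∀ p : Hyp3, F p.coord = (φ p).coord) : ContDiffOn ℝ ∞ F (range coord) := by
  have key : ∀ a : Hyp3, ContDiffOn ℝ ∞ (fun x : ℂ × ℝ =>
      (‖(F x).1 - a.z‖ ^ 2 + (F x).2 ^ 2 + a.t ^ 2) / (2 * (F x).2 * a.t)) (range coord) := by
    intro a
    refine (contDiffOn_cosh (φ.symm a)).congr ?_
    rintro _ ⟨p, rfl⟩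
    rw [hF]
    change (‖(φ p).z - a.z‖ ^ 2 + (φ p).t ^ 2 + a.t ^ 2) / (2 * (φ p).t * a.t) =
      (‖p.z - (φ.symm a).z‖ ^ 2 + p.t ^ 2 + (φ.symm a).t ^ 2) / (2 * p.t * (φ.symm a).t)
    rw [← cosh_dist, ← cosh_dist, ← φ.dist_eq p, φ.apply_symm_apply]
  have c0 := key ⟨0, 1, one_pos⟩
  have c1 := key ⟨1, 1, one_pos⟩
  have c2 := key ⟨Complex.I, 1, one_pos⟩
  have c3 := key ⟨0, 2, two_pos⟩
  have hpos : ∀ x ∈ range coord, 0 < (F x).2 := by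
    rintro _ ⟨p, rfl⟩
    rw [hF]
    exact (φ p).t_pos
  have hB : ContDiffOn ℝ ∞ (fun x => ((F x).2)⁻¹) (range coord) := by
    refine (((contDiffOn_const (c := (4 : ℝ))).mul c3).sub
      ((contDiffOn_const (c := (2 : ℝ))).mul c0) |>.div_const 3).congr fun x hx => ?_
    have := hpos x hx
    simp only
    field_simp
    ring
  have hT : ContDiffOn ℝ ∞ (fun x => (F x).2) (range coord) := by
    refine (hB.inv fun x hx => (inv_pos.2 (hpos x hx)).ne').congr fun x _ => ?_
    simp
  have hre : ContDiffOn ℝ ∞ (fun x => (F x).1.re) (range coord) := by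
    refine ((hT.mul (c0.sub c1)).add (contDiffOn_const (c := (1 / 2 : ℝ)))).congr
      fun x hx => ?_
    have := hpos x hx
    simp only [Complex.sq_norm, Complex.normSq_apply, Complex.sub_re, Complex.sub_im,
      Complex.one_re, Complex.one_im, Complex.zero_re, Complex.zero_im]
    field_simp
    ring
  have him : ContDiffOn ℝ ∞ (fun x => (F x).1.im) (range coord) := by
    refine ((hT.mul (c0.sub c2)).add (contDiffOn_const (c := (1 / 2 : ℝ)))).congr
      fun x hx => ?_
    have := hpos x hx
    simp only [Complex.sq_norm, Complex.normSq_apply, Complex.sub_re, Complex.sub_im,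
      Complex.I_re, Complex.I_im, Complex.zero_re, Complex.zero_im]
    field_simp
    ring
  have hz : ContDiffOn ℝ ∞ (fun x => (F x).1) (range coord) := by
    refine ((Complex.ofRealCLM.contDiff.comp_contDiffOn hre).add
      ((Complex.ofRealCLM.contDiff.comp_contDiffOn him).mul
        (contDiffOn_const (c := Complex.I)))).congr fun x _ => ?_
    simp [Complex.re_add_im]
  exact hz.prodMk hT

end Hyp3

/-! ### Compact hyperbolic 3-manifolds -/

/-- A co-compact torsion-free lattice in the isometry group of hyperbolic `3`-space: a subgroup
that is discrete (it acts properly discontinuously), has no nontrivial element of finite order,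
and has a compact quotient. -/
structure NiceLattice where
  /-- the group of isometries -/
  Γ : Subgroup (Hyp3 ≃ᵢ Hyp3)
  discrete : ProperlyDiscontinuousSMul Γ Hyp3
  torsionFree : ∀ γ ∈ Γ, IsOfFinOrder γ → γ = 1
  cocompact : CompactSpace (MulAction.orbitRel.Quotient Γ Hyp3)

namespace NiceLattice

variable (L : NiceLattice)

instance : ProperlyDiscontinuousSMul L.Γ Hyp3 := L.discrete

instance : IsIsometricSMul L.Γ Hyp3 := ⟨fun γ => γ.1.isometry⟩

/-- The action is free. -/
instance : IsCancelSMul L.Γ Hyp3 where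
  left_cancel' g _ _ h := smul_left_cancel g h
  right_cancel' a b p h := by
    have hfin : Finite (MulAction.stabilizer L.Γ p) :=
      (ProperlyDiscontinuousSMul.finite_stabilizer' L.Γ p).to_subtype
    have hmem : b⁻¹ * a ∈ MulAction.stabilizer L.Γ p := by
      rw [MulAction.mem_stabilizer_iff, mul_smul, h, inv_smul_smul]
    have h1 : IsOfFinOrder (⟨b⁻¹ * a, hmem⟩ : MulAction.stabilizer L.Γ p) :=
      isOfFinOrder_of_finite _
    have h2 : IsOfFinOrder (b⁻¹ * a) :=
      (MulAction.stabilizer L.Γ p).subtype.isOfFinOrder h1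
    have h3 : IsOfFinOrder ((b⁻¹ * a : L.Γ) : Hyp3 ≃ᵢ Hyp3) := L.Γ.subtype.isOfFinOrder h2
    have h4 : b⁻¹ * a = 1 := Subtype.ext (L.torsionFree _ (b⁻¹ * a).2 h3)
    exact (inv_mul_eq_one.1 h4).symm

/-- The compact hyperbolic `3`-manifold `Hyp3 / Γ`. -/
def Manifold : Type := MulAction.orbitRel.Quotient L.Γ Hyp3

/-- The universal covering map from hyperbolic space to its quotient. -/
def proj (p : Hyp3) : L.Manifold := Quotient.mk (MulAction.orbitRel L.Γ Hyp3) p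

/-- The quotient topology. -/
instance : TopologicalSpace L.Manifold :=
  inferInstanceAs (TopologicalSpace (MulAction.orbitRel.Quotient L.Γ Hyp3))

instance : CompactSpace L.Manifold := L.cocompact

instance : T2Space L.Manifold :=
  inferInstanceAs (T2Space (Quotient (MulAction.orbitRel L.Γ Hyp3)))

/-- The smooth structure whose charts are local inverses of the covering map. -/
instance : ChartedSpace (ℂ × ℝ) L.Manifold :=
  inferInstanceAs (ChartedSpace (ℂ × ℝ) (MulAction.orbitRel.Quotient L.Γ Hyp3))

theorem isQuotientCoveringMap_proj : IsQuotientCoveringMap L.proj L.Γ :=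
  isQuotientCoveringMap_quotientMk_of_properlyDiscontinuousSMul

theorem proj_surjective : Function.Surjective L.proj := Quotient.mk_surjective

theorem proj_eq_iff {p q : Hyp3} : L.proj p = L.proj q ↔ ∃ γ : L.Γ, γ • q = p :=
  L.isQuotientCoveringMap_proj.apply_eq_iff_mem_orbit

theorem proj_smul (γ : L.Γ) (p : Hyp3) : L.proj (γ • p) = L.proj p :=
  L.isQuotientCoveringMap_proj.map_smul γ

theorem continuous_proj : Continuous L.proj := L.isQuotientCoveringMap_proj.continuous

theorem isOpenMap_proj : IsOpenMap L.proj :=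
  L.isQuotientCoveringMap_proj.isCoveringMap.isLocalHomeomorph.isOpenMap

instance : IsManifold 𝓘(ℝ, ℂ × ℝ) ∞ L.Manifold := by
  have hloc : IsLocalHomeomorph L.proj :=
    L.isQuotientCoveringMap_proj.isCoveringMap.isLocalHomeomorph
  set c := Hyp3.isOpenEmbedding_coord.toOpenPartialHomeomorph Hyp3.coord with hc
  have hcsymm : ∀ p : Hyp3, c.symm p.coord = p := fun p => c.left_inv (by simp [c])
  have hccoe : ∀ p : Hyp3, c p = p.coord := fun p => rfl
  have key : ∀ a b : Hyp3, ContDiffOn ℝ ∞ (((hloc.localInverseAt a).trans c).symm.trans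
      ((hloc.localInverseAt b).trans c)) (((hloc.localInverseAt a).trans c).symm.trans
      ((hloc.localInverseAt b).trans c)).source := by
    intro a b
    have hf : ∀ u, (((hloc.localInverseAt a).trans c).symm.trans
        ((hloc.localInverseAt b).trans c)) u =
        (hloc.localInverseAt b (L.proj (c.symm u))).coord := by
      intro u
      simp [hccoe]
    intro u hu
    have hu' := hu
    simp only [OpenPartialHomeomorph.trans_source, OpenPartialHomeomorph.symm_source,
      OpenPartialHomeomorph.trans_target, mem_inter_iff, mem_preimage,
      OpenPartialHomeomorph.coe_trans_symm, Function.comp_apply,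
      IsLocalHomeomorph.localInverseAt_symm] at hu'
    obtain ⟨⟨hut, -⟩, hus, -⟩ := hu'
    have hur : u ∈ range Hyp3.coord := by simpa [c] using hut
    obtain ⟨p, rfl⟩ := hur
    rw [hcsymm] at hus
    obtain ⟨γ, hγ⟩ := L.proj_eq_iff.1 (hloc.apply_localInverseAt_of_mem hus)
    have hsm := Hyp3.contDiffOn_isometry γ.1 (fun v => (γ.1 (c.symm v)).coord)
      (fun q => by simp only [hcsymm])
    have hsm' := (hsm p.coord (mem_range_self p)).contDiffAt
      (Hyp3.isOpenEmbedding_coord.isOpen_range.mem_nhds (mem_range_self p))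
    refine (hsm'.congr_of_eventuallyEq ?_).contDiffWithinAt
    have hev : ∀ᶠ q in 𝓝 p, γ • q ∈ (hloc.localInverseAt b).target := by
      refine (continuous_const_smul γ).continuousAt
        ((hloc.localInverseAt b).open_target.mem_nhds ?_)
      rw [hγ]
      exact (hloc.localInverseAt b).map_source hus
    rw [EventuallyEq, ← Hyp3.isOpenEmbedding_coord.map_nhds_eq, eventually_map]
    filter_upwards [hev] with q hq
    rw [hf, hcsymm]
    have h1 : hloc.localInverseAt b (L.proj (γ • q)) = γ • q := by
      have := (hloc.localInverseAt b).right_inv hq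
      rwa [hloc.localInverseAt_symm] at this
    rw [L.proj_smul] at h1
    rw [h1]
    rfl
  refine isManifold_of_contDiffOn _ _ _ ?_
  rintro _ _ ⟨x, rfl⟩ ⟨y, rfl⟩
  simp only [modelWithCornersSelf_coe, modelWithCornersSelf_coe_symm, range_id, inter_univ,
    preimage_id, Function.comp_id, Function.id_comp]
  exact key _ _

/-- The distance in the quotient is the distance between fibres of the covering map; this is the
path metric for which the covering map is a local isometry. -/
instance : Dist L.Manifold :=
  ⟨fun a b => sInf (image2 dist (L.proj ⁻¹' {a}) (L.proj ⁻¹' {b}))⟩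

theorem dist_eq_infDist (p : Hyp3) (b : L.Manifold) :
    dist (L.proj p) b = Metric.infDist p (L.proj ⁻¹' {b}) := by
  obtain ⟨q₀, rfl⟩ := L.proj_surjective b
  have hne : (L.proj ⁻¹' {L.proj q₀}).Nonempty := ⟨q₀, rfl⟩
  apply le_antisymm
  · refine (Metric.le_infDist hne).2 fun q hq => ?_
    refine csInf_le ⟨0, ?_⟩ ⟨p, rfl, q, hq, rfl⟩
    rintro _ ⟨_, -, _, -, rfl⟩
    exact dist_nonneg
  · refine le_csInf ⟨_, p, rfl, q₀, rfl, rfl⟩ ?_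
    rintro _ ⟨p', hp', q', hq', rfl⟩
    obtain ⟨γ, rfl⟩ := L.proj_eq_iff.1 (show L.proj p = L.proj p' from hp'.symm)
    rw [← dist_smul γ p' q']
    refine Metric.infDist_le_dist_of_mem ?_
    rw [mem_preimage, L.proj_smul]
    exact hq'

theorem ball_proj (p : Hyp3) (r : ℝ) :
    {b | dist (L.proj p) b < r} = L.proj '' Metric.ball p r := by
  ext b
  obtain ⟨q₀, rfl⟩ := L.proj_surjective b
  have hne : (L.proj ⁻¹' {L.proj q₀}).Nonempty := ⟨q₀, rfl⟩
  rw [mem_ofPred_eq, dist_eq_infDist, Metric.infDist_lt_iff hne]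
  constructor
  · rintro ⟨q, hq, h⟩
    exact ⟨q, by rwa [Metric.mem_ball'], hq⟩
  · rintro ⟨q, hq, h⟩
    exact ⟨q, h, by rwa [Metric.mem_ball'] at hq⟩

/-- The quotient metric, before its topology is identified with the quotient topology. -/
@[reducible]
def metricSpaceAux : MetricSpace L.Manifold where
  dist := dist
  dist_self a := by
    obtain ⟨p, rfl⟩ := L.proj_surjective a
    rw [dist_eq_infDist]
    exact Metric.infDist_zero_of_mem rfl
  dist_comm a b := by
    change sInf _ = sInf _
    rw [image2_swap]
    simp only [dist_comm]
  dist_triangle a b c := by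
    obtain ⟨p, rfl⟩ := L.proj_surjective a
    obtain ⟨q₀, rfl⟩ := L.proj_surjective b
    have hne : (L.proj ⁻¹' {L.proj q₀}).Nonempty := ⟨q₀, rfl⟩
    rw [← sub_le_iff_le_add, dist_eq_infDist L p (L.proj q₀)]
    refine (Metric.le_infDist hne).2 fun q hq => ?_
    have hq' : L.proj q = L.proj q₀ := hq
    rw [← hq', dist_eq_infDist, dist_eq_infDist, sub_le_iff_le_add']
    exact Metric.infDist_le_infDist_add_dist
  eq_of_dist_eq_zero {a b} h := by
    obtain ⟨p, rfl⟩ := L.proj_surjective a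
    rw [dist_eq_infDist] at h
    have hcl : IsClosed (L.proj ⁻¹' {b}) := isClosed_singleton.preimage L.continuous_proj
    obtain ⟨q, rfl⟩ := L.proj_surjective b
    exact (hcl.mem_iff_infDist_zero ⟨q, rfl⟩).2 h

/-- The metric of a compact hyperbolic `3`-manifold; its topology is the quotient topology. -/
instance : MetricSpace L.Manifold :=
  L.metricSpaceAux.replaceTopology <| by
    refine TopologicalSpace.ext_nhds fun a => ?_
    obtain ⟨p, rfl⟩ := L.proj_surjective a
    rw [← L.isOpenMap_proj.map_nhds_eq L.continuous_proj.continuousAt]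
    have h1 := (Metric.nhds_basis_ball (x := p)).map L.proj
    have h2 := @Metric.nhds_basis_ball L.Manifold L.metricSpaceAux.toPseudoMetricSpace (L.proj p)
    refine h1.eq_of_same_basis (h2.congr (fun _ => Iff.rfl) fun r _ => ?_)
    rw [← ball_proj]
    ext b
    exact iff_of_eq (congrArg (· < r) (L.metricSpaceAux.dist_comm b (L.proj p)))

end NiceLattice

/-! ### Bi-Lipschitz maps, lifts and their boundary values -/

/-- A bijection of metric spaces that distorts distances by a factor of at most some `K ≥ 1`. -/
def IsBL {X Y : Type*} [MetricSpace X] [MetricSpace Y] (f : X → Y) : Prop :=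
  Function.Bijective f ∧ ∃ K : ℝ, 1 ≤ K ∧
    ∀ x y, K⁻¹ * dist x y ≤ dist (f x) (f y) ∧ dist (f x) (f y) ≤ K * dist x y

/-- `H` conjugates the first lattice to the second: `H Γ₁ H⁻¹ = Γ₂` (for a bijection `H`). -/
def Conjugates (L₁ L₂ : NiceLattice) (H : Hyp3 → Hyp3) : Prop :=
  (∀ γ₁ ∈ L₁.Γ, ∃ γ₂ ∈ L₂.Γ, H ∘ γ₁ = γ₂ ∘ H) ∧
    ∀ γ₂ ∈ L₂.Γ, ∃ γ₁ ∈ L₁.Γ, H ∘ γ₁ = γ₂ ∘ H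

/-- An equivariant bi-Lipschitz lift to hyperbolic space of a map between the quotients. -/
structure IsEquivariantLift {L₁ L₂ : NiceLattice} (f : L₁.Manifold → L₂.Manifold)
    (H : Hyp3 → Hyp3) : Prop where
  isBL : IsBL H
  lifts : ∀ p, L₂.proj (H p) = f (L₁.proj p)
  conjugates : Conjugates L₁ L₂ H

/-- Hyperbolic space inside the one-point compactification of `ℂ × ℝ`. -/
def interiorPoint (p : Hyp3) : OnePoint (ℂ × ℝ) := (p.coord : OnePoint (ℂ × ℝ))

/-- The Riemann sphere `ℂ ∪ {∞}` as the ideal boundary of hyperbolic space, inside the one-point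
compactification of `ℂ × ℝ`. -/
def boundaryPoint : OnePoint ℂ → OnePoint (ℂ × ℝ) := OnePoint.map fun z => (z, 0)

/-- `h` is the continuous extension of `H` to the ideal boundary: as `p` in hyperbolic space tends
to an ideal point `ξ`, the point `H p` tends to `h ξ`. -/
def IsBoundaryExtension (H : Hyp3 → Hyp3) (h : OnePoint ℂ ≃ₜ OnePoint ℂ) : Prop :=
  ∀ ξ : OnePoint ℂ, Tendsto (fun p => interiorPoint (H p))
    (comap interiorPoint (𝓝 (boundaryPoint ξ))) (𝓝 (boundaryPoint (h ξ)))

/-- A Möbius transformation of the Riemann sphere, possibly reversing the orientation: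
`w ↦ (a w + b) / (c w + d)` with `w = z` or `w = conj z`, where `a d - b c ≠ 0`. -/
def IsMoebius (h : OnePoint ℂ → OnePoint ℂ) : Prop :=
  ∃ A : GL (Fin 2) ℂ, (∀ ξ, h ξ = A • ξ) ∨
    ∀ ξ, h ξ = A • OnePoint.map (starRingEnd ℂ) ξ

end

/-!
A bi-Lipschitz map `f` of the quotients lifts to an equivariant bi-Lipschitz map `H` of hyperbolic
space. Seen in the ball model, the points at distance `n`, `n + 1`, … along a geodesic ray have
images whose successive Euclidean distances decay geometrically, so `H` has a boundary map `h`, and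
uniformly so: normalized bi-Lipschitz maps form a compact family together with their boundary maps.
Composing with an isometry, we may assume `h ∞ = ∞`. Compactness makes `h` quasisymmetric on `ℂ`. By
Stepanov's theorem it is then differentiable almost everywhere, and its difference quotients are
bounded in `L²`; were the derivative zero almost everywhere, these quotients, which telescope to
increments of `h`, would tend to zero in `L¹`. So `h` has a nonzero derivative at some point.

Zoom in at that point. Since the quotient is compact, the rescaled maps are, by equivariance, `H`
preceded and followed by isometries that range in a compact set. In the limit `h`, composed with
boundary maps of isometries on both sides, equals the real-linear derivative `A`. Some element of
the lattice moves the point that corresponds to `∞`, and `A` conjugates its boundary map to a Möbius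
transformation that again moves `∞`. Both are inversions up to similarities, which forces `‖A u‖ *
‖A (I * u)‖` to be constant on the unit circle, whence `A` is a similarity. Thus `h` is the boundary
map of an isometry `Φ`, and in particular Möbius. An isometry is determined by its boundary map, so
`Φ` conjugates the lattices as `H` does and descends to an isometry of the quotients.
Diffeomorphisms of compact manifolds are bi-Lipschitz, which covers the smooth case.
-/

noncomputable section

namespace Hyp3

/-! ### Isometries of hyperbolic space -/

/-- Euclidean `3`-space, in which the half-space and the ball models of hyperbolic space live. The
product `ℂ × ℝ` itself carries the supremum norm. -/
abbrev E3 : Type := WithLp 2 (ℂ × ℝ)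

/-- The position of a point of the upper half-space in Euclidean space. -/
def euclid (p : Hyp3) : E3 := WithLp.toLp 2 p.coord

@[simp] theorem euclid_fst (p : Hyp3) : (euclid p).fst = p.z := rfl
@[simp] theorem euclid_snd (p : Hyp3) : (euclid p).snd = p.t := rfl

theorem euclid_injective : Function.Injective euclid :=
  (WithLp.toLp_injective 2).comp coord_injective

theorem norm_euclid_sq (p : Hyp3) : ‖euclid p‖ ^ 2 = ‖p.z‖ ^ 2 + p.t ^ 2 := by
  simp [WithLp.prod_norm_sq_eq_of_L2]

theorem dist_euclid (p q : Hyp3) :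
    dist (euclid p) (euclid q) = √(‖p.z - q.z‖ ^ 2 + (p.t - q.t) ^ 2) := by
  rw [WithLp.prod_dist_eq_of_L2]
  simp [dist_eq_norm]

theorem dist_eq_euclid (p q : Hyp3) :
    dist p q = 2 * Real.arsinh (dist (euclid p) (euclid q) / (2 * √(p.t * q.t))) := by
  rw [dist_def, dist_euclid]

theorem sinh_half_dist (p q : Hyp3) :
    Real.sinh (dist p q / 2) = dist (euclid p) (euclid q) / (2 * √(p.t * q.t)) := by
  rw [dist_eq_euclid, mul_div_cancel_left₀ _ (two_ne_zero' ℝ), Real.sinh_arsinh]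

theorem normSq_pos (p : Hyp3) : 0 < ‖p.z‖ ^ 2 + p.t ^ 2 := by
  have := p.t_pos
  positivity

theorem dist_eq_of_cosh_eq {p q p' q' : Hyp3}
    (h : Real.cosh (dist p q) = Real.cosh (dist p' q')) : dist p q = dist p' q' :=
  Real.cosh_strictMonoOn.injOn dist_nonneg dist_nonneg h

theorem height_le (p q : Hyp3) : p.t ≤ q.t * Real.exp (dist p q) := by
  have h : dist p.t q.t ≤ _ := (le_max_right _ _).trans (euclidean_le p q)
  rw [Real.dist_eq] at h
  linarith [le_abs_self (p.t - q.t)]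

theorem norm_z_sub_le (p q : Hyp3) : ‖p.z - q.z‖ ≤ q.t * Real.exp (dist p q) := by
  have h : dist p.z q.z ≤ _ := (le_max_left _ _).trans (euclidean_le p q)
  rw [dist_eq_norm] at h
  linarith [q.t_pos]

instance : ProperSpace Hyp3 where
  isCompact_closedBall p R := by
    set e := Real.exp R
    have he : 0 < e := Real.exp_pos R
    have hbox : IsCompact (coord ⁻¹' (Metric.closedBall p.z (p.t * e) ×ˢ
        Icc (p.t * e⁻¹) (p.t * e))) := by
      refine (isOpenEmbedding_coord.isInducing.isCompact_preimage_iff ?_).2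
        ((isCompact_closedBall _ _).prod isCompact_Icc)
      rintro ⟨z, t⟩ ⟨-, ht⟩
      rw [range_coord]
      exact (mul_pos p.t_pos (inv_pos.2 he)).trans_le ht.1
    refine hbox.of_isClosed_subset Metric.isClosed_closedBall fun q hq => ?_
    have hexp : Real.exp (dist q p) ≤ e := Real.exp_le_exp.2 hq
    have hp := p.t_pos
    have hq0 := q.t_pos
    refine ⟨?_, ?_, (height_le q p).trans (by gcongr)⟩
    · rw [Metric.mem_closedBall, dist_eq_norm]
      exact (norm_z_sub_le q p).trans (by gcongr)
    · change p.t * e⁻¹ ≤ q.t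
      rw [← div_eq_mul_inv, div_le_iff₀ he]
      refine (height_le p q).trans ?_
      rw [dist_comm]
      gcongr

/-- The isometry of hyperbolic space that extends a similarity of `ℂ`. -/
def similarity (Ψ : ℂ ≃ ℂ) (l : ℝ) (hl : 0 < l) (hΨ : ∀ z w, ‖Ψ z - Ψ w‖ = l * ‖z - w‖) :
    Hyp3 ≃ᵢ Hyp3 where
  toFun p := ⟨Ψ p.z, l * p.t, mul_pos hl p.t_pos⟩
  invFun p := ⟨Ψ.symm p.z, l⁻¹ * p.t, mul_pos (inv_pos.2 hl) p.t_pos⟩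
  left_inv p := by
    ext <;> simp [hl.ne']
  right_inv p := by
    ext <;> simp [hl.ne']
  isometry_toFun := by
    refine Isometry.of_dist_eq fun p q => dist_eq_of_cosh_eq ?_
    have hp := p.t_pos
    have hq := q.t_pos
    simp only [cosh_dist, hΨ]
    field_simp

section similarity

variable (Ψ : ℂ ≃ ℂ) (l : ℝ) (hl : 0 < l) (hΨ : ∀ z w, ‖Ψ z - Ψ w‖ = l * ‖z - w‖)

@[simp] theorem similarity_z (p : Hyp3) : (similarity Ψ l hl hΨ p).z = Ψ p.z := rfl
@[simp] theorem similarity_t (p : Hyp3) : (similarity Ψ l hl hΨ p).t = l * p.t := rfl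

end similarity

/-- The base point `(0, 1)`. -/
def base : Hyp3 := ⟨0, 1, one_pos⟩

@[simp] theorem base_z : base.z = 0 := rfl
@[simp] theorem base_t : base.t = 1 := rfl

/-- The homothety of `ℂ` that carries `0` and `1` to `p.z` and `p.z + p.t`. -/
def homothety (p : Hyp3) : ℂ ≃ ℂ where
  toFun z := p.z + p.t * z
  invFun z := (z - p.z) / p.t
  left_inv z := by
    have : (p.t : ℂ) ≠ 0 := Complex.ofReal_ne_zero.2 p.t_pos.ne'
    simp [this]
  right_inv z := by
    have : (p.t : ℂ) ≠ 0 := Complex.ofReal_ne_zero.2 p.t_pos.ne'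
    field_simp
    ring

/-- The isometry extending `homothety p`; it carries the base point to `p`, so that it serves to
recenter hyperbolic space at `p`. -/
def fromBase (p : Hyp3) : Hyp3 ≃ᵢ Hyp3 :=
  similarity (homothety p) p.t p.t_pos fun z w => by
    change ‖p.z + p.t * z - (p.z + p.t * w)‖ = _
    rw [add_sub_add_left_eq_sub, ← mul_sub, norm_mul, Complex.norm_real,
      Real.norm_of_nonneg p.t_pos.le]

@[simp] theorem fromBase_base (p : Hyp3) : fromBase p base = p := by
  ext <;> simp [fromBase, homothety]

@[simp] theorem fromBase_symm_self (p : Hyp3) : (fromBase p).symm p = base := by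
  rw [IsometryEquiv.symm_apply_eq, fromBase_base]

/-- The inversion in the unit hemisphere, as a map. -/
def inversionFun (p : Hyp3) : Hyp3 :=
  ⟨((‖p.z‖ ^ 2 + p.t ^ 2)⁻¹ : ℝ) • p.z, (‖p.z‖ ^ 2 + p.t ^ 2)⁻¹ * p.t,
    mul_pos (inv_pos.2 p.normSq_pos) p.t_pos⟩

theorem euclid_inversionFun (p : Hyp3) :
    euclid (inversionFun p) = EuclideanGeometry.inversion 0 1 (euclid p) := by
  rw [EuclideanGeometry.inversion, dist_zero_right, div_pow, norm_euclid_sq, one_pow, one_div,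
    vsub_eq_sub, sub_zero, vadd_eq_add, add_zero]
  rfl

theorem euclid_ne_zero (p : Hyp3) : euclid p ≠ 0 := fun h =>
  p.t_pos.ne' (congrArg (fun x : E3 => x.snd) h)

theorem inversionFun_involutive : Function.Involutive inversionFun := fun p =>
  euclid_injective <| by
    rw [euclid_inversionFun, euclid_inversionFun,
      EuclideanGeometry.inversion_inversion _ one_ne_zero]

theorem dist_inversionFun (p q : Hyp3) : dist (inversionFun p) (inversionFun q) = dist p q := by
  have hp : 0 < ‖euclid p‖ := norm_pos_iff.2 p.euclid_ne_zero
  have hq : 0 < ‖euclid q‖ := norm_pos_iff.2 q.euclid_ne_zero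
  have ht : ∀ r : Hyp3, (inversionFun r).t = (‖euclid r‖ ^ 2)⁻¹ * r.t := fun r => by
    rw [norm_euclid_sq]
    rfl
  have hsqrt : √((inversionFun p).t * (inversionFun q).t) =
      (‖euclid p‖ * ‖euclid q‖)⁻¹ * √(p.t * q.t) := by
    rw [ht, ht, ← Real.sqrt_sq (inv_pos.2 (mul_pos hp hq)).le, ← Real.sqrt_mul (sq_nonneg _)]
    congr 1
    field_simp
  rw [dist_eq_euclid, dist_eq_euclid p q, hsqrt, euclid_inversionFun, euclid_inversionFun,
    EuclideanGeometry.dist_inversion_inversion p.euclid_ne_zero q.euclid_ne_zero,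
    dist_zero_right, dist_zero_right]
  congr 2
  field_simp

/-- The inversion in the unit hemisphere. -/
def inversion : Hyp3 ≃ᵢ Hyp3 where
  toEquiv := inversionFun_involutive.toPerm
  isometry_toFun := Isometry.of_dist_eq dist_inversionFun

theorem inversion_t (p : Hyp3) : (inversion p).t = (‖p.z‖ ^ 2 + p.t ^ 2)⁻¹ * p.t := rfl

theorem euclid_inversion (p : Hyp3) :
    euclid (inversion p) = EuclideanGeometry.inversion 0 1 (euclid p) :=
  euclid_inversionFun p

@[simp] theorem inversion_inversion (p : Hyp3) : inversion (inversion p) = p :=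
  inversionFun_involutive p

/-! ### The ball model and the ideal boundary -/

/-- The centre `(0, -1)` of the inversion that exchanges the half-space and the unit ball. -/
def south : E3 := WithLp.toLp 2 (0, -1)

@[simp] theorem south_fst : south.fst = 0 := rfl
@[simp] theorem south_snd : south.snd = -1 := rfl

/-- The inversion of Euclidean space that exchanges the upper half-space and the unit ball. -/
def cayley : E3 → E3 := EuclideanGeometry.inversion south √2

theorem cayley_involutive : Function.Involutive cayley :=
  EuclideanGeometry.inversion_involutive _ (by positivity)

theorem dist_cayley {x y : E3} (hx : x ≠ south) (hy : y ≠ south) :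
    dist (cayley x) (cayley y) = 2 / (dist x south * dist y south) * dist x y := by
  rw [cayley, EuclideanGeometry.dist_inversion_inversion hx hy, Real.sq_sqrt zero_le_two]

theorem dist_sq (x y : E3) : dist x y ^ 2 =
    ‖x.fst - y.fst‖ ^ 2 + (x.snd - y.snd) ^ 2 := by
  rw [WithLp.prod_dist_eq_of_L2, Real.sq_sqrt (by positivity)]
  simp [dist_eq_norm]

theorem norm_south : ‖south‖ = 1 := by
  simp [south]

theorem dist_neg_south : dist (-south) south = 2 := by
  rw [dist_eq_norm, ← neg_add', norm_neg, ← two_smul ℝ, norm_smul, norm_south]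
  norm_num

theorem cayley_south : cayley south = south :=
  EuclideanGeometry.inversion_self _ _

theorem cayley_neg_south : cayley (-south) = 0 := by
  rw [cayley, EuclideanGeometry.inversion, dist_neg_south, div_pow, Real.sq_sqrt zero_le_two,
    vsub_eq_sub, vadd_eq_add]
  module

theorem one_sub_norm_cayley_sq {x : E3} (hx : x ≠ south) :
    1 - ‖cayley x‖ ^ 2 = 4 * x.snd / dist x south ^ 2 := by
  have hpos : 0 < dist x south := dist_pos.2 hx
  have hne : -south ≠ south := dist_pos.1 (dist_neg_south ▸ two_pos)
  have hnorm : ‖cayley x‖ = dist x (-south) / dist x south := by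
    rw [← dist_zero_right, ← cayley_neg_south, dist_cayley hx hne, dist_neg_south]
    field_simp
  have hsq : dist x south ^ 2 - dist x (-south) ^ 2 = 4 * x.snd := by
    rw [dist_sq, dist_sq, WithLp.neg_fst, WithLp.neg_snd, south_fst, south_snd]
    ring_nf
  rw [hnorm, div_pow, ← hsq]
  field_simp

theorem ne_south_of_nonneg {x : E3} (hx : 0 ≤ x.snd) : x ≠ south := by
  rintro rfl
  norm_num [south] at hx

theorem euclid_ne_south (p : Hyp3) : euclid p ≠ south :=
  ne_south_of_nonneg p.t_pos.le

/-- The position of a point in the ball model, the open unit ball of Euclidean space. -/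
def ball (p : Hyp3) : E3 := cayley (euclid p)

theorem ball_injective : Function.Injective ball :=
  cayley_involutive.injective.comp euclid_injective

@[simp] theorem ball_base : ball base = 0 := by
  have h : euclid base = -south := by
    simp [euclid, south, coord, ← WithLp.toLp_neg]
  rw [ball, h, cayley_neg_south]

theorem dist_euclid_south (p : Hyp3) :
    dist (euclid p) south = 2 * √p.t * Real.cosh (dist p base / 2) := by
  have ht := p.t_pos
  refine (sq_eq_sq₀ dist_nonneg (by positivity)).1 ?_
  rw [mul_pow, mul_pow, Real.cosh_sq, sinh_half_dist, div_pow, dist_sq, dist_sq, mul_pow,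
    Real.sq_sqrt ht.le, Real.sq_sqrt (by simp [ht.le])]
  simp only [euclid_fst, euclid_snd, base_z, base_t, south_fst, south_snd]
  field_simp
  ring_nf

theorem dist_ball (p q : Hyp3) : dist (ball p) (ball q) =
    Real.sinh (dist p q / 2) / (Real.cosh (dist p base / 2) * Real.cosh (dist q base / 2)) := by
  have htp := p.t_pos
  have htq := q.t_pos
  rw [ball, ball, dist_cayley p.euclid_ne_south q.euclid_ne_south, dist_euclid_south,
    dist_euclid_south, sinh_half_dist, Real.sqrt_mul htp.le]
  field_simp

theorem norm_ball (p : Hyp3) : ‖ball p‖ = Real.tanh (dist p base / 2) := by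
  rw [← dist_zero_right, ← ball_base, dist_ball, dist_self, zero_div, Real.cosh_zero, mul_one,
    Real.tanh_eq_sinh_div_cosh]

theorem mem_range_ball {u : E3} (hu : ‖u‖ < 1) : u ∈ range ball := by
  have hne : u ≠ south := by
    rintro rfl
    exact hu.ne norm_south
  have hne' : cayley u ≠ south := fun h => hne (by
    rw [← cayley_involutive u, h, cayley_south])
  have h := one_sub_norm_cayley_sq hne'
  rw [cayley_involutive] at h
  have hpos : 0 < (cayley u).snd := by
    by_contra! hle
    have : 4 * (cayley u).snd / dist (cayley u) south ^ 2 ≤ 0 :=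
      div_nonpos_of_nonpos_of_nonneg (by linarith) (by positivity)
    nlinarith [norm_nonneg u]
  exact ⟨⟨(cayley u).fst, (cayley u).snd, hpos⟩, cayley_involutive u⟩

/-- A filter of neighbourhoods, in hyperbolic space, of an ideal point. -/
def atIdeal (ξ : OnePoint ℂ) : Filter Hyp3 := comap interiorPoint (𝓝 (boundaryPoint ξ))

/-- The position in the ball model of a point of the compactified half-space. -/
def ballChart : OnePoint (ℂ × ℝ) → E3 := fun x => x.elim south fun x => cayley (WithLp.toLp 2 x)

/-- The position in the ball model of an ideal point. -/
def idealBall (ξ : OnePoint ℂ) : E3 := ballChart (boundaryPoint ξ)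

theorem idealBall_coe (z : ℂ) : idealBall z = cayley (WithLp.toLp 2 (z, 0)) := rfl

theorem norm_idealBall (ξ : OnePoint ℂ) : ‖idealBall ξ‖ = 1 := by
  induction ξ using OnePoint.rec with
  | infty => exact norm_south
  | coe z =>
    have h := one_sub_norm_cayley_sq (x := WithLp.toLp 2 (z, 0)) (ne_south_of_nonneg le_rfl)
    rw [show (WithLp.toLp 2 (z, 0) : E3).snd = 0 from rfl, mul_zero, zero_div, sub_eq_zero] at h
    rw [idealBall_coe, ← pow_eq_one_iff_of_nonneg (norm_nonneg _) two_ne_zero, h]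

theorem mem_range_idealBall {u : E3} (hu : ‖u‖ = 1) : u ∈ range idealBall := by
  obtain rfl | hne := eq_or_ne u south
  · exact ⟨OnePoint.infty, rfl⟩
  have hne' : cayley u ≠ south := fun h => hne (by
    rw [← cayley_involutive u, h, cayley_south])
  have h := one_sub_norm_cayley_sq hne'
  rw [cayley_involutive, hu, one_pow, sub_self, eq_comm,
    div_eq_zero_iff, or_iff_left (pow_ne_zero 2 (dist_pos.2 hne').ne'),
    mul_eq_zero, or_iff_right (four_ne_zero' ℝ)] at h
  refine ⟨((cayley u).fst : ℂ), ?_⟩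
  rw [idealBall_coe, ← h]
  exact cayley_involutive u

/-- The closed upper half-space in the one-point compactification of `ℂ × ℝ`. -/
def closedHalfSpace : Set (OnePoint (ℂ × ℝ)) := ((↑) '' {x : ℂ × ℝ | x.2 < 0})ᶜ

theorem isCompact_closedHalfSpace : IsCompact closedHalfSpace :=
  (OnePoint.isOpen_image_coe.2 (isOpen_lt continuous_snd continuous_const)).isClosed_compl.isCompact

theorem coe_mem_closedHalfSpace {x : ℂ × ℝ} :
    (x : OnePoint (ℂ × ℝ)) ∈ closedHalfSpace ↔ 0 ≤ x.2 := by
  simp [closedHalfSpace]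

theorem interiorPoint_mem (p : Hyp3) : interiorPoint p ∈ closedHalfSpace :=
  coe_mem_closedHalfSpace.2 p.t_pos.le

theorem boundaryPoint_mem (ξ : OnePoint ℂ) : boundaryPoint ξ ∈ closedHalfSpace := by
  induction ξ using OnePoint.rec with
  | infty => simp [closedHalfSpace, boundaryPoint]
  | coe z => exact coe_mem_closedHalfSpace.2 le_rfl

theorem continuousOn_ballChart : ContinuousOn ballChart closedHalfSpace := by
  have htoLp := WithLp.prod_continuous_toLp 2 ℂ ℝ
  refine continuousOn_of_forall_continuousAt fun x hx => ?_
  induction x using OnePoint.rec with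
  | infty =>
    rw [OnePoint.continuousAt_infty', coclosedCompact_eq_cocompact]
    have hdist : Tendsto (fun x : ℂ × ℝ => dist (WithLp.toLp 2 x : E3) south)
        (cocompact (ℂ × ℝ)) atTop :=
      (tendsto_dist_right_cocompact_atTop south).comp
        (WithLp.homeomorphProd 2 ℂ ℝ).symm.isClosedEmbedding.tendsto_cocompact
    refine tendsto_iff_dist_tendsto_zero.2 ?_
    simp only [Function.comp_apply, ballChart, OnePoint.elim_some, OnePoint.elim_infty, cayley,
      EuclideanGeometry.dist_inversion_center]
    exact hdist.const_div_atTop _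
  | coe x =>
    rw [OnePoint.continuousAt_coe]
    exact ContinuousAt.inversion continuousAt_const continuousAt_const htoLp.continuousAt
      (ne_south_of_nonneg (coe_mem_closedHalfSpace.1 hx))

theorem injective_ballChart : Function.Injective (closedHalfSpace.domRestrict ballChart) := by
  have hne : ∀ x : ℂ × ℝ, (x : OnePoint (ℂ × ℝ)) ∈ closedHalfSpace →
      cayley (WithLp.toLp 2 x) ≠ south := fun x hx h =>
    ne_south_of_nonneg (coe_mem_closedHalfSpace.1 hx)
      (cayley_involutive.injective (h.trans cayley_south.symm))
  rintro ⟨x, hx⟩ ⟨y, hy⟩ h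
  induction x using OnePoint.rec with
  | infty =>
    induction y using OnePoint.rec with
    | infty => rfl
    | coe y => exact absurd h.symm (hne y hy)
  | coe x =>
    induction y using OnePoint.rec with
    | infty => exact absurd h (hne x hx)
    | coe y =>
      obtain rfl := WithLp.toLp_injective 2 (cayley_involutive.injective h)
      rfl

theorem isEmbedding_ballChart : IsEmbedding (closedHalfSpace.domRestrict ballChart) :=
  have := isCompact_iff_compactSpace.1 isCompact_closedHalfSpace
  (continuousOn_ballChart.domRestrict.isClosedEmbedding injective_ballChart).isEmbedding

theorem atIdeal_eq_comap_ball (ξ : OnePoint ℂ) : atIdeal ξ = comap ball (𝓝 (idealBall ξ)) := by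
  let ξ' : closedHalfSpace := ⟨boundaryPoint ξ, boundaryPoint_mem ξ⟩
  let ι : Hyp3 → closedHalfSpace := fun p => ⟨interiorPoint p, interiorPoint_mem p⟩
  calc atIdeal ξ = comap ι (𝓝 ξ') := by
        rw [nhds_subtype_eq_comap, comap_comap]
        rfl
    _ = comap ball (𝓝 (idealBall ξ)) := by
        rw [isEmbedding_ballChart.nhds_eq_comap, comap_comap]
        rfl

theorem tendsto_atIdeal_iff_ball {α : Type*} {l : Filter α} {u : α → Hyp3} {ξ : OnePoint ℂ} :
    Tendsto u l (atIdeal ξ) ↔ Tendsto (fun i => ball (u i)) l (𝓝 (idealBall ξ)) := by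
  rw [atIdeal_eq_comap_ball, tendsto_comap_iff]
  rfl

theorem isClosedEmbedding_coe_zero : IsClosedEmbedding fun z : ℂ => ((z, 0) : ℂ × ℝ) :=
  .of_continuous_injective_isClosedMap (by fun_prop) (Prod.mk_left_injective 0)
    (isClosedMap_prodMk_right 0)

theorem continuous_boundaryPoint : Continuous boundaryPoint := by
  refine OnePoint.continuous_map (by fun_prop) ?_
  simpa only [coclosedCompact_eq_cocompact] using isClosedEmbedding_coe_zero.tendsto_cocompact

theorem boundaryPoint_injective : Function.Injective boundaryPoint :=
  Option.map_injective isClosedEmbedding_coe_zero.injective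

theorem isEmbedding_idealBall : IsEmbedding idealBall := by
  have hc : Continuous idealBall :=
    continuousOn_ballChart.comp_continuous continuous_boundaryPoint boundaryPoint_mem
  refine (hc.isClosedEmbedding fun ξ η h => boundaryPoint_injective ?_).isEmbedding
  exact congrArg Subtype.val (@injective_ballChart ⟨_, boundaryPoint_mem ξ⟩
    ⟨_, boundaryPoint_mem η⟩ h)

theorem tendsto_atIdeal_coe {α : Type*} {l : Filter α} {u : α → Hyp3} {z : ℂ} :
    Tendsto u l (atIdeal z) ↔
      Tendsto (fun i => (u i).z) l (𝓝 z) ∧ Tendsto (fun i => (u i).t) l (𝓝 0) := by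
  rw [atIdeal, tendsto_comap_iff]
  exact (OnePoint.isOpenEmbedding_coe.isInducing.tendsto_nhds_iff (f := fun i => (u i).coord)
    (y := (z, 0))).symm.trans
    (Prod.tendsto_iff _ _)

theorem tendsto_atIdeal_infty {α : Type*} {l : Filter α} {u : α → Hyp3} :
    Tendsto u l (atIdeal OnePoint.infty) ↔ Tendsto (fun i => ‖(u i).coord‖) l atTop := by
  rw [atIdeal, tendsto_comap_iff]
  change Tendsto ((↑) ∘ fun i => (u i).coord) l (𝓝 (OnePoint.infty : OnePoint (ℂ × ℝ))) ↔ _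
  rw [← tendsto_comap_iff, OnePoint.comap_coe_nhds_infty, coclosedCompact_eq_cocompact,
    ← Metric.cobounded_eq_cocompact, tendsto_norm_atTop_iff_cobounded]

instance (ξ : OnePoint ℂ) : (atIdeal ξ).NeBot := by
  rw [atIdeal_eq_comap_ball, comap_neBot_iff]
  intro s hs
  have hmem : idealBall ξ ∈ closure (Metric.ball 0 1) := by
    rw [closure_ball _ one_ne_zero, mem_closedBall_zero_iff, norm_idealBall]
  obtain ⟨u, hus, hu⟩ := mem_closure_iff_nhds.1 hmem s hs
  obtain ⟨p, rfl⟩ := mem_range_ball (mem_ball_zero_iff.1 hu)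
  exact ⟨p, hus⟩

theorem eq_of_tendsto_atIdeal {α : Type*} {l : Filter α} [l.NeBot] {u : α → Hyp3}
    {ξ η : OnePoint ℂ} (hξ : Tendsto u l (atIdeal ξ)) (hη : Tendsto u l (atIdeal η)) : ξ = η :=
  isEmbedding_idealBall.injective
    (tendsto_nhds_unique (tendsto_atIdeal_iff_ball.1 hξ) (tendsto_atIdeal_iff_ball.1 hη))

/-! ### Geodesics -/

theorem one_sub_tanh_sq (x : ℝ) : 1 - Real.tanh x ^ 2 = (Real.cosh x ^ 2)⁻¹ := by
  have := (Real.cosh_pos x).ne'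
  rw [Real.tanh_eq_sinh_div_cosh, div_pow, Real.sinh_sq]
  field_simp
  ring

theorem tanh_sub_tanh (x y : ℝ) :
    Real.tanh x - Real.tanh y = Real.sinh (x - y) / (Real.cosh x * Real.cosh y) := by
  have := (Real.cosh_pos x).ne'
  have := (Real.cosh_pos y).ne'
  rw [Real.tanh_eq_sinh_div_cosh, Real.tanh_eq_sinh_div_cosh, Real.sinh_sub]
  field_simp

theorem cosh_half_dist_base_of_ball {p : Hyp3} {x : ℝ} {u : E3} (hu : ‖u‖ = 1)
    (hp : ball p = Real.tanh x • u) : Real.cosh (dist p base / 2) = Real.cosh x := by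
  refine (sq_eq_sq₀ (Real.cosh_pos _).le (Real.cosh_pos _).le).1 (inv_injective ?_)
  rw [← one_sub_tanh_sq, ← one_sub_tanh_sq, ← norm_ball, hp, norm_smul, hu, mul_one,
    Real.norm_eq_abs, sq_abs]

theorem exists_isometry_ball_eq {u : E3} (hu : ‖u‖ = 1) :
    ∃ γ : ℝ → Hyp3, Isometry γ ∧ ∀ s, ball (γ s) = Real.tanh (s / 2) • u := by
  have hmem : ∀ s : ℝ, ‖Real.tanh (s / 2) • u‖ < 1 := fun s => by
    rw [norm_smul, hu, mul_one, Real.norm_eq_abs, ← sq_lt_one_iff_abs_lt_one, ← sub_pos,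
      one_sub_tanh_sq]
    exact inv_pos.2 (pow_pos (Real.cosh_pos _) 2)
  choose γ hγ using fun s => mem_range_ball (hmem s)
  refine ⟨γ, Isometry.of_dist_eq fun s s' => ?_, hγ⟩
  have hcosh := Real.cosh_pos (s / 2)
  have hcosh' := Real.cosh_pos (s' / 2)
  have hsinh : Real.sinh (dist (γ s) (γ s') / 2) = Real.sinh (|s - s'| / 2) := by
    have h := dist_ball (γ s) (γ s')
    rw [cosh_half_dist_base_of_ball hu (hγ s), cosh_half_dist_base_of_ball hu (hγ s'), hγ, hγ,
      dist_eq_norm, ← sub_smul, norm_smul, hu, mul_one, tanh_sub_tanh, norm_div,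
      Real.norm_of_nonneg (mul_pos hcosh hcosh').le] at h
    rw [← (div_left_inj' (mul_pos hcosh hcosh').ne').1 h, Real.norm_eq_abs, Real.abs_sinh,
      ← sub_div, abs_div, abs_two]
  rw [Real.dist_eq]
  linarith [Real.sinh_injective hsinh]

theorem exists_isometry_through_base (p : Hyp3) :
    ∃ γ : ℝ → Hyp3, Isometry γ ∧ γ 0 = base ∧ γ (dist base p) = p := by
  obtain ⟨u, hu, hpu⟩ : ∃ u : E3, ‖u‖ = 1 ∧ ball p = ‖ball p‖ • u := by
    obtain h | h := eq_or_ne (ball p) 0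
    · exact ⟨south, norm_south, by rw [h, norm_zero, zero_smul]⟩
    · exact ⟨‖ball p‖⁻¹ • ball p, norm_smul_inv_norm h,
        (smul_inv_smul₀ (norm_ne_zero_iff.2 h) _).symm⟩
  obtain ⟨γ, hγ, hball⟩ := exists_isometry_ball_eq hu
  refine ⟨γ, hγ, ball_injective ?_, ball_injective ?_⟩
  · rw [hball, zero_div, Real.tanh_zero, zero_smul, ball_base]
  · rw [hball, dist_comm, ← norm_ball, ← hpu]

theorem exists_isometry_real (p q : Hyp3) :
    ∃ γ : ℝ → Hyp3, Isometry γ ∧ γ 0 = p ∧ γ (dist p q) = q := by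
  obtain ⟨γ, hγ, h0, hd⟩ := exists_isometry_through_base ((fromBase p).symm q)
  refine ⟨fromBase p ∘ γ, (fromBase p).isometry.comp hγ, ?_, ?_⟩
  · rw [Function.comp_apply, h0, fromBase_base]
  · have hdist : dist p q = dist base ((fromBase p).symm q) := by
      rw [← (fromBase p).dist_eq base, fromBase_base, IsometryEquiv.apply_symm_apply]
    rw [Function.comp_apply, hdist, hd, IsometryEquiv.apply_symm_apply]

end Hyp3

/-! ### Bi-Lipschitz bijections -/

/-- A bijection of metric spaces that distorts distances by a factor of at most `K ≥ 1`; as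
opposed to `IsBL` it records the constant, in which compactness arguments have to be uniform. -/
structure BiLip {X Y : Type*} [MetricSpace X] [MetricSpace Y] (K : ℝ) (H : X ≃ Y) : Prop where
  one_le : 1 ≤ K
  le : ∀ x y, dist (H x) (H y) ≤ K * dist x y
  ge : ∀ x y, dist x y ≤ K * dist (H x) (H y)

namespace BiLip

variable {X Y Z : Type*} [MetricSpace X] [MetricSpace Y] [MetricSpace Z] {K : ℝ} {H : X ≃ Y}

theorem pos (hH : BiLip K H) : 0 < K := zero_lt_one.trans_le hH.one_le

theorem symm (hH : BiLip K H) : BiLip K H.symm where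
  one_le := hH.one_le
  le x y := by simpa using hH.ge (H.symm x) (H.symm y)
  ge x y := by simpa using hH.le (H.symm x) (H.symm y)

theorem of_isometry (φ : X ≃ᵢ Y) : BiLip 1 φ.toEquiv where
  one_le := le_rfl
  le x y := by simp [φ.dist_eq]
  ge x y := by simp [φ.dist_eq]

theorem trans_isometry (hH : BiLip K H) (φ : Y ≃ᵢ Z) : BiLip K (H.trans φ.toEquiv) where
  one_le := hH.one_le
  le x y := (φ.dist_eq _ _).trans_le (hH.le x y)
  ge x y := (hH.ge x y).trans_eq (congrArg (K * ·) (φ.dist_eq _ _).symm)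

theorem isometry_trans (hH : BiLip K H) (φ : Z ≃ᵢ X) : BiLip K (φ.toEquiv.trans H) where
  one_le := hH.one_le
  le x y := (hH.le (φ x) (φ y)).trans_eq (congrArg (K * ·) (φ.dist_eq x y))
  ge x y := (φ.dist_eq x y).symm.trans_le (hH.ge (φ x) (φ y))

protected theorem continuous (hH : BiLip K H) : Continuous H :=
  (LipschitzWith.of_dist_le_mul (K := ⟨K, hH.pos.le⟩) hH.le).continuous

/-- A bi-Lipschitz map with constant one, as an isometry. -/
def toIsometry (hH : BiLip 1 H) : X ≃ᵢ Y where
  toEquiv := H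
  isometry_toFun := Isometry.of_dist_eq fun x y =>
    le_antisymm (by simpa using hH.le x y) (by simpa using hH.ge x y)

theorem le_dist_of_le_dist (hH : BiLip K H) {o : X} {o' : Y} {R s : ℝ} (hR : dist (H o) o' ≤ R)
    {x : X} (hs : s ≤ dist x o) : s / K - R ≤ dist (H x) o' := by
  have h1 : s / K ≤ dist (H x) (H o) := (div_le_iff₀' hH.pos).2 (hs.trans (hH.ge x o))
  linarith [dist_triangle_right (H x) (H o) o', dist_comm o' (H o)]

section Ultralimit

variable {ι : Type*} (l : Ultrafilter ι) {F : ι → X ≃ Y}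

theorem exists_pointwise_tendsto [ProperSpace Y] {o : X} {o' : Y} {R : ℝ}
    (hF : ∀ᶠ i in l, BiLip K (F i)) (hR : ∀ᶠ i in l, dist (F i o) o' ≤ R) :
    ∃ G : X → Y, ∀ x, Tendsto (fun i => F i x) l (𝓝 (G x)) := by
  have hmem : ∀ x, ∀ᶠ i in l, F i x ∈ Metric.closedBall o' (R + K * dist x o) := fun x => by
    filter_upwards [hF, hR] with i hi hRi
    rw [Metric.mem_closedBall]
    linarith [dist_triangle (F i x) (F i o) o', hi.le x o]
  choose G hG using fun x => (isCompact_closedBall o' (R + K * dist x o)).ultrafilter_le_nhds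
    (l.map fun i => F i x) (le_principal_iff.2 (hmem x))
  exact ⟨G, fun x => (hG x).2⟩

theorem leftInverse_of_tendsto {G : X → Y} {G' : Y → X} (hF : ∀ᶠ i in l, BiLip K (F i))
    (hG : ∀ x, Tendsto (fun i => F i x) l (𝓝 (G x)))
    (hG' : ∀ y, Tendsto (fun i => (F i).symm y) l (𝓝 (G' y))) : Function.LeftInverse G' G := by
  intro x
  refine tendsto_nhds_unique (hG' (G x)) (tendsto_iff_dist_tendsto_zero.2 ?_)
  have h := (tendsto_iff_dist_tendsto_zero.1 (hG x)).const_mul K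
  rw [mul_zero] at h
  refine squeeze_zero' (Eventually.of_forall fun _ => dist_nonneg) ?_ h
  filter_upwards [hF] with i hi
  have := hi.symm.le (G x) (F i x)
  rwa [Equiv.symm_apply_apply, dist_comm (G x)] at this

theorem exists_ultralimit [ProperSpace X] [ProperSpace Y] {o : X} {o' : Y} {R : ℝ}
    (hF : ∀ᶠ i in l, BiLip K (F i)) (hR : ∀ᶠ i in l, dist (F i o) o' ≤ R) :
    ∃ G : X ≃ Y, BiLip K G ∧ ∀ x, Tendsto (fun i => F i x) l (𝓝 (G x)) := by
  have hF' : ∀ᶠ i in l, BiLip K (F i).symm := hF.mono fun _ hi => hi.symm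
  have hR' : ∀ᶠ i in l, dist ((F i).symm o') o ≤ K * R := by
    filter_upwards [hF, hR] with i hi hRi
    have := hi.symm.le o' (F i o)
    rw [Equiv.symm_apply_apply, dist_comm o'] at this
    exact this.trans (mul_le_mul_of_nonneg_left hRi hi.pos.le)
  obtain ⟨G, hG⟩ := exists_pointwise_tendsto l hF hR
  obtain ⟨G', hG'⟩ := exists_pointwise_tendsto l hF' hR'
  obtain ⟨_, hi⟩ := hF.exists
  refine ⟨⟨G, G', leftInverse_of_tendsto l hF hG hG', leftInverse_of_tendsto l hF' hG' hG⟩,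
    ⟨hi.one_le, fun x y => ?_, fun x y => ?_⟩, hG⟩
  · exact le_of_tendsto ((hG x).dist (hG y)) (hF.mono fun i hi => hi.le x y)
  · exact ge_of_tendsto (((hG x).dist (hG y)).const_mul K) (hF.mono fun i hi => hi.ge x y)

end Ultralimit

end BiLip

namespace Hyp3

/-! ### Boundary values of bi-Lipschitz maps -/

theorem dist_ball_le {p q : Hyp3} {s D : ℝ} (hp : s ≤ dist p base) (hq : s ≤ dist q base)
    (hD : dist p q ≤ D) : dist (ball p) (ball q) ≤ 4 * Real.sinh (D / 2) * Real.exp (-s) := by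
  have hcosh : ∀ {x : ℝ}, s ≤ x → Real.exp (s / 2) / 2 ≤ Real.cosh (x / 2) := fun {x} hx => by
    have := Real.exp_le_exp.2 (div_le_div_of_nonneg_right hx zero_le_two)
    rw [Real.cosh_eq]
    linarith [Real.exp_pos (-(x / 2))]
  have hpq : Real.exp s / 4 ≤ Real.cosh (dist p base / 2) * Real.cosh (dist q base / 2) := by
    calc Real.exp s / 4 = Real.exp (s / 2) / 2 * (Real.exp (s / 2) / 2) := by
          rw [div_mul_div_comm, ← Real.exp_add, add_halves]
          norm_num
      _ ≤ _ := mul_le_mul (hcosh hp) (hcosh hq) (by positivity) (Real.cosh_pos _).le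
  have hsinh : Real.sinh (dist p q / 2) ≤ Real.sinh (D / 2) := Real.sinh_le_sinh.2 (by linarith)
  have h0 : 0 ≤ Real.sinh (dist p q / 2) := Real.sinh_nonneg_iff.2 (by positivity)
  calc dist (ball p) (ball q)
      ≤ Real.sinh (D / 2) / (Real.exp s / 4) := by
        rw [dist_ball]
        exact div_le_div₀ (h0.trans hsinh) hsinh (by positivity) hpq
    _ = 4 * Real.sinh (D / 2) * Real.exp (-s) := by
        rw [Real.exp_neg]
        field_simp

theorem dist_le_of_dist_ball_le {p q : Hyp3} {s B : ℝ} (hp : dist p base ≤ s)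
    (hq : dist q base ≤ s) (h : dist (ball p) (ball q) ≤ B * Real.exp (-s)) :
    dist p q ≤ 2 * B := by
  have hcosh : ∀ {x : ℝ}, 0 ≤ x → x ≤ s → Real.cosh (x / 2) ≤ Real.exp (s / 2) :=
    fun {x} hx hxs => by
      have := Real.exp_le_exp.2 (div_le_div_of_nonneg_right hxs zero_le_two)
      have := Real.exp_le_exp.2 (show -(x / 2) ≤ x / 2 by linarith)
      rw [Real.cosh_eq]
      linarith
  have hB : 0 ≤ B := nonneg_of_mul_nonneg_left (dist_nonneg.trans h) (Real.exp_pos _)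
  have hc := mul_pos (Real.cosh_pos (dist p base / 2)) (Real.cosh_pos (dist q base / 2))
  have hsinh : Real.sinh (dist p q / 2) ≤ B := by
    rw [dist_ball, div_le_iff₀ hc] at h
    calc Real.sinh (dist p q / 2) ≤ _ := h
      _ ≤ B * Real.exp (-s) * (Real.exp (s / 2) * Real.exp (s / 2)) := by
        refine mul_le_mul_of_nonneg_left ?_ (mul_nonneg hB (Real.exp_pos _).le)
        exact mul_le_mul (hcosh dist_nonneg hp) (hcosh dist_nonneg hq) (Real.cosh_pos _).le
          (Real.exp_pos _).le
      _ = B := by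
        rw [← Real.exp_add, add_halves, mul_assoc, ← Real.exp_add, neg_add_cancel, Real.exp_zero,
          mul_one]
  linarith [Real.self_le_sinh_iff.2 (show 0 ≤ dist p q / 2 by positivity)]

theorem dist_le_of_unit_steps {X : Type*} [PseudoMetricSpace X] {f : ℝ → X} {A a : ℝ}
    (ha : 0 < a)
    (h : ∀ s s', 0 ≤ s → s ≤ s' → s' ≤ s + 1 → dist (f s) (f s') ≤ A * Real.exp (-(a * s)))
    {s s' : ℝ} (hs : 0 ≤ s) (hss' : s ≤ s') :
    dist (f s) (f s') ≤ A / (1 - Real.exp (-a)) * Real.exp (-(a * s)) := by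
  set r := Real.exp (-a) with hr
  have hr1 : 0 < 1 - r := sub_pos.2 (Real.exp_lt_one_iff.2 (neg_neg_of_pos ha))
  have hA : 0 ≤ A := nonneg_of_mul_nonneg_left
    (dist_nonneg.trans (h s s hs le_rfl (by linarith))) (Real.exp_pos _)
  have hA' : A ≤ A / (1 - r) := le_div_self hA hr1 (by linarith [Real.exp_pos (-a)])
  obtain ⟨n, hn⟩ := exists_nat_ge (s' - s)
  induction n generalizing s with
  | zero =>
    obtain rfl : s = s' := le_antisymm hss' (by simpa using hn)
    rw [dist_self]
    positivity
  | succ n ih =>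
    push_cast at hn
    obtain hle | hlt := le_or_gt s' (s + 1)
    · exact (h s s' hs hss' hle).trans (mul_le_mul_of_nonneg_right hA' (Real.exp_pos _).le)
    · calc dist (f s) (f s') ≤ dist (f s) (f (s + 1)) + dist (f (s + 1)) (f s') :=
            dist_triangle _ _ _
        _ ≤ A * Real.exp (-(a * s)) + A / (1 - r) * Real.exp (-(a * (s + 1))) :=
            add_le_add (h s (s + 1) hs (by linarith) le_rfl)
              (ih (by linarith) hlt.le (by linarith))
        _ = A / (1 - r) * Real.exp (-(a * s)) := by
            rw [mul_add_one, neg_add, Real.exp_add, ← hr]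
            field_simp
            ring

theorem _root_.BiLip.dist_ball_le {K R : ℝ} {H : Hyp3 ≃ Hyp3} (hH : BiLip K H)
    (hR : dist (H base) base ≤ R) {p q : Hyp3} {s D : ℝ} (hp : s ≤ dist p base)
    (hq : s ≤ dist q base) (hD : dist p q ≤ D) : dist (ball (H p)) (ball (H q)) ≤
      4 * Real.sinh (K * D / 2) * Real.exp R * Real.exp (-(s / K)) := by
  refine (Hyp3.dist_ball_le (hH.le_dist_of_le_dist hR hp) (hH.le_dist_of_le_dist hR hq)
    ((hH.le p q).trans (mul_le_mul_of_nonneg_left hD hH.pos.le))).trans_eq ?_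
  rw [neg_sub, sub_eq_add_neg, Real.exp_add]
  ring

/-- A geodesic from the base point moves away from it at unit speed, so that its image under a
bi-Lipschitz map has geometrically decreasing steps in the ball model. -/
theorem exists_dist_ball_isometry_le (K R : ℝ) : ∃ C, ∀ H : Hyp3 ≃ Hyp3, BiLip K H →
    dist (H base) base ≤ R → ∀ γ : ℝ → Hyp3, Isometry γ → γ 0 = base → ∀ s s', 0 ≤ s → s ≤ s' →
      dist (ball (H (γ s))) (ball (H (γ s'))) ≤ C * Real.exp (-(s / K)) := by
  refine ⟨4 * Real.sinh (K * 1 / 2) * Real.exp R / (1 - Real.exp (-K⁻¹)),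
    fun H hH hR γ hγ hγ0 s s' hs hss' => ?_⟩
  have hdepth : ∀ s, 0 ≤ s → dist (γ s) base = s := fun s hs => by
    rw [← hγ0, hγ.dist_eq, Real.dist_eq, sub_zero, abs_of_nonneg hs]
  simpa only [inv_mul_eq_div] using dist_le_of_unit_steps (f := fun s => ball (H (γ s)))
    (inv_pos.2 hH.pos) (fun s s' hs hss' hs' => by
      rw [inv_mul_eq_div]
      refine hH.dist_ball_le hR (hdepth s hs).ge (hss'.trans (hdepth s' (hs.trans hss')).ge) ?_
      rw [hγ.dist_eq, Real.dist_eq, abs_sub_comm, abs_of_nonneg (sub_nonneg.2 hss')]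
      exact sub_le_iff_le_add'.2 hs') hs hss'

/-- Bi-Lipschitz maps are Hölder continuous at infinity, uniformly in the ball model: two points
that are close to each other and to the boundary are pulled back along geodesics to a depth at
which they have bounded hyperbolic distance. -/
theorem exists_dist_ball_le (K R : ℝ) : ∃ C, ∀ H : Hyp3 ≃ Hyp3, BiLip K H →
    dist (H base) base ≤ R → ∀ s, 0 ≤ s → ∀ p q, s ≤ dist p base → s ≤ dist q base →
      dist (ball p) (ball q) ≤ Real.exp (-s) →
      dist (ball (H p)) (ball (H q)) ≤ C * Real.exp (-(s / K)) := by
  obtain ⟨C, hC⟩ := exists_dist_ball_isometry_le K R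
  obtain ⟨C₁, hC₁⟩ := exists_dist_ball_isometry_le 1 0
  refine ⟨2 * C + 4 * Real.sinh (K * (2 * (2 * C₁ + 1)) / 2) * Real.exp R,
    fun H hH hR s hs p q hp hq hpq => ?_⟩
  have htruncate : ∀ p, s ≤ dist p base → ∃ p', dist p' base = s ∧
      dist (ball (H p')) (ball (H p)) ≤ C * Real.exp (-(s / K)) ∧
      dist (ball p') (ball p) ≤ C₁ * Real.exp (-s) := fun p hp => by
    obtain ⟨γ, hγ, h0, hγp⟩ := exists_isometry_through_base p
    rw [dist_comm] at hp
    refine ⟨γ s, ?_, ?_, ?_⟩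
    · rw [← h0, hγ.dist_eq, Real.dist_eq, sub_zero, abs_of_nonneg hs]
    · have h := hC H hH hR γ hγ h0 s _ hs hp
      rwa [hγp] at h
    · have h := hC₁ _ (BiLip.of_isometry (.refl Hyp3)) (dist_self base).le γ hγ h0 s _ hs hp
      rwa [hγp, div_one] at h
  obtain ⟨p', hps, hHp, hpp'⟩ := htruncate p hp
  obtain ⟨q', hqs, hHq, hqq'⟩ := htruncate q hq
  have hball : dist (ball p') (ball q') ≤ (2 * C₁ + 1) * Real.exp (-s) := by
    linarith [dist_triangle4_right (ball p') (ball q') (ball p) (ball q)]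
  have hHball := hH.dist_ball_le hR hps.ge hqs.ge (dist_le_of_dist_ball_le hps.le hqs.le hball)
  linarith [dist_triangle4_left (ball (H p')) (ball (H q')) (ball (H p)) (ball (H q))]

theorem tendsto_norm_ball_iff {α : Type*} {l : Filter α} {u : α → Hyp3} :
    Tendsto (fun i => ‖ball (u i)‖) l (𝓝 1) ↔ Tendsto (fun i => dist (u i) base) l atTop := by
  have hsq : ∀ p, ‖ball p‖ ^ 2 = 1 - (Real.cosh (dist p base / 2) ^ 2)⁻¹ := fun p => by
    rw [← one_sub_tanh_sq, norm_ball, sub_sub_cancel]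
  constructor
  · intro h
    refine tendsto_atTop.2 fun s => ?_
    filter_upwards [h.eventually (lt_mem_nhds (Real.tanh_lt_one (s / 2)))] with i hi
    rw [norm_ball, ← sub_pos, tanh_sub_tanh, div_pos_iff_of_pos_right
      (mul_pos (Real.cosh_pos _) (Real.cosh_pos _)), Real.sinh_pos_iff] at hi
    linarith
  · intro h
    have hcosh : Tendsto (fun i => Real.cosh (dist (u i) base / 2)) l atTop :=
      tendsto_atTop_mono (fun i => (Real.self_le_sinh_iff.2 (by positivity)).trans
        (Real.sinh_lt_cosh _).le) (h.atTop_div_const two_pos)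
    have hlim : Tendsto (fun i => ‖ball (u i)‖ ^ 2) l (𝓝 1) := by
      simpa only [hsq, Function.comp_apply, sub_zero] using
        ((tendsto_inv_atTop_zero.comp ((tendsto_pow_atTop two_ne_zero).comp hcosh)).const_sub 1)
    simpa only [Real.sqrt_sq (norm_nonneg _), Real.sqrt_one] using hlim.sqrt

theorem tendsto_ball_atIdeal (ξ : OnePoint ℂ) : Tendsto ball (atIdeal ξ) (𝓝 (idealBall ξ)) :=
  tendsto_atIdeal_iff_ball.1 tendsto_id

theorem tendsto_dist_base_atIdeal (ξ : OnePoint ℂ) :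
    Tendsto (fun p => dist p base) (atIdeal ξ) atTop :=
  tendsto_norm_ball_iff.1 (norm_idealBall ξ ▸ (tendsto_ball_atIdeal ξ).norm)

theorem eventually_atIdeal (ξ : OnePoint ℂ) (s : ℝ) {r : ℝ} (hr : 0 < r) :
    ∀ᶠ p in atIdeal ξ, s ≤ dist p base ∧ dist (ball p) (idealBall ξ) < r :=
  ((tendsto_dist_base_atIdeal ξ).eventually_ge_atTop s).and
    ((tendsto_ball_atIdeal ξ).eventually (Metric.ball_mem_nhds _ hr))

theorem exists_mul_exp_neg_div_lt {K : ℝ} (hK : 0 < K) (C : ℝ) {ε : ℝ} (hε : 0 < ε) :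
    ∃ s, 0 ≤ s ∧ C * Real.exp (-(s / K)) < ε := by
  have h : Tendsto (fun s : ℝ => C * Real.exp (-(s / K))) atTop (𝓝 (C * 0)) :=
    (Real.tendsto_exp_neg_atTop_nhds_zero.comp (tendsto_id.atTop_div_const hK)).const_mul C
  rw [mul_zero] at h
  exact ((eventually_ge_atTop 0).and (h.eventually (gt_mem_nhds hε))).exists

theorem _root_.BiLip.tendsto_dist_base {K : ℝ} {H : Hyp3 ≃ Hyp3} (hH : BiLip K H)
    (ξ : OnePoint ℂ) : Tendsto (fun p => dist (H p) base) (atIdeal ξ) atTop :=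
  tendsto_atTop_mono (fun _ => hH.le_dist_of_le_dist le_rfl le_rfl)
    (tendsto_atTop_add_const_right _ _ ((tendsto_dist_base_atIdeal ξ).atTop_div_const hH.pos))

theorem _root_.BiLip.cauchy_map_ball {K : ℝ} {H : Hyp3 ≃ Hyp3} (hH : BiLip K H) (ξ : OnePoint ℂ) :
    Cauchy (map (fun p => ball (H p)) (atIdeal ξ)) := by
  obtain ⟨C, hC⟩ := exists_dist_ball_le K (dist (H base) base)
  refine Metric.cauchy_iff.2 ⟨inferInstance, fun ε hε => ?_⟩
  obtain ⟨s, hs, hsε⟩ := exists_mul_exp_neg_div_lt hH.pos C hε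
  refine ⟨_, image_mem_map (eventually_atIdeal ξ s (half_pos (Real.exp_pos (-s)))), ?_⟩
  rintro _ ⟨p, ⟨hp, hpξ⟩, rfl⟩ _ ⟨q, ⟨hq, hqξ⟩, rfl⟩
  refine (hC H hH le_rfl s hs p q hp hq ?_).trans_lt hsε
  linarith [dist_triangle_right (ball p) (ball q) (idealBall ξ)]

theorem _root_.BiLip.exists_tendsto {K : ℝ} {H : Hyp3 ≃ Hyp3} (hH : BiLip K H) (ξ : OnePoint ℂ) :
    ∃ η, Tendsto H (atIdeal ξ) (atIdeal η) := by
  obtain ⟨u, hu⟩ := cauchy_map_iff_exists_tendsto.1 (hH.cauchy_map_ball ξ)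
  obtain ⟨η, rfl⟩ := mem_range_idealBall
    (tendsto_nhds_unique hu.norm (tendsto_norm_ball_iff.2 (hH.tendsto_dist_base ξ)))
  exact ⟨η, tendsto_atIdeal_iff_ball.2 hu⟩

open Classical in
/-- The boundary value map of a self-map of hyperbolic space, with the junk value `ξ` at the ideal
points `ξ` at which there is no boundary value. -/
def bdry (H : Hyp3 → Hyp3) (ξ : OnePoint ℂ) : OnePoint ℂ :=
  if h : ∃ η, Tendsto H (atIdeal ξ) (atIdeal η) then h.choose else ξ

theorem bdry_eq {H : Hyp3 → Hyp3} {ξ η : OnePoint ℂ} (h : Tendsto H (atIdeal ξ) (atIdeal η)) :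
    bdry H ξ = η := by
  have hex : ∃ η, Tendsto H (atIdeal ξ) (atIdeal η) := ⟨η, h⟩
  rw [bdry, dif_pos hex]
  exact eq_of_tendsto_atIdeal hex.choose_spec h

theorem _root_.BiLip.tendsto_bdry {K : ℝ} {H : Hyp3 ≃ Hyp3} (hH : BiLip K H) (ξ : OnePoint ℂ) :
    Tendsto H (atIdeal ξ) (atIdeal (bdry H ξ)) := by
  obtain ⟨η, h⟩ := hH.exists_tendsto ξ
  rwa [bdry_eq h]

theorem tendsto_bdry_isometry (φ : Hyp3 ≃ᵢ Hyp3) (ξ : OnePoint ℂ) :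
    Tendsto φ (atIdeal ξ) (atIdeal (bdry φ ξ)) :=
  (BiLip.of_isometry φ).tendsto_bdry ξ

theorem bdry_id (ξ : OnePoint ℂ) : bdry id ξ = ξ := bdry_eq tendsto_id

theorem bdry_comp {H G : Hyp3 → Hyp3} {ξ : OnePoint ℂ}
    (hG : Tendsto G (atIdeal ξ) (atIdeal (bdry G ξ)))
    (hH : Tendsto H (atIdeal (bdry G ξ)) (atIdeal (bdry H (bdry G ξ)))) :
    bdry (H ∘ G) ξ = bdry H (bdry G ξ) :=
  bdry_eq (hH.comp hG)

theorem _root_.BiLip.bdry_symm_bdry {K : ℝ} {H : Hyp3 ≃ Hyp3} (hH : BiLip K H) (ξ : OnePoint ℂ) :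
    bdry H.symm (bdry H ξ) = ξ := by
  rw [← bdry_comp (hH.tendsto_bdry ξ) (hH.symm.tendsto_bdry _), Equiv.symm_comp_self, bdry_id]

theorem _root_.BiLip.bdry_bdry_symm {K : ℝ} {H : Hyp3 ≃ Hyp3} (hH : BiLip K H) (ξ : OnePoint ℂ) :
    bdry H (bdry H.symm ξ) = ξ := hH.symm.bdry_symm_bdry ξ

theorem bdry_symm_bdry_isometry (φ : Hyp3 ≃ᵢ Hyp3) (ξ : OnePoint ℂ) :
    bdry φ.symm (bdry φ ξ) = ξ := (BiLip.of_isometry φ).bdry_symm_bdry ξ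

theorem bdry_bdry_symm_isometry (φ : Hyp3 ≃ᵢ Hyp3) (ξ : OnePoint ℂ) :
    bdry φ (bdry φ.symm ξ) = ξ := (BiLip.of_isometry φ).bdry_bdry_symm ξ

theorem _root_.BiLip.bdry_injective {K : ℝ} {H : Hyp3 ≃ Hyp3} (hH : BiLip K H) :
    Function.Injective (bdry H) :=
  Function.LeftInverse.injective hH.bdry_symm_bdry

theorem continuous_ball : Continuous ball := by
  refine continuous_iff_continuousAt.2 fun p => ?_
  exact ContinuousAt.inversion continuousAt_const continuousAt_const
    ((WithLp.prod_continuous_toLp 2 ℂ ℝ).comp isOpenEmbedding_coord.continuous).continuousAt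
    p.euclid_ne_south

theorem exists_dist_ball_bdry_le (K R : ℝ) : ∃ C, ∀ H : Hyp3 ≃ Hyp3, BiLip K H →
    dist (H base) base ≤ R → ∀ s, 0 ≤ s → ∀ p ξ, s ≤ dist p base →
      dist (ball p) (idealBall ξ) < Real.exp (-s) →
      dist (ball (H p)) (idealBall (bdry H ξ)) ≤ C * Real.exp (-(s / K)) := by
  obtain ⟨C, hC⟩ := exists_dist_ball_le K R
  refine ⟨C, fun H hH hR s hs p ξ hp hpξ => ?_⟩
  have hlim := tendsto_atIdeal_iff_ball.1 (hH.tendsto_bdry ξ)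
  refine le_of_tendsto (tendsto_const_nhds.dist hlim) ?_
  filter_upwards [(tendsto_dist_base_atIdeal ξ).eventually_ge_atTop s,
    (tendsto_const_nhds.dist (tendsto_ball_atIdeal ξ)).eventually (gt_mem_nhds hpξ)] with q hq hpq
  exact hC H hH hR s hs p q hp hq hpq.le

theorem tendsto_bdry {ι : Type*} {l : Filter ι} {K : ℝ} {F : ι → Hyp3 ≃ Hyp3} {G : Hyp3 ≃ Hyp3}
    (hF : ∀ᶠ i in l, BiLip K (F i)) (hG : BiLip K G)
    (hlim : ∀ p, Tendsto (fun i => F i p) l (𝓝 (G p))) {ξ : OnePoint ℂ} {u : ι → OnePoint ℂ}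
    (hu : Tendsto u l (𝓝 ξ)) : Tendsto (fun i => bdry (F i) (u i)) l (𝓝 (bdry G ξ)) := by
  obtain ⟨C, hC⟩ := exists_dist_ball_bdry_le K (dist (G base) base + 1)
  rw [isEmbedding_idealBall.tendsto_nhds_iff, Metric.tendsto_nhds]
  intro ε hε
  obtain ⟨s, hs, hsε⟩ := exists_mul_exp_neg_div_lt hG.pos C (div_pos hε three_pos)
  obtain ⟨p, hp, hpξ⟩ := (eventually_atIdeal ξ s (Real.exp_pos (-s))).exists
  have hξ : ∀ᶠ i in l, dist (ball p) (idealBall (u i)) < Real.exp (-s) :=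
    (tendsto_const_nhds.dist (isEmbedding_idealBall.tendsto_nhds_iff.1 hu)).eventually
      (gt_mem_nhds hpξ)
  have hR : ∀ᶠ i in l, dist (F i base) base < dist (G base) base + 1 :=
    ((hlim base).dist tendsto_const_nhds).eventually (gt_mem_nhds (lt_add_one _))
  have hFG : ∀ᶠ i in l, dist (ball (F i p)) (ball (G p)) < ε / 3 :=
    ((continuous_ball.tendsto _).comp (hlim p)).eventually
      (Metric.ball_mem_nhds _ (div_pos hε three_pos))
  filter_upwards [hF, hR, hξ, hFG] with i hi hiR hiξ hiG
  have hbdryF := hC (F i) hi hiR.le s hs p (u i) hp hiξ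
  have hbdryG := hC G hG (lt_add_one _).le s hs p ξ hp hpξ
  rw [dist_comm] at hbdryF
  rw [Function.comp_apply]
  linarith [dist_triangle4 (idealBall (bdry (F i) (u i))) (ball (F i p)) (ball (G p))
    (idealBall (bdry G ξ))]

theorem _root_.BiLip.continuous_bdry {K : ℝ} {H : Hyp3 ≃ Hyp3} (hH : BiLip K H) :
    Continuous (bdry H) :=
  continuous_iff_continuousAt.2 fun _ => tendsto_bdry (Eventually.of_forall fun _ => hH) hH
    (fun _ => tendsto_const_nhds) tendsto_id

/-- The homeomorphism of the Riemann sphere given by the boundary values of a bi-Lipschitz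
bijection of hyperbolic space. -/
def _root_.BiLip.bdryHomeo {K : ℝ} {H : Hyp3 ≃ Hyp3} (hH : BiLip K H) :
    OnePoint ℂ ≃ₜ OnePoint ℂ where
  toFun := bdry H
  invFun := bdry H.symm
  left_inv := hH.bdry_symm_bdry
  right_inv := hH.bdry_bdry_symm
  continuous_toFun := hH.continuous_bdry
  continuous_invFun := hH.symm.continuous_bdry

theorem _root_.BiLip.isBoundaryExtension {K : ℝ} {H : Hyp3 ≃ Hyp3} (hH : BiLip K H) :
    IsBoundaryExtension H hH.bdryHomeo := fun ξ => by
  have h := hH.tendsto_bdry ξ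
  rwa [atIdeal, atIdeal, tendsto_comap_iff] at h

/-! ### Isometries and their boundary values -/

section similarity

variable (Ψ : ℂ ≃ ℂ) (l : ℝ) (hl : 0 < l) (hΨ : ∀ z w, ‖Ψ z - Ψ w‖ = l * ‖z - w‖)

theorem bdry_similarity_coe (z : ℂ) : bdry (similarity Ψ l hl hΨ) z = Ψ z := by
  have hc : Continuous Ψ := (LipschitzWith.of_dist_le_mul (K := ⟨l, hl.le⟩) fun z w => by
    rw [dist_eq_norm, dist_eq_norm, hΨ]
    rfl).continuous
  have h := (tendsto_atIdeal_coe (u := id) (z := z)).1 tendsto_id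
  refine bdry_eq (tendsto_atIdeal_coe.2 ⟨(hc.tendsto z).comp h.1, ?_⟩)
  simpa using h.2.const_mul l

theorem bdry_similarity_infty :
    bdry (similarity Ψ l hl hΨ) OnePoint.infty = OnePoint.infty := by
  by_contra hne
  obtain ⟨z, hz⟩ := OnePoint.ne_infty_iff_exists.1 hne
  have h := bdry_similarity_coe Ψ l hl hΨ (Ψ.symm z)
  rw [Equiv.apply_symm_apply, hz] at h
  exact OnePoint.coe_ne_infty _ ((BiLip.of_isometry (similarity Ψ l hl hΨ)).bdry_injective h)

end similarity

theorem bdry_trans (φ ψ : Hyp3 ≃ᵢ Hyp3) (ξ : OnePoint ℂ) :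
    bdry (φ.trans ψ) ξ = bdry ψ (bdry φ ξ) :=
  bdry_comp (tendsto_bdry_isometry φ ξ) (tendsto_bdry_isometry ψ _)

theorem norm_euclid_inversion (p : Hyp3) : ‖euclid (inversion p)‖ = ‖euclid p‖⁻¹ := by
  rw [← dist_zero_right, euclid_inversion, EuclideanGeometry.dist_inversion_center, one_pow,
    dist_zero_right, one_div]

theorem tendsto_inversion_infty :
    Tendsto inversion (atIdeal OnePoint.infty) (atIdeal (0 : ℂ)) := by
  have hcoord : Tendsto (fun p : Hyp3 => ‖p.coord‖) (atIdeal OnePoint.infty) atTop :=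
    tendsto_atIdeal_infty.1 tendsto_id
  have heuclid : Tendsto (fun p => ‖euclid p‖) (atIdeal OnePoint.infty) atTop :=
    tendsto_atTop_mono (fun p => max_le (WithLp.norm_fst_le _ (euclid p))
      (WithLp.norm_snd_le _ (euclid p))) hcoord
  have hlim : Tendsto (fun p => euclid (inversion p)) (atIdeal OnePoint.infty) (𝓝 0) := by
    rw [tendsto_zero_iff_norm_tendsto_zero]
    exact heuclid.inv_tendsto_atTop.congr fun p => (norm_euclid_inversion p).symm
  exact tendsto_atIdeal_coe.2
    ⟨((WithLp.prod_continuous_ofLp 2 ℂ ℝ).fst.tendsto 0).comp hlim,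
      ((WithLp.prod_continuous_ofLp 2 ℂ ℝ).snd.tendsto 0).comp hlim⟩

theorem bdry_inversion_infty : bdry inversion OnePoint.infty = (0 : ℂ) :=
  bdry_eq tendsto_inversion_infty

theorem bdry_inversion_zero : bdry inversion (0 : ℂ) = OnePoint.infty := by
  rw [← bdry_inversion_infty, ← bdry_trans]
  exact (congrArg (bdry · _) (funext inversion_inversion)).trans (bdry_id _)

theorem bdry_inversion_coe {z : ℂ} (hz : z ≠ 0) :
    bdry inversion z = ((starRingEnd ℂ z)⁻¹ : ℂ) := by
  have h := (tendsto_atIdeal_coe (u := id) (z := z)).1 tendsto_id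
  have hinv : Tendsto (fun p : Hyp3 => (‖p.z‖ ^ 2 + p.t ^ 2)⁻¹) (atIdeal z)
      (𝓝 (‖z‖ ^ 2)⁻¹) := by
    have : Tendsto (fun p : Hyp3 => ‖p.z‖ ^ 2 + p.t ^ 2) (atIdeal z) (𝓝 (‖z‖ ^ 2)) := by
      simpa using (h.1.norm.pow 2).add (h.2.pow 2)
    exact this.inv₀ (by positivity)
  have hconj : (starRingEnd ℂ z)⁻¹ = (‖z‖ ^ 2)⁻¹ • z := by
    rw [Complex.inv_def, Complex.conj_conj, Complex.normSq_conj, Complex.normSq_eq_norm_sq,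
      Complex.real_smul, mul_comm]
  refine bdry_eq (tendsto_atIdeal_coe.2 ⟨?_, ?_⟩)
  · rw [hconj]
    exact hinv.smul h.1
  · simpa only [mul_zero, id_eq, inversion_t] using hinv.mul h.2

theorem tendsto_cosh_dist_div_zero (a b : Hyp3) :
    Tendsto (fun p => Real.cosh (dist p a) / Real.cosh (dist p b)) (atIdeal (0 : ℂ))
      (𝓝 ((‖euclid a‖ ^ 2 / (2 * a.t)) / (‖euclid b‖ ^ 2 / (2 * b.t)))) := by
  have h := (tendsto_atIdeal_coe (u := id) (z := 0)).1 tendsto_id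
  have hN : ∀ a : Hyp3, Tendsto (fun p : Hyp3 => (‖p.z - a.z‖ ^ 2 + p.t ^ 2 + a.t ^ 2) /
      (2 * a.t)) (atIdeal (0 : ℂ)) (𝓝 (‖euclid a‖ ^ 2 / (2 * a.t))) := fun a => by
    have := ((((h.1.sub_const a.z).norm.pow 2).add (h.2.pow 2)).add_const (a.t ^ 2)).div_const
      (2 * a.t)
    simpa [norm_euclid_sq] using this
  have hb : 0 < ‖euclid b‖ := norm_pos_iff.2 b.euclid_ne_zero
  have hbt := b.t_pos
  refine ((hN a).div (hN b) (by positivity)).congr fun p => ?_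
  have hp := p.t_pos
  have ha := a.t_pos
  have : 0 < ‖p.z - b.z‖ ^ 2 + p.t ^ 2 + b.t ^ 2 := by positivity
  rw [cosh_dist, cosh_dist, Pi.div_apply]
  field_simp

/-- This is the Busemann cocycle at `∞`, so that isometries fixing `∞` scale all heights by the
same factor. -/
theorem tendsto_cosh_dist_div_infty (a b : Hyp3) :
    Tendsto (fun p => Real.cosh (dist p a) / Real.cosh (dist p b)) (atIdeal OnePoint.infty)
      (𝓝 (b.t / a.t)) := by
  have hdiv : ∀ a : Hyp3, ‖euclid (inversion a)‖ ^ 2 / (2 * (inversion a).t) = (2 * a.t)⁻¹ :=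
    fun a => by
      have ha := a.t_pos
      have : 0 < ‖euclid a‖ := norm_pos_iff.2 a.euclid_ne_zero
      rw [norm_euclid_inversion, inversion_t, ← norm_euclid_sq]
      field_simp
  have h := (tendsto_cosh_dist_div_zero (inversion a) (inversion b)).comp tendsto_inversion_infty
  simp only [Function.comp_def, inversion.dist_eq, hdiv] at h
  have ha := a.t_pos
  have hb := b.t_pos
  convert h using 2
  field_simp

section FixesInfty

variable {φ : Hyp3 ≃ᵢ Hyp3}

theorem t_eq_mul_of_bdry_infty (hφ : bdry φ OnePoint.infty = OnePoint.infty) (a : Hyp3) :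
    (φ a).t = (φ base).t * a.t := by
  have hlim : Tendsto φ (atIdeal OnePoint.infty) (atIdeal OnePoint.infty) := by
    simpa only [hφ] using tendsto_bdry_isometry φ OnePoint.infty
  have h := tendsto_nhds_unique
    (((tendsto_cosh_dist_div_infty (φ base) (φ a)).comp hlim).congr fun p => by simp [φ.dist_eq])
    (tendsto_cosh_dist_div_infty base a)
  rwa [base_t, div_one, div_eq_iff (φ base).t_pos.ne', mul_comm] at h

theorem norm_z_sub_eq_of_bdry_infty (hφ : bdry φ OnePoint.infty = OnePoint.infty) (a b : Hyp3) :
    ‖(φ a).z - (φ b).z‖ = (φ base).t * ‖a.z - b.z‖ := by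
  have hl := (φ base).t_pos
  have ha := a.t_pos
  have hb := b.t_pos
  have h : Real.cosh (dist (φ a) (φ b)) = Real.cosh (dist a b) := by rw [φ.dist_eq]
  rw [cosh_dist, cosh_dist, t_eq_mul_of_bdry_infty hφ a, t_eq_mul_of_bdry_infty hφ b,
    div_eq_div_iff (by positivity) (by positivity)] at h
  refine (sq_eq_sq₀ (norm_nonneg _) (by positivity)).1 ?_
  refine mul_left_cancel₀ (by positivity : 2 * a.t * b.t ≠ 0) ?_
  linear_combination h

theorem z_eq_of_bdry_infty (hφ : bdry φ OnePoint.infty = OnePoint.infty) (a b : Hyp3)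
    (h : a.z = b.z) : (φ a).z = (φ b).z := by
  rw [← sub_eq_zero, ← norm_eq_zero, norm_z_sub_eq_of_bdry_infty hφ, h, sub_self, norm_zero,
    mul_zero]

theorem exists_eq_similarity (hφ : bdry φ OnePoint.infty = OnePoint.infty) :
    ∃ (Ψ : ℂ ≃ ℂ) (l : ℝ) (hl : 0 < l) (hΨ : ∀ z w, ‖Ψ z - Ψ w‖ = l * ‖z - w‖),
      φ = similarity Ψ l hl hΨ := by
  have hφ' : bdry φ.symm OnePoint.infty = OnePoint.infty := by
    conv_lhs => rw [← hφ, bdry_symm_bdry_isometry]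
  let Ψ : ℂ ≃ ℂ :=
    { toFun := fun z => (φ ⟨z, 1, one_pos⟩).z
      invFun := fun z => (φ.symm ⟨z, 1, one_pos⟩).z
      left_inv := fun z =>
        (z_eq_of_bdry_infty hφ' ⟨_, 1, one_pos⟩ (φ ⟨z, 1, one_pos⟩) rfl).trans
          (congrArg Hyp3.z (φ.symm_apply_apply _))
      right_inv := fun z =>
        (z_eq_of_bdry_infty hφ ⟨_, 1, one_pos⟩ (φ.symm ⟨z, 1, one_pos⟩) rfl).trans
          (congrArg Hyp3.z (φ.apply_symm_apply _)) }
  refine ⟨Ψ, (φ base).t, (φ base).t_pos, fun z w => norm_z_sub_eq_of_bdry_infty hφ _ _, ?_⟩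
  exact IsometryEquiv.ext fun p =>
    Hyp3.ext (z_eq_of_bdry_infty hφ p ⟨p.z, 1, one_pos⟩ rfl) (t_eq_mul_of_bdry_infty hφ p)

end FixesInfty

theorem apply_eq_self_of_bdry_eq (φ : Hyp3 ≃ᵢ Hyp3) (h : ∀ ξ, bdry φ ξ = ξ) (p : Hyp3) :
    φ p = p := by
  obtain ⟨Ψ, l, hl, hΨ, rfl⟩ := exists_eq_similarity (h OnePoint.infty)
  have hid : ∀ z, Ψ z = z := fun z => by
    have := h z
    rw [bdry_similarity_coe] at this
    exact OnePoint.coe_injective this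
  have h1 := hΨ 1 0
  rw [hid, hid, sub_zero, norm_one, mul_one] at h1
  ext
  · exact hid _
  · rw [similarity_t, ← h1, one_mul]

/-- The translation by `c` along the boundary plane. -/
def translation (c : ℂ) : Hyp3 ≃ᵢ Hyp3 :=
  similarity (Equiv.addRight c) 1 one_pos fun z w => by simp

theorem bdry_translation_coe (c z : ℂ) : bdry (translation c) z = (z + c : ℂ) :=
  bdry_similarity_coe _ _ _ _ z

theorem bdry_translation_infty (c : ℂ) : bdry (translation c) OnePoint.infty = OnePoint.infty :=
  bdry_similarity_infty _ _ _ _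

theorem exists_eq_inversion (φ : Hyp3 ≃ᵢ Hyp3) {c : ℂ} (hφ : bdry φ OnePoint.infty = c) :
    ∃ (Ψ : ℂ ≃ ℂ) (l : ℝ) (hl : 0 < l) (hΨ : ∀ z w, ‖Ψ z - Ψ w‖ = l * ‖z - w‖),
      φ = ((similarity Ψ l hl hΨ).trans inversion).trans (translation c) := by
  obtain ⟨Ψ, l, hl, hΨ, h⟩ := exists_eq_similarity
    (φ := (φ.trans (translation c).symm).trans inversion) (by
      rw [bdry_trans, bdry_trans, hφ]
      have : bdry (translation c).symm c = (0 : ℂ) := by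
        rw [← bdry_symm_bdry_isometry (translation c) (0 : ℂ), bdry_translation_coe, zero_add]
      rw [this, bdry_inversion_zero])
  refine ⟨Ψ, l, hl, hΨ, ?_⟩
  rw [← h]
  refine IsometryEquiv.ext fun p => ?_
  simp [inversion_inversion]

theorem exists_norm_bdry (φ : Hyp3 ≃ᵢ Hyp3) {c w : ℂ} (hc : bdry φ OnePoint.infty = c)
    (hw : bdry φ w = OnePoint.infty) :
    ∃ m : ℝ, 0 < m ∧ ∃ f : ℂ → ℂ, (∀ x, x ≠ w → bdry φ x = f x) ∧
      (∀ x, x ≠ w → ‖f x - c‖ = m / ‖x - w‖) ∧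
      ∀ x y, x ≠ w → y ≠ w → ‖f x - f y‖ = m * ‖x - y‖ / (‖x - w‖ * ‖y - w‖) := by
  obtain ⟨Ψ, l, hl, hΨ, rfl⟩ := exists_eq_inversion φ hc
  have hΨw : Ψ w = 0 := by
    by_contra hne
    rw [bdry_trans, bdry_trans, bdry_similarity_coe, bdry_inversion_coe hne,
      bdry_translation_coe] at hw
    exact OnePoint.coe_ne_infty _ hw
  have hne : ∀ x, x ≠ w → Ψ x ≠ 0 := fun x hx h => hx (Ψ.injective (h.trans hΨw.symm))
  have hnorm : ∀ x, ‖Ψ x‖ = l * ‖x - w‖ := fun x => by rw [← hΨ, hΨw, sub_zero]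
  refine ⟨l⁻¹, inv_pos.2 hl, fun x => (starRingEnd ℂ (Ψ x))⁻¹ + c, fun x hx => ?_, fun x hx => ?_,
    fun x y hx hy => ?_⟩
  · rw [bdry_trans, bdry_trans, bdry_similarity_coe, bdry_inversion_coe (hne x hx),
      bdry_translation_coe]
  · have : ‖x - w‖ ≠ 0 := norm_ne_zero_iff.2 (sub_ne_zero.2 hx)
    rw [add_sub_cancel_right, norm_inv, RCLike.norm_conj, hnorm]
    field_simp
  · have h1 : ‖x - w‖ ≠ 0 := norm_ne_zero_iff.2 (sub_ne_zero.2 hx)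
    have h2 : ‖y - w‖ ≠ 0 := norm_ne_zero_iff.2 (sub_ne_zero.2 hy)
    have hx' : starRingEnd ℂ (Ψ x) ≠ 0 := by simpa using hne x hx
    have hy' : starRingEnd ℂ (Ψ y) ≠ 0 := by simpa using hne y hy
    rw [add_sub_add_right_eq_sub, inv_sub_inv hx' hy', norm_div, norm_mul, ← map_sub,
      RCLike.norm_conj, RCLike.norm_conj, RCLike.norm_conj, hnorm, hnorm, hΨ, norm_sub_rev]
    field_simp

theorem exists_eq_affine_of_norm_sub_eq (Ψ : ℂ ≃ ℂ) (l : ℝ) (hl : 0 < l)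
    (hΨ : ∀ z w, ‖Ψ z - Ψ w‖ = l * ‖z - w‖) :
    ∃ a b : ℂ, a ≠ 0 ∧ ((∀ z, Ψ z = a * z + b) ∨ ∀ z, Ψ z = a * starRingEnd ℂ z + b) := by
  have hlc : (l : ℂ) ≠ 0 := Complex.ofReal_ne_zero.2 hl.ne'
  let f : ℂ ≃ᵢ ℂ :=
    { toFun := fun z => (Ψ z - Ψ 0) / l
      invFun := fun z => Ψ.symm (l * z + Ψ 0)
      left_inv := fun z => by
        simp only
        rw [mul_div_cancel₀ _ hlc, sub_add_cancel, Equiv.symm_apply_apply]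
      right_inv := fun z => by
        simp only
        rw [Equiv.apply_symm_apply, add_sub_cancel_right, mul_div_cancel_left₀ _ hlc]
      isometry_toFun := Isometry.of_dist_eq fun z w => by
        rw [dist_eq_norm, dist_eq_norm, ← sub_div, sub_sub_sub_cancel_right, norm_div, hΨ,
          Complex.norm_real, Real.norm_of_nonneg hl.le, mul_div_cancel_left₀ _ hl.ne'] }
  have hf0 : f 0 = 0 := by simp [f]
  have hfz : ∀ z, Ψ z = l * f z + Ψ 0 := fun z => by
    simp only [f, IsometryEquiv.coe_mk, Equiv.coe_fn_mk]
    field_simp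
    ring
  obtain ⟨a, ha⟩ := linear_isometry_complex (f.toRealLinearIsometryEquivOfMapZero hf0)
  have hfe : ∀ z, f z = f.toRealLinearIsometryEquivOfMapZero hf0 z := fun z => rfl
  refine ⟨l * a, Ψ 0, mul_ne_zero hlc (by simp), ha.imp (fun h z => ?_) fun h z => ?_⟩
  · rw [hfz, hfe, h, rotation_apply]
    ring
  · rw [hfz, hfe, h, LinearIsometryEquiv.trans_apply, rotation_apply, Complex.conjLIE_apply]
    ring

end Hyp3

/-! ### Möbius transformations -/

theorem onePoint_map_conj_map_conj (ξ : OnePoint ℂ) :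
    OnePoint.map (starRingEnd ℂ) (OnePoint.map (starRingEnd ℂ) ξ) = ξ := by
  cases ξ <;> simp

theorem IsMoebius.comp {f g : OnePoint ℂ → OnePoint ℂ} (hf : IsMoebius f) (hg : IsMoebius g) :
    IsMoebius (f ∘ g) := by
  obtain ⟨A, hA⟩ := hf
  obtain ⟨B, hB⟩ := hg
  rcases hA with hA | hA <;> rcases hB with hB | hB
  · exact ⟨A * B, Or.inl fun ξ => by rw [Function.comp_apply, hB, hA, mul_smul]⟩
  · exact ⟨A * B, Or.inr fun ξ => by rw [Function.comp_apply, hB, hA, mul_smul]⟩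
  · exact ⟨A * B.map (starRingEnd ℂ), Or.inr fun ξ => by
      rw [Function.comp_apply, hB, hA, OnePoint.map_smul, mul_smul]⟩
  · exact ⟨A * B.map (starRingEnd ℂ), Or.inl fun ξ => by
      rw [Function.comp_apply, hB, hA, OnePoint.map_smul, mul_smul, onePoint_map_conj_map_conj]⟩

namespace Hyp3

theorem isMoebius_similarity (Ψ : ℂ ≃ ℂ) (l : ℝ) (hl : 0 < l)
    (hΨ : ∀ z w, ‖Ψ z - Ψ w‖ = l * ‖z - w‖) : IsMoebius (bdry (similarity Ψ l hl hΨ)) := by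
  obtain ⟨a, b, ha, h⟩ := exists_eq_affine_of_norm_sub_eq Ψ l hl hΨ
  refine ⟨Matrix.GeneralLinearGroup.mkOfDetNeZero !![a, b; 0, 1] (by simpa using ha),
    h.imp (fun h ξ => ?_) fun h ξ => ?_⟩
  · induction ξ using OnePoint.rec with
    | infty => simp [bdry_similarity_infty, OnePoint.smul_infty_eq_ite,
        Matrix.GeneralLinearGroup.mkOfDetNeZero]
    | coe z => simp [bdry_similarity_coe, OnePoint.smul_some_eq_ite,
        Matrix.GeneralLinearGroup.mkOfDetNeZero, h]
  · induction ξ using OnePoint.rec with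
    | infty => simp [bdry_similarity_infty, OnePoint.smul_infty_eq_ite,
        Matrix.GeneralLinearGroup.mkOfDetNeZero]
    | coe z => simp [bdry_similarity_coe, OnePoint.smul_some_eq_ite,
        Matrix.GeneralLinearGroup.mkOfDetNeZero, h]

theorem isMoebius_inversion : IsMoebius (bdry inversion) := by
  refine ⟨Matrix.GeneralLinearGroup.mkOfDetNeZero !![0, 1; 1, 0] (by simp), Or.inr fun ξ => ?_⟩
  induction ξ using OnePoint.rec with
  | infty => simp [bdry_inversion_infty, OnePoint.smul_infty_eq_ite,
      Matrix.GeneralLinearGroup.mkOfDetNeZero]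
  | coe z =>
    by_cases hz : z = 0
    · subst hz
      simp [bdry_inversion_zero, OnePoint.smul_some_eq_ite,
        Matrix.GeneralLinearGroup.mkOfDetNeZero]
    · simp [bdry_inversion_coe hz, OnePoint.smul_some_eq_ite,
        Matrix.GeneralLinearGroup.mkOfDetNeZero, hz]

theorem isMoebius_bdry (φ : Hyp3 ≃ᵢ Hyp3) : IsMoebius (bdry φ) := by
  by_cases hφ : bdry φ OnePoint.infty = OnePoint.infty
  · obtain ⟨Ψ, l, hl, hΨ, rfl⟩ := exists_eq_similarity hφ
    exact isMoebius_similarity Ψ l hl hΨ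
  · obtain ⟨c, hc⟩ := OnePoint.ne_infty_iff_exists.1 hφ
    obtain ⟨Ψ, l, hl, hΨ, h⟩ := exists_eq_inversion φ hc.symm
    have h2 : bdry φ = bdry (translation c) ∘ bdry inversion ∘ bdry (similarity Ψ l hl hΨ) := by
      funext ξ
      rw [h, bdry_trans, bdry_trans]
      rfl
    rw [h2]
    exact (isMoebius_similarity _ _ _ _).comp
      (isMoebius_inversion.comp (isMoebius_similarity Ψ l hl hΨ))

end Hyp3

/-! ### Stepanov's theorem -/

section Stepanov

open MeasureTheory Asymptotics

variable {E F : Type*} [NormedAddCommGroup E] [NormedAddCommGroup F]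

theorem exists_isLittleO_sub_of_isLittleO_infDist {S : Set E} {x : E} (hx : x ∈ S)
    (h : (fun y => Metric.infDist y S) =o[𝓝 x] fun y => y - x) :
    ∃ g : E → E, (∀ y, g y ∈ S) ∧ (fun y => y - g y) =o[𝓝 x] fun y => y - x := by
  have hg : ∀ y, ∃ y' ∈ S, ‖y - y'‖ ≤ Metric.infDist y S + ‖y - x‖ ^ 2 := fun y => by
    rcases eq_or_ne y x with rfl | hy
    · exact ⟨y, hx, by simp [Metric.infDist_nonneg]⟩
    have hpos : 0 < ‖y - x‖ := norm_pos_iff.2 (sub_ne_zero.2 hy)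
    obtain ⟨y', hy', hlt⟩ := (Metric.infDist_lt_iff ⟨x, hx⟩).1
      (lt_add_of_pos_right (Metric.infDist y S) (pow_pos hpos 2))
    exact ⟨y', hy', by rw [← dist_eq_norm]; exact hlt.le⟩
  choose g hgS hg using hg
  exact ⟨g, hgS, (IsBigO.of_norm_le hg).trans_isLittleO
    (h.add (isLittleO_pow_sub_sub x one_lt_two))⟩

theorem exists_lipschitzOnWith_cover [TopologicalSpace.SeparableSpace E] (f : E → F) :
    ∃ S : ℕ × ℕ → Set E,
      (∀ k, LipschitzOnWith (k.1 : NNReal) f (S k)) ∧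
      (∀ k, ∀ x ∈ S k, ∀ y, ‖y - x‖ < (k.1 + 1 : ℝ)⁻¹ → ‖f y - f x‖ ≤ k.1 * ‖y - x‖) ∧
      ∀ x, (∃ M : ℝ, ∀ᶠ y in 𝓝 x, ‖f y - f x‖ ≤ M * ‖y - x‖) → ∃ k, x ∈ S k := by
  let c := TopologicalSpace.denseSeq E
  refine ⟨fun k => {x | ∀ y, ‖y - x‖ < (k.1 + 1 : ℝ)⁻¹ → ‖f y - f x‖ ≤ k.1 * ‖y - x‖} ∩
      Metric.ball (c k.2) ((k.1 + 1 : ℝ)⁻¹ / 2), fun k => ?_, fun k x hx => hx.1, ?_⟩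
  · refine LipschitzOnWith.of_dist_le_mul fun x hx y hy => ?_
    rw [dist_eq_norm, dist_eq_norm]
    refine hy.1 x ?_
    rw [← dist_eq_norm]
    linarith [dist_triangle_right x y (c k.2), Metric.mem_ball.1 hx.2, Metric.mem_ball.1 hy.2]
  · rintro x ⟨M, hM⟩
    obtain ⟨r, hr, hrM⟩ := Metric.eventually_nhds_iff.1 hM
    obtain ⟨n, hn⟩ := exists_nat_ge (max M r⁻¹)
    obtain ⟨k, hk⟩ := (TopologicalSpace.denseRange_denseSeq E).exists_dist_lt x
      (ε := (n + 1 : ℝ)⁻¹ / 2) (by positivity)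
    have hnr : (n + 1 : ℝ)⁻¹ ≤ r := by
      rw [inv_le_comm₀ (by positivity) hr]
      linarith [(le_max_right M r⁻¹).trans hn]
    refine ⟨(n, k), fun y hy => (hrM (by rw [dist_eq_norm]; linarith)).trans ?_, hk⟩
    gcongr
    exact (le_max_left _ _).trans hn

variable [NormedSpace ℝ E] [NormedSpace ℝ F]

theorem hasFDerivAt_of_hasFDerivWithinAt_of_isLittleO_infDist {f : E → F} {D : E →L[ℝ] F}
    {S : Set E} {x : E} {M r : ℝ} (hr : 0 < r) (hx : x ∈ S)
    (hD : HasFDerivWithinAt f D S x)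
    (hS : (fun y => Metric.infDist y S) =o[𝓝 x] fun y => y - x)
    (hf : ∀ y' ∈ S, ∀ y, ‖y - y'‖ < r → ‖f y - f y'‖ ≤ M * ‖y - y'‖) : HasFDerivAt f D x := by
  obtain ⟨g, hgS, hg⟩ := exists_isLittleO_sub_of_isLittleO_infDist hx hS
  have hsub : Tendsto (fun y => y - x) (𝓝 x) (𝓝 0) :=
    tendsto_sub_nhds_zero_iff.2 tendsto_id
  have hg0 : Tendsto (fun y => y - g y) (𝓝 x) (𝓝 0) := hg.isBigO.trans_tendsto hsub
  have hgx : Tendsto g (𝓝 x) (𝓝[S] x) :=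
    tendsto_nhdsWithin_iff.2 ⟨by simpa using tendsto_id.sub hg0, .of_forall hgS⟩
  have hgO : (fun y => g y - x) =O[𝓝 x] fun y => y - x := by
    simpa using (isBigO_refl (fun y => y - x) (𝓝 x)).sub hg.isBigO
  have h1 : (fun y => f y - f (g y)) =o[𝓝 x] fun y => y - x := by
    refine (IsBigO.of_bound M ?_).trans_isLittleO hg
    filter_upwards [hg0.norm.eventually_lt_const (by simpa using hr)] with y hy
    exact hf _ (hgS y) y hy
  have h2 : (fun y => f (g y) - f x - D (g y - x)) =o[𝓝 x] fun y => y - x :=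
    (hD.isLittleO.comp_tendsto hgx).trans_isBigO hgO
  have h3 : (fun y => D (y - g y)) =o[𝓝 x] fun y => y - x :=
    (D.isBigO_comp _ _).trans_isLittleO hg
  refine .of_isLittleO (((h1.add h2).sub h3).congr_left fun y => ?_)
  simp only [map_sub]
  abel

variable [FiniteDimensional ℝ E] [MeasurableSpace E] [BorelSpace E] (μ : Measure E)
  [μ.IsAddHaarMeasure]

theorem ae_isLittleO_infDist (S : Set E) :
    ∀ᵐ x ∂μ, x ∈ S → (fun y => Metric.infDist y S) =o[𝓝 x] fun y => y - x := by
  have hdense := ae_all_iff.2 fun n : ℕ => ae_imp_of_ae_restrict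
    (IsUnifLocDoublingMeasure.ae_tendsto_measure_inter_div μ S (n + 1 : ℝ))
  filter_upwards [hdense] with x hx hxS
  refine isLittleO_iff.2 fun ε hε => ?_
  obtain ⟨n, hn⟩ := exists_nat_one_div_lt hε
  rw [one_div] at hn
  have hn0 : (0 : ℝ) < n + 1 := by positivity
  have hδ : Tendsto (fun y => (n + 1 : ℝ)⁻¹ * ‖y - x‖) (𝓝[≠] x) (𝓝[>] 0) := by
    refine tendsto_nhdsWithin_iff.2 ⟨?_, ?_⟩
    · have hc : Continuous fun y => (n + 1 : ℝ)⁻¹ * ‖y - x‖ := by fun_prop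
      simpa using (hc.tendsto x).mono_left (nhdsWithin_le_nhds (s := {x}ᶜ))
    · filter_upwards [self_mem_nhdsWithin] with y hy
      exact mul_pos (inv_pos.2 hn0) (norm_pos_iff.2 (sub_ne_zero.2 hy))
  have hratio := (hx n hxS (fun y => y) _ hδ (Eventually.of_forall fun y => by
    rw [Metric.mem_closedBall, dist_comm, dist_eq_norm, mul_inv_cancel_left₀ hn0.ne'])).eventually
    (lt_mem_nhds one_pos)
  filter_upwards [eventually_nhdsWithin_iff.1 hratio] with y hy
  rw [Real.norm_of_nonneg Metric.infDist_nonneg]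
  rcases eq_or_ne y x with rfl | hyx
  · simp [Metric.infDist_zero_of_mem hxS]
  obtain ⟨y', hy', hyy'⟩ : (S ∩ Metric.closedBall y ((n + 1 : ℝ)⁻¹ * ‖y - x‖)).Nonempty := by
    refine nonempty_iff_ne_empty.2 fun hempty => ?_
    simpa [hempty] using hy hyx
  calc Metric.infDist y S ≤ dist y y' := Metric.infDist_le_dist_of_mem hy'
    _ ≤ (n + 1 : ℝ)⁻¹ * ‖y - x‖ := by rw [dist_comm]; exact hyy'
    _ ≤ ε * ‖y - x‖ := by gcongr

/-- **Stepanov's theorem**. -/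
theorem ae_differentiableAt_of_ae_lipschitz_at [FiniteDimensional ℝ F] {f : E → F}
    (hf : ∀ᵐ x ∂μ, ∃ M : ℝ, ∀ᶠ y in 𝓝 x, ‖f y - f x‖ ≤ M * ‖y - x‖) :
    ∀ᵐ x ∂μ, DifferentiableAt ℝ f x := by
  obtain ⟨S, hlip, hS, hcover⟩ := exists_lipschitzOnWith_cover f
  have hdiff := ae_all_iff.2 fun k => (hlip k).ae_differentiableWithinAt_of_mem (μ := μ)
  have hdense := ae_all_iff.2 fun k => ae_isLittleO_infDist μ (S k)
  filter_upwards [hf, hdiff, hdense] with x hx hdiff hdense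
  obtain ⟨k, hk⟩ := hcover x hx
  obtain ⟨D, hD⟩ := hdiff k hk
  exact (hasFDerivAt_of_hasFDerivWithinAt_of_isLittleO_infDist
    (inv_pos.2 (by positivity : (0 : ℝ) < k.1 + 1)) hk hD (hdense k hk) (hS k)).differentiableAt

end Stepanov

/-! ### Quasisymmetric homeomorphisms of the plane -/

section Lintegral

open MeasureTheory

open scoped ENNReal

theorem lintegral_measure_closedBall_comm {X : Type*} [PseudoMetricSpace X]
    [SecondCountableTopology X] [MeasurableSpace X] [BorelSpace X] (μ ν : Measure X) [SFinite μ]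
    [SFinite ν] (δ : ℝ) :
    ∫⁻ x, ν (Metric.closedBall x δ) ∂μ = ∫⁻ y, μ (Metric.closedBall y δ) ∂ν := by
  have hs : MeasurableSet {p : X × X | dist p.2 p.1 ≤ δ} :=
    (isClosed_le (continuous_snd.dist continuous_fst) continuous_const).measurableSet
  have hswap : ∀ y : X, (fun x => (x, y)) ⁻¹' {p : X × X | dist p.2 p.1 ≤ δ} =
      Metric.closedBall y δ := fun y => by
    ext x
    exact Metric.mem_closedBall'.symm
  have h := (Measure.prod_apply (μ := μ) (ν := ν) hs).symm.trans (Measure.prod_apply_symm hs)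
  simp only [hswap] at h
  exact h

theorem lintegral_closedBall_add_le {E : Type*} [SeminormedAddCommGroup E] [MeasurableSpace E]
    [BorelSpace E] (μ : Measure E) [μ.IsAddRightInvariant] (g : E → ℝ≥0∞) {c : E} {r s : ℝ}
    (hc : r + ‖c‖ ≤ s) :
    ∫⁻ x in Metric.closedBall 0 r, g (x + c) ∂μ ≤ ∫⁻ x in Metric.closedBall 0 s, g x ∂μ := by
  rw [← lintegral_indicator Metric.isClosed_closedBall.measurableSet,
    ← lintegral_indicator Metric.isClosed_closedBall.measurableSet,
    ← lintegral_add_right_eq_self ((Metric.closedBall 0 s).indicator g) c]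
  refine lintegral_mono <| indicator_le (s := Metric.closedBall 0 r) fun x hx => ?_
  rw [indicator_of_mem]
  rw [mem_closedBall_zero_iff] at hx ⊢
  linarith [norm_add_le x c]

theorem le_min_add_inv_mul_sq {m : ℝ≥0∞} (hm : m ≠ 0) (hm' : m ≠ ⊤) (a : ℝ≥0∞) :
    a ≤ min a m + m⁻¹ * a ^ 2 := by
  rcases le_total a m with ha | ha
  · rw [min_eq_left ha]
    exact le_self_add
  · refine le_add_left ?_
    calc a = m⁻¹ * (m * a) := by rw [← mul_assoc, ENNReal.inv_mul_cancel hm hm', one_mul]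
      _ ≤ m⁻¹ * a ^ 2 := by rw [sq]; gcongr

/-- Truncate at a large height `m`: the truncations converge by dominated convergence, and
`g ≤ min g m + m⁻¹ g ^ 2` controls what is cut off. -/
theorem tendsto_lintegral_zero_of_lintegral_sq_le {α : Type*} [MeasurableSpace α] {μ : Measure α}
    [IsFiniteMeasure μ] {g : ℕ → α → ℝ≥0∞} (hg : ∀ n, Measurable (g n)) {B : ℝ≥0∞} (hB : B ≠ ⊤)
    (hgB : ∀ n, ∫⁻ x, g n x ^ 2 ∂μ ≤ B) (hlim : ∀ᵐ x ∂μ, Tendsto (fun n => g n x) atTop (𝓝 0)) :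
    Tendsto (fun n => ∫⁻ x, g n x ∂μ) atTop (𝓝 0) := by
  refine ENNReal.tendsto_nhds_zero.2 fun ε hε => ?_
  have hε2 : 0 < ε / 2 := ENNReal.half_pos hε.ne'
  have htail : Tendsto (fun M : ℕ => (M : ℝ≥0∞)⁻¹ * B) atTop (𝓝 0) := by
    simpa using ENNReal.Tendsto.mul_const ENNReal.tendsto_inv_nat_nhds_zero (Or.inr hB)
  obtain ⟨M, hM, hMB⟩ := ((eventually_ge_atTop 1).and (htail.eventually_le_const hε2)).exists
  have hM0 : (M : ℝ≥0∞) ≠ 0 := Nat.cast_ne_zero.2 (Nat.one_le_iff_ne_zero.1 hM)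
  have htrunc : Tendsto (fun n => ∫⁻ x, min (g n x) M ∂μ) atTop (𝓝 (∫⁻ _, 0 ∂μ)) := by
    refine tendsto_lintegral_of_dominated_convergence (fun _ => M)
      (fun n => (hg n).min measurable_const) (fun n => .of_forall fun x => min_le_right _ _) ?_ ?_
    · rw [lintegral_const]
      exact ENNReal.mul_ne_top (ENNReal.natCast_ne_top M) (measure_ne_top μ _)
    · filter_upwards [hlim] with x hx
      exact tendsto_of_tendsto_of_tendsto_of_le_of_le tendsto_const_nhds hx
        (fun _ => zero_le) fun _ => min_le_left _ _
  rw [lintegral_zero] at htrunc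
  filter_upwards [htrunc.eventually_le_const hε2] with n hn
  calc ∫⁻ x, g n x ∂μ ≤ ∫⁻ x, (min (g n x) M + (M : ℝ≥0∞)⁻¹ * g n x ^ 2) ∂μ :=
        lintegral_mono fun x => le_min_add_inv_mul_sq hM0 (ENNReal.natCast_ne_top M) _
    _ = ∫⁻ x, min (g n x) M ∂μ + (M : ℝ≥0∞)⁻¹ * ∫⁻ x, g n x ^ 2 ∂μ := by
        rw [lintegral_add_left ((hg n).min measurable_const),
          lintegral_const_mul' _ _ (ENNReal.inv_ne_top.2 hM0)]
    _ ≤ ε / 2 + ε / 2 := add_le_add hn ((mul_le_mul_right (hgB n) _).trans hMB)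
    _ = ε := ENNReal.add_halves ε

end Lintegral

section Quasisymmetric

open MeasureTheory

open scoped ENNReal NNReal

/-- The (weakly) quasisymmetric homeomorphisms of the plane: with respect to any centre `x`, a
point closer to `x` than another one is mapped at most `C` times further from the image of `x`. -/
def IsQuasisymmetric (C : ℝ) (h : ℂ ≃ₜ ℂ) : Prop :=
  0 < C ∧ ∀ x y w, ‖y - x‖ ≤ ‖w - x‖ → ‖h y - h x‖ ≤ C * ‖h w - h x‖

namespace IsQuasisymmetric

variable {C : ℝ} {h : ℂ ≃ₜ ℂ}

/-- The measure that assigns to a set the area of its image under the homeomorphism `h`. -/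
def areaPullback (h : ℂ ≃ₜ ℂ) : Measure ℂ := (volume : Measure ℂ).map h.symm

theorem areaPullback_apply {s : Set ℂ} (hs : MeasurableSet s) :
    areaPullback h s = volume (h.symm ⁻¹' s) :=
  Measure.map_apply h.symm.continuous.measurable hs

instance : IsFiniteMeasureOnCompacts (areaPullback h) where
  lt_top_of_isCompact K hK := by
    rw [areaPullback_apply hK.measurableSet, ← h.image_eq_preimage_symm]
    exact (hK.image h.continuous).measure_lt_top

/-- By quasisymmetry the image of a disc contains a disc of comparable radius. -/
theorem enorm_sq_le (hh : IsQuasisymmetric C h) {x y : ℂ} {r : ℝ} (hy : ‖y - x‖ ≤ r) :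
    ‖h y - h x‖ₑ ^ 2 ≤ ENNReal.ofReal C ^ 2 * areaPullback h (Metric.closedBall x r) := by
  have hC := hh.1
  have hsub : Metric.ball (h x) (‖h y - h x‖ / C) ⊆ h.symm ⁻¹' Metric.closedBall x r := by
    intro v hv
    by_contra hfar
    rw [mem_preimage, Metric.mem_closedBall, not_le, dist_eq_norm] at hfar
    have hle := hh.2 x y (h.symm v) (by linarith)
    rw [h.apply_symm_apply] at hle
    rw [Metric.mem_ball, dist_eq_norm, lt_div_iff₀ hC] at hv
    linarith
  have hpi : (1 : ℝ≥0∞) ≤ NNReal.pi := by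
    rw [ENNReal.one_le_coe_iff, ← NNReal.coe_le_coe, NNReal.coe_one, NNReal.coe_real_pi]
    linarith [Real.two_le_pi]
  calc ‖h y - h x‖ₑ ^ 2 = ENNReal.ofReal C ^ 2 * ENNReal.ofReal (‖h y - h x‖ / C) ^ 2 := by
        rw [← mul_pow, ← ENNReal.ofReal_mul hC.le, mul_div_cancel₀ _ hC.ne', ofReal_norm]
    _ ≤ ENNReal.ofReal C ^ 2 * volume (Metric.ball (h x) (‖h y - h x‖ / C)) := by
        rw [Complex.volume_ball]
        gcongr
        exact le_mul_of_one_le_right' hpi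
    _ ≤ _ := by
        rw [areaPullback_apply Metric.isClosed_closedBall.measurableSet]
        gcongr

theorem exists_lipschitz_at (hh : IsQuasisymmetric C h) {x : ℂ} {L : ℝ≥0∞} (hL : L < ⊤)
    (hx : Tendsto (fun r => areaPullback h (Metric.closedBall x r) /
      volume (Metric.closedBall x r)) (𝓝[>] 0) (𝓝 L)) :
    ∃ M : ℝ, ∀ᶠ y in 𝓝 x, ‖h y - h x‖ ≤ M * ‖y - x‖ := by
  obtain ⟨M, hLM, hM⟩ := exists_between hL
  obtain ⟨ρ, hρ, hratio⟩ := Metric.eventually_nhds_iff.1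
    (eventually_nhdsWithin_iff.1 (hx.eventually (gt_mem_nhds hLM)))
  set B : ℝ≥0∞ := ENNReal.ofReal C ^ 2 * (M * NNReal.pi) with hB
  have hBtop : B ≠ ⊤ := ENNReal.mul_ne_top (ENNReal.pow_ne_top ENNReal.ofReal_ne_top)
    (ENNReal.mul_ne_top hM.ne ENNReal.coe_ne_top)
  refine ⟨√B.toReal, ?_⟩
  filter_upwards [Metric.ball_mem_nhds x hρ] with y hy
  rcases eq_or_ne y x with rfl | hyx
  · simp
  rw [Metric.mem_ball, dist_eq_norm] at hy
  have hr : 0 < ‖y - x‖ := norm_pos_iff.2 (sub_ne_zero.2 hyx)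
  have harea : areaPullback h (Metric.closedBall x ‖y - x‖) ≤
      M * (ENNReal.ofReal ‖y - x‖ ^ 2 * NNReal.pi) := by
    rw [← Complex.volume_closedBall x]
    exact (ENNReal.div_le_iff (Metric.measure_closedBall_pos _ _ hr).ne'
      measure_closedBall_lt_top.ne).1 (hratio (by simpa using hy) hr).le
  have hsq : ‖h y - h x‖ₑ ^ 2 ≤ B * ENNReal.ofReal ‖y - x‖ ^ 2 := by
    refine (hh.enorm_sq_le le_rfl).trans ?_
    calc _ ≤ ENNReal.ofReal C ^ 2 * (M * (ENNReal.ofReal ‖y - x‖ ^ 2 * NNReal.pi)) := by gcongr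
      _ = _ := by rw [hB]; ring
  refine le_of_sq_le_sq ?_ (by positivity)
  rw [mul_pow, Real.sq_sqrt ENNReal.toReal_nonneg]
  simpa using ENNReal.toReal_mono
    (ENNReal.mul_ne_top hBtop (ENNReal.pow_ne_top ENNReal.ofReal_ne_top)) hsq

theorem ae_differentiableAt (hh : IsQuasisymmetric C h) :
    ∀ᵐ x : ℂ, DifferentiableAt ℝ h x := by
  refine ae_differentiableAt_of_ae_lipschitz_at volume ?_
  filter_upwards [Besicovitch.ae_tendsto_rnDeriv (areaPullback h) volume,
    Measure.rnDeriv_lt_top (areaPullback h) volume] with x hx hlt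
  exact hh.exists_lipschitz_at hlt hx

/-- The size of the difference quotient of `h` at `x` along the real step `(n + 1)⁻¹`. -/
def diffQuot (h : ℂ → ℂ) (n : ℕ) (x : ℂ) : ℝ≥0∞ :=
  (n + 1 : ℕ) * ‖h (x + ((n + 1 : ℕ) : ℂ)⁻¹) - h x‖ₑ

theorem measurable_diffQuot (n : ℕ) : Measurable (diffQuot h n) := by
  have hc : Continuous fun x => h (x + ((n + 1 : ℕ) : ℂ)⁻¹) - h x := by fun_prop
  exact hc.measurable.enorm.const_mul _

theorem lintegral_areaPullback_le (R δ : ℝ) :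
    ∫⁻ x in Metric.closedBall 0 R, areaPullback h (Metric.closedBall x δ) ≤
      volume (Metric.closedBall (0 : ℂ) δ) * areaPullback h (Metric.closedBall 0 (R + δ)) := by
  rw [lintegral_measure_closedBall_comm, ← setLIntegral_const,
    ← lintegral_indicator Metric.isClosed_closedBall.measurableSet]
  refine lintegral_mono fun y => ?_
  rw [Measure.restrict_apply Metric.isClosed_closedBall.measurableSet]
  by_cases hy : y ∈ Metric.closedBall (0 : ℂ) (R + δ)
  · rw [indicator_of_mem hy]
    refine (measure_mono inter_subset_left).trans_eq ?_
    rw [Complex.volume_closedBall, Complex.volume_closedBall]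
  · have hempty : Metric.closedBall y δ ∩ Metric.closedBall 0 R = ∅ :=
      disjoint_iff_inter_eq_empty.1 <| Metric.closedBall_disjoint_closedBall <| by
        rw [Metric.mem_closedBall, not_le] at hy
        linarith
    rw [hempty, measure_empty]
    exact zero_le

theorem lintegral_diffQuot_sq_le (hh : IsQuasisymmetric C h) (n : ℕ) :
    ∫⁻ x in Metric.closedBall 0 2, diffQuot h n x ^ 2 ≤
      ENNReal.ofReal C ^ 2 * NNReal.pi * areaPullback h (Metric.closedBall 0 3) := by
  set δ : ℝ := ((n + 1 : ℕ) : ℝ)⁻¹ with hδ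
  have hδ1 : δ ≤ 1 := inv_le_one_of_one_le₀ (by simp)
  have hnδ : ((n + 1 : ℕ) : ℝ≥0∞) ^ 2 * ENNReal.ofReal δ ^ 2 = 1 := by
    rw [← mul_pow, ← ENNReal.ofReal_natCast, ← ENNReal.ofReal_mul (by positivity), hδ,
      mul_inv_cancel₀ (by positivity), ENNReal.ofReal_one, one_pow]
  calc _ ≤ ∫⁻ x in Metric.closedBall 0 2, ((n + 1 : ℕ) : ℝ≥0∞) ^ 2 * (ENNReal.ofReal C ^ 2 *
        areaPullback h (Metric.closedBall x δ)) := by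
        refine lintegral_mono fun x => ?_
        simp only [diffQuot, mul_pow]
        gcongr
        refine hh.enorm_sq_le ?_
        rw [add_sub_cancel_left, norm_inv, Complex.norm_natCast]
    _ = ((n + 1 : ℕ) : ℝ≥0∞) ^ 2 * (ENNReal.ofReal C ^ 2 *
        ∫⁻ x in Metric.closedBall 0 2, areaPullback h (Metric.closedBall x δ)) := by
        rw [lintegral_const_mul', lintegral_const_mul']
        · exact ENNReal.pow_ne_top ENNReal.ofReal_ne_top
        · exact ENNReal.pow_ne_top (ENNReal.natCast_ne_top _)
    _ ≤ ((n + 1 : ℕ) : ℝ≥0∞) ^ 2 * (ENNReal.ofReal C ^ 2 *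
        ((ENNReal.ofReal δ ^ 2 * NNReal.pi) * areaPullback h (Metric.closedBall 0 3))) := by
        gcongr
        refine (lintegral_areaPullback_le 2 δ).trans ?_
        rw [Complex.volume_closedBall]
        gcongr
        linarith
    _ = (((n + 1 : ℕ) : ℝ≥0∞) ^ 2 * ENNReal.ofReal δ ^ 2) * (ENNReal.ofReal C ^ 2 * NNReal.pi *
        areaPullback h (Metric.closedBall 0 3)) := by ring
    _ = _ := by rw [hnδ, one_mul]

theorem enorm_sub_le_sum_diffQuot (h : ℂ → ℂ) (n : ℕ) (x : ℂ) :
    ‖h (x + 1) - h x‖ₑ ≤ ∑ j ∈ Finset.range (n + 1),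
      ((n + 1 : ℕ) : ℝ≥0∞)⁻¹ * diffQuot h n (x + j * ((n + 1 : ℕ) : ℂ)⁻¹) := by
  have hn : ((n + 1 : ℕ) : ℂ) ≠ 0 := Nat.cast_ne_zero.2 n.succ_ne_zero
  have htele := Finset.sum_range_sub (fun j : ℕ => h (x + j * ((n + 1 : ℕ) : ℂ)⁻¹)) (n + 1)
  simp only [mul_inv_cancel₀ hn, Nat.cast_zero, zero_mul, add_zero] at htele
  rw [← htele]
  refine (enorm_sum_le _ _).trans_eq (Finset.sum_congr rfl fun j _ => ?_)
  rw [diffQuot, ← mul_assoc, ENNReal.inv_mul_cancel (Nat.cast_ne_zero.2 n.succ_ne_zero)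
    (ENNReal.natCast_ne_top _), one_mul, Nat.cast_succ j, add_one_mul, add_assoc]

theorem lintegral_enorm_le (n : ℕ) :
    ∫⁻ x in Metric.closedBall 0 1, ‖h (x + 1) - h x‖ₑ ≤
      ∫⁻ x in Metric.closedBall 0 2, diffQuot h n x := by
  have hn : ((n + 1 : ℕ) : ℝ≥0∞) ≠ 0 := Nat.cast_ne_zero.2 n.succ_ne_zero
  have hstep : ∀ j ∈ Finset.range (n + 1), ‖(j : ℂ) * ((n + 1 : ℕ) : ℂ)⁻¹‖ ≤ 1 := fun j hj => by
    rw [norm_mul, norm_inv, Complex.norm_natCast, Complex.norm_natCast, ← div_eq_mul_inv]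
    exact div_le_one_of_le₀ (Nat.cast_le.2 (Finset.mem_range.1 hj).le) (by positivity)
  calc _ ≤ ∫⁻ x in Metric.closedBall 0 1, ∑ j ∈ Finset.range (n + 1),
        ((n + 1 : ℕ) : ℝ≥0∞)⁻¹ * diffQuot h n (x + j * ((n + 1 : ℕ) : ℂ)⁻¹) :=
        lintegral_mono (enorm_sub_le_sum_diffQuot h n)
    _ = ∑ j ∈ Finset.range (n + 1), ((n + 1 : ℕ) : ℝ≥0∞)⁻¹ *
        ∫⁻ x in Metric.closedBall 0 1, diffQuot h n (x + j * ((n + 1 : ℕ) : ℂ)⁻¹) := by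
        refine (lintegral_finsetSum _ fun _ _ =>
          ((measurable_diffQuot n).comp (measurable_add_const _)).const_mul _).trans ?_
        simp only [lintegral_const_mul' _ _ (ENNReal.inv_ne_top.2 hn), Function.comp_apply]
    _ ≤ ∑ _ ∈ Finset.range (n + 1), ((n + 1 : ℕ) : ℝ≥0∞)⁻¹ *
        ∫⁻ x in Metric.closedBall 0 2, diffQuot h n x :=
        Finset.sum_le_sum fun j hj => mul_le_mul_right
          (lintegral_closedBall_add_le _ _ (by linarith [hstep j hj])) _
    _ = _ := by
        rw [Finset.sum_const, Finset.card_range, nsmul_eq_mul, ← mul_assoc,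
          ENNReal.mul_inv_cancel hn (ENNReal.natCast_ne_top _), one_mul]

theorem tendsto_diffQuot {h : ℂ → ℂ} {x : ℂ} (hx : HasFDerivAt h (0 : ℂ →L[ℝ] ℂ) x) :
    Tendsto (fun n => diffQuot h n x) atTop (𝓝 0) := by
  have hquot : Tendsto (fun n : ℕ => (n + 1 : ℕ) * ‖h (x + ((n + 1 : ℕ) : ℂ)⁻¹) - h x‖) atTop
      (𝓝 0) := by
    have hseq : Tendsto (fun n : ℕ => x + ((n + 1 : ℕ) : ℂ)⁻¹) atTop (𝓝 x) := by
      simpa using ((tendsto_inv_atTop_nhds_zero_nat (𝕜 := ℂ)).comp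
        (tendsto_add_atTop_nat 1)).const_add x
    refine ((hasFDerivAt_iff_tendsto.1 hx).comp hseq).congr fun n => ?_
    simp only [Function.comp_apply, add_sub_cancel_left, norm_inv, Complex.norm_natCast, inv_inv,
      _root_.zero_apply, sub_zero]
  have hlim := (ENNReal.continuous_ofReal.tendsto 0).comp hquot
  rw [ENNReal.ofReal_zero] at hlim
  refine hlim.congr fun n => ?_
  rw [Function.comp_apply, ENNReal.ofReal_mul (by positivity), ENNReal.ofReal_natCast,
    ofReal_norm, diffQuot]

theorem lintegral_enorm_ne_zero (h : ℂ ≃ₜ ℂ) :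
    ∫⁻ x in Metric.closedBall 0 1, ‖h (x + 1) - h x‖ₑ ≠ 0 := by
  have hc : Continuous fun x => h (x + 1) - h x := by fun_prop
  rw [ne_eq, lintegral_eq_zero_iff hc.measurable.enorm]
  intro h0
  have hfalse : ∀ᵐ _ ∂(volume.restrict (Metric.closedBall (0 : ℂ) 1)), False := by
    filter_upwards [h0] with _ hx
    simp [sub_eq_zero] at hx
  rw [eventually_false_iff_eq_bot, ae_eq_bot, Measure.restrict_eq_zero] at hfalse
  exact (Metric.measure_closedBall_pos volume (0 : ℂ) one_pos).ne' hfalse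

/-- If the derivative vanished almost everywhere, the difference quotients, which are bounded in
`L²`, would tend to `0` in `L¹`, although they telescope to `h (x + 1) - h x`. -/
theorem exists_hasFDerivAt_ne_zero (hh : IsQuasisymmetric C h) :
    ∃ (z : ℂ) (A : ℂ →L[ℝ] ℂ), HasFDerivAt h A z ∧ A ≠ 0 := by
  by_contra! hzero
  have hae : ∀ᵐ x : ℂ, Tendsto (fun n => diffQuot h n x) atTop (𝓝 0) := by
    filter_upwards [hh.ae_differentiableAt] with x hx
    exact tendsto_diffQuot (hzero _ _ hx.hasFDerivAt ▸ hx.hasFDerivAt)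
  have hB : ENNReal.ofReal C ^ 2 * NNReal.pi * areaPullback h (Metric.closedBall 0 3) ≠ ⊤ :=
    ENNReal.mul_ne_top (ENNReal.mul_ne_top (ENNReal.pow_ne_top ENNReal.ofReal_ne_top)
      ENNReal.coe_ne_top) ((isCompact_closedBall (0 : ℂ) 3).measure_lt_top (μ := areaPullback h)).ne
  have hfin : IsFiniteMeasure (volume.restrict (Metric.closedBall (0 : ℂ) 2)) :=
    isFiniteMeasure_restrict.2 measure_closedBall_lt_top.ne
  have hlim := tendsto_lintegral_zero_of_lintegral_sq_le
    (μ := volume.restrict (Metric.closedBall (0 : ℂ) 2)) measurable_diffQuot hB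
    hh.lintegral_diffQuot_sq_le (ae_restrict_of_ae hae)
  exact lintegral_enorm_ne_zero h (le_antisymm (ge_of_tendsto' hlim lintegral_enorm_le) zero_le)

end IsQuasisymmetric

end Quasisymmetric

/-! ### Maps of the sphere that fix infinity -/

section OnePoint

variable {X Y : Type*} [TopologicalSpace X] [TopologicalSpace Y] (e : OnePoint X ≃ₜ OnePoint Y)

theorem coe_removeNone_toEquiv (he : e OnePoint.infty = OnePoint.infty) (x : X) :
    (Equiv.removeNone e.toEquiv x : OnePoint Y) = e x :=
  Equiv.removeNone_some _ <| Option.ne_none_iff_exists'.1 fun h =>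
    OnePoint.coe_ne_infty x (e.injective (h.trans he.symm))

theorem continuous_removeNone_toEquiv (he : e OnePoint.infty = OnePoint.infty) :
    Continuous (Equiv.removeNone e.toEquiv : X → Y) := by
  rw [OnePoint.isOpenEmbedding_coe.isInducing.continuous_iff]
  exact (e.continuous.comp OnePoint.continuous_coe).congr fun x =>
    (coe_removeNone_toEquiv e he x).symm

/-- The restriction of a homeomorphism of one-point compactifications that fixes `∞`. -/
def homeomorphOfOnePoint (he : e OnePoint.infty = OnePoint.infty) : X ≃ₜ Y where
  toEquiv := Equiv.removeNone e.toEquiv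
  continuous_toFun := continuous_removeNone_toEquiv e he
  continuous_invFun := continuous_removeNone_toEquiv e.symm (e.symm_apply_eq.2 he.symm)

theorem coe_homeomorphOfOnePoint (he : e OnePoint.infty = OnePoint.infty) (x : X) :
    (homeomorphOfOnePoint e he x : OnePoint Y) = e x :=
  coe_removeNone_toEquiv e he x

end OnePoint

namespace Hyp3

/-! ### Boundary values are quasisymmetric -/

theorem bdry_fromBase_coe (p : Hyp3) (z : ℂ) : bdry (fromBase p) z = (p.z + p.t * z : ℂ) :=
  bdry_similarity_coe _ _ _ _ z

theorem bdry_fromBase_infty (p : Hyp3) : bdry (fromBase p) OnePoint.infty = OnePoint.infty :=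
  bdry_similarity_infty _ _ _ _

theorem bdry_fromBase_symm_coe (p : Hyp3) (z : ℂ) :
    bdry (fromBase p).symm z = ((z - p.z) / p.t : ℂ) := by
  have hp : (p.t : ℂ) ≠ 0 := Complex.ofReal_ne_zero.2 p.t_pos.ne'
  rw [← bdry_symm_bdry_isometry (fromBase p) ((z - p.z) / p.t : ℂ), bdry_fromBase_coe,
    mul_div_cancel₀ _ hp, add_sub_cancel]

theorem bdry_fromBase_symm_infty (p : Hyp3) :
    bdry (fromBase p).symm OnePoint.infty = OnePoint.infty := by
  conv_lhs => rw [← bdry_fromBase_infty p]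
  exact bdry_symm_bdry_isometry _ _

/-- The map `H` seen from the points `p` in the source and `q` in the target. -/
def rescale (H : Hyp3 ≃ Hyp3) (p q : Hyp3) : Hyp3 ≃ Hyp3 :=
  (fromBase p).toEquiv.trans (H.trans (fromBase q).symm.toEquiv)

theorem rescale_self_base (H : Hyp3 ≃ Hyp3) (p : Hyp3) : rescale H p (H p) base = base := by
  change (fromBase (H p)).symm (H (fromBase p base)) = base
  rw [fromBase_base, fromBase_symm_self]

section BiLip

variable {K : ℝ} {H : Hyp3 ≃ Hyp3}

theorem _root_.BiLip.rescale (hH : BiLip K H) (p q : Hyp3) : BiLip K (rescale H p q) :=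
  (hH.trans_isometry _).isometry_trans _

theorem _root_.BiLip.bdry_rescale (hH : BiLip K H) (p q : Hyp3) (ξ : OnePoint ℂ) :
    bdry (rescale H p q) ξ = bdry (fromBase q).symm (bdry H (bdry (fromBase p) ξ)) :=
  (bdry_comp (tendsto_bdry_isometry _ _)
    ((hH.trans_isometry (fromBase q).symm).tendsto_bdry _)).trans
    (bdry_comp (H := (fromBase q).symm) (hH.tendsto_bdry _) (tendsto_bdry_isometry _ _))

theorem _root_.BiLip.bdry_rescale_infty (hH : BiLip K H)
    (hinf : bdry H OnePoint.infty = OnePoint.infty) (p q : Hyp3) :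
    bdry (rescale H p q) OnePoint.infty = OnePoint.infty := by
  rw [hH.bdry_rescale, bdry_fromBase_infty, hinf, bdry_fromBase_symm_infty]

/-- The boundary homeomorphism of the plane, of a map that fixes `∞`. -/
def _root_.BiLip.planar (hH : BiLip K H) (hinf : bdry H OnePoint.infty = OnePoint.infty) : ℂ ≃ₜ ℂ :=
  homeomorphOfOnePoint hH.bdryHomeo hinf

theorem _root_.BiLip.coe_planar (hH : BiLip K H) (hinf : bdry H OnePoint.infty = OnePoint.infty)
    (z : ℂ) : (hH.planar hinf z : OnePoint ℂ) = bdry H z :=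
  coe_homeomorphOfOnePoint _ _ z

theorem _root_.BiLip.bdry_rescale_div (hH : BiLip K H)
    (hinf : bdry H OnePoint.infty = OnePoint.infty) (p q : Hyp3) (z : ℂ) :
    bdry (rescale H p q) ((z - p.z) / p.t : ℂ) = ((hH.planar hinf z - q.z) / q.t : ℂ) := by
  rw [hH.bdry_rescale, ← bdry_fromBase_symm_coe, bdry_bdry_symm_isometry, ← hH.coe_planar hinf,
    bdry_fromBase_symm_coe]

end BiLip

theorem exists_tendsto_bdry {ι : Type*} (l : Ultrafilter ι) {K : ℝ} {F : ι → Hyp3 ≃ Hyp3}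
    (hF : ∀ i, BiLip K (F i)) (hbase : ∀ i, F i base = base) :
    ∃ G : Hyp3 ≃ Hyp3, BiLip K G ∧
      ∀ ⦃u : ι → OnePoint ℂ⦄ ⦃ξ⦄, Tendsto u l (𝓝 ξ) →
        Tendsto (fun i => bdry (F i) (u i)) l (𝓝 (bdry G ξ)) := by
  obtain ⟨G, hG, hlim⟩ := BiLip.exists_ultralimit l (Eventually.of_forall hF)
    (Eventually.of_forall fun i => (congrArg (dist · base) (hbase i)).le)
  exact ⟨G, hG, fun u ξ hu => tendsto_bdry (Eventually.of_forall hF) hG hlim hu⟩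

theorem exists_tendsto_of_isCompact {ι X : Type*} [TopologicalSpace X] (l : Ultrafilter ι)
    {S : Set X} (hS : IsCompact S) {u : ι → X} (hu : ∀ i, u i ∈ S) :
    ∃ v ∈ S, Tendsto u l (𝓝 v) :=
  hS.ultrafilter_le_nhds' (l.map u) (Ultrafilter.mem_map.2 (univ_mem' hu))

theorem exists_norm_bdry_le (K : ℝ) : ∃ C : ℝ, 0 < C ∧ ∀ F : Hyp3 ≃ Hyp3, BiLip K F →
    F base = base → bdry F OnePoint.infty = OnePoint.infty →
    ∀ x v : ℂ, ‖x‖ ≤ 1 → bdry F x = v → ‖v‖ ≤ C := by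
  by_contra! hcon
  choose F hF hbase hinf x v hx hv hlarge using fun n : ℕ => hcon (n + 1) (by positivity)
  obtain ⟨G, hG, hlim⟩ := exists_tendsto_bdry (hyperfilter ℕ) hF hbase
  obtain ⟨x₀, -, hx₀⟩ := exists_tendsto_of_isCompact (hyperfilter ℕ)
    (isCompact_closedBall (0 : ℂ) 1) fun n => mem_closedBall_zero_iff.2 (hx n)
  have hGinf : OnePoint.infty = bdry G OnePoint.infty := tendsto_nhds_unique tendsto_const_nhds
    ((hlim (tendsto_const_nhds (x := OnePoint.infty))).congr hinf)
  have hvinf : Tendsto (fun n => (v n : OnePoint ℂ)) (hyperfilter ℕ) (𝓝 OnePoint.infty) := by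
    refine OnePoint.tendsto_coe_infty.comp ?_
    rw [coclosedCompact_eq_cocompact, ← Metric.cobounded_eq_cocompact]
    refine tendsto_norm_atTop_iff_cobounded.1 (tendsto_atTop_mono (fun n => (hlarge n).le) ?_)
    exact (tendsto_atTop_add_const_right _ _ tendsto_natCast_atTop_atTop).mono_left
      Nat.hyperfilter_le_atTop
  have hGx₀ : bdry G x₀ = OnePoint.infty := tendsto_nhds_unique
    ((hlim ((OnePoint.continuous_coe.tendsto x₀).comp hx₀)).congr fun n => hv n) hvinf
  exact OnePoint.coe_ne_infty _ (hG.bdry_injective (hGx₀.trans hGinf))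

theorem exists_le_norm_bdry_sub (K : ℝ) : ∃ C : ℝ, 0 < C ∧ ∀ F : Hyp3 ≃ Hyp3, BiLip K F →
    F base = base → bdry F OnePoint.infty = OnePoint.infty →
    ∀ x v w : ℂ, ‖x‖ = 1 → bdry F x = v → bdry F (0 : ℂ) = w → 1 ≤ C * ‖v - w‖ := by
  obtain ⟨B, -, hbound⟩ := exists_norm_bdry_le K
  by_contra! hcon
  choose F hF hbase hinf x v w hx hv hw hsmall using fun n : ℕ => hcon (n + 1) (by positivity)
  obtain ⟨G, hG, hlim⟩ := exists_tendsto_bdry (hyperfilter ℕ) hF hbase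
  obtain ⟨x₀, hx₀1, hx₀⟩ := exists_tendsto_of_isCompact (hyperfilter ℕ)
    (isCompact_sphere (0 : ℂ) 1) fun n => mem_sphere_zero_iff_norm.2 (hx n)
  obtain ⟨w₀, -, hw₀⟩ := exists_tendsto_of_isCompact (hyperfilter ℕ) (isCompact_closedBall 0 B)
    fun n => mem_closedBall_zero_iff.2 (hbound (F n) (hF n) (hbase n) (hinf n) 0 _ (by simp) (hw n))
  have hvw : Tendsto (fun n => v n - w n) (hyperfilter ℕ) (𝓝 0) := by
    refine squeeze_zero_norm (fun n => ?_)
      (tendsto_one_div_add_atTop_nhds_zero_nat.mono_left Nat.hyperfilter_le_atTop)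
    rw [le_div_iff₀' (by positivity)]
    exact (hsmall n).le
  have hv₀ : Tendsto v (hyperfilter ℕ) (𝓝 w₀) := by simpa using hvw.add hw₀
  have hlimit : ∀ {y : ℕ → ℂ} {y₀ : ℂ}, Tendsto y (hyperfilter ℕ) (𝓝 y₀) →
      Tendsto (fun n => (y n : OnePoint ℂ)) (hyperfilter ℕ) (𝓝 (y₀ : OnePoint ℂ)) :=
    fun h => (OnePoint.continuous_coe.tendsto _).comp h
  have hGx₀ : bdry G x₀ = w₀ :=
    tendsto_nhds_unique ((hlim (hlimit hx₀)).congr fun n => hv n) (hlimit hv₀)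
  have hG0 : bdry G (0 : ℂ) = w₀ :=
    tendsto_nhds_unique ((hlim tendsto_const_nhds).congr fun n => hw n) (hlimit hw₀)
  obtain rfl : x₀ = 0 := OnePoint.coe_injective (hG.bdry_injective (hGx₀.trans hG0.symm))
  simp at hx₀1

section Scale

variable {K : ℝ} {H : Hyp3 ≃ Hyp3}

theorem _root_.BiLip.exists_norm_planar_sub_le (hH : BiLip K H)
    (hinf : bdry H OnePoint.infty = OnePoint.infty) : ∃ C : ℝ, 0 < C ∧ ∀ (p : Hyp3) (y : ℂ),
      ‖y - p.z‖ ≤ p.t → ‖hH.planar hinf y - (H p).z‖ ≤ C * (H p).t := by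
  obtain ⟨C, hC, h⟩ := exists_norm_bdry_le K
  refine ⟨C, hC, fun p y hy => ?_⟩
  have := h _ (hH.rescale p (H p)) (rescale_self_base H p) (hH.bdry_rescale_infty hinf _ _) _ _
    (by rw [norm_div, Complex.norm_real, Real.norm_of_nonneg p.t_pos.le]
        exact div_le_one_of_le₀ hy p.t_pos.le) (hH.bdry_rescale_div hinf p (H p) y)
  rwa [norm_div, Complex.norm_real, Real.norm_of_nonneg (H p).t_pos.le,
    div_le_iff₀ (H p).t_pos] at this

theorem _root_.BiLip.exists_le_norm_planar_sub (hH : BiLip K H)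
    (hinf : bdry H OnePoint.infty = OnePoint.infty) : ∃ C : ℝ, 0 < C ∧ ∀ (p : Hyp3) (w : ℂ),
      ‖w - p.z‖ = p.t → (H p).t ≤ C * ‖hH.planar hinf w - hH.planar hinf p.z‖ := by
  obtain ⟨C, hC, h⟩ := exists_le_norm_bdry_sub K
  refine ⟨C, hC, fun p w hw => ?_⟩
  have h0 := hH.bdry_rescale_div hinf p (H p) p.z
  rw [sub_self, zero_div] at h0
  have := h _ (hH.rescale p (H p)) (rescale_self_base H p) (hH.bdry_rescale_infty hinf _ _) _ _ _
    (by rw [norm_div, hw, Complex.norm_real, Real.norm_of_nonneg p.t_pos.le,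
      div_self p.t_pos.ne']) (hH.bdry_rescale_div hinf p (H p) w) h0
  rwa [← sub_div, sub_sub_sub_cancel_right, norm_div, Complex.norm_real,
    Real.norm_of_nonneg (H p).t_pos.le, mul_div_assoc', one_le_div (H p).t_pos] at this

theorem _root_.BiLip.exists_isQuasisymmetric (hH : BiLip K H)
    (hinf : bdry H OnePoint.infty = OnePoint.infty) :
    ∃ C, IsQuasisymmetric C (hH.planar hinf) := by
  obtain ⟨C₁, hC₁, hle⟩ := hH.exists_norm_planar_sub_le hinf
  obtain ⟨C₂, hC₂, hge⟩ := hH.exists_le_norm_planar_sub hinf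
  refine ⟨2 * C₁ * C₂, by positivity, fun x y w hyw => ?_⟩
  obtain hwx | hwx := (norm_nonneg (w - x)).eq_or_lt
  · obtain rfl : y = x := sub_eq_zero.1 (norm_le_zero_iff.1 (hyw.trans hwx.ge))
    rw [sub_self, norm_zero]
    positivity
  let p : Hyp3 := ⟨x, ‖w - x‖, hwx⟩
  calc ‖hH.planar hinf y - hH.planar hinf x‖
      ≤ ‖hH.planar hinf y - (H p).z‖ + ‖hH.planar hinf x - (H p).z‖ := by
        rw [norm_sub_rev (hH.planar hinf x)]
        exact norm_sub_le_norm_sub_add_norm_sub _ _ _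
    _ ≤ C₁ * (H p).t + C₁ * (H p).t := add_le_add (hle p y hyw) (hle p x (by simp [p]))
    _ = 2 * C₁ * (H p).t := by ring
    _ ≤ 2 * C₁ * (C₂ * ‖hH.planar hinf w - hH.planar hinf x‖) := by
        gcongr
        exact hge p w rfl
    _ = 2 * C₁ * C₂ * ‖hH.planar hinf w - hH.planar hinf x‖ := (mul_assoc _ _ _).symm

end Scale

/-! ### Blowing up at a point of differentiability -/

theorem dist_le_two_mul_cosh (p q : Hyp3) : dist p q ≤ 2 * Real.cosh (dist p q) := by
  rw [Real.cosh_eq]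
  linarith [Real.add_one_le_exp (dist p q), Real.exp_pos (-dist p q)]

theorem dist_le_of_comparable {p q : Hyp3} {C M : ℝ} (hz : ‖p.z - q.z‖ ≤ C * p.t)
    (hpq : p.t ≤ M * q.t) (hqp : q.t ≤ M * p.t) : dist p q ≤ (C ^ 2 + 1) * M + M := by
  have hp := p.t_pos
  have hq := q.t_pos
  refine (dist_le_two_mul_cosh p q).trans ?_
  rw [cosh_dist, mul_div_assoc', div_le_iff₀ (by positivity)]
  have hz2 : ‖p.z - q.z‖ ^ 2 ≤ C ^ 2 * p.t ^ 2 := by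
    rw [← mul_pow]
    gcongr
  have hpt : (C ^ 2 + 1) * p.t ^ 2 ≤ (C ^ 2 + 1) * (M * (p.t * q.t)) := by
    gcongr
    nlinarith
  have hqt : q.t ^ 2 ≤ M * (p.t * q.t) := by nlinarith
  nlinarith

/-- The point at signed distance `s` from height one on the vertical geodesic over `z`. -/
def vertical (z : ℂ) (s : ℝ) : Hyp3 := ⟨z, Real.exp s, Real.exp_pos s⟩

theorem vertical_z (z : ℂ) (s : ℝ) : (vertical z s).z = z := rfl

theorem vertical_t (z : ℂ) (s : ℝ) : (vertical z s).t = Real.exp s := rfl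

variable {K : ℝ} {H : Hyp3 ≃ Hyp3}

theorem exists_norm_eq_one_of_ne_zero {A : ℂ →L[ℝ] ℂ} (hA : A ≠ 0) : ∃ u, ‖u‖ = 1 ∧ A u ≠ 0 := by
  obtain ⟨v, hv⟩ := DFunLike.ne_iff.1 hA
  have hv0 : ‖v‖ ≠ 0 := norm_ne_zero_iff.2 fun h0 => hv (by simp [h0])
  refine ⟨‖v‖⁻¹ • v, by rw [norm_smul, norm_inv, norm_norm, inv_mul_cancel₀ hv0], ?_⟩
  rw [map_smul]
  exact smul_ne_zero (inv_ne_zero hv0) hv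

theorem eventually_norm_sub_mem_Icc {h : ℂ → ℂ} {z u : ℂ} {A : ℂ →L[ℝ] ℂ}
    (hA : HasFDerivAt h A z) (hAu : A u ≠ 0) : ∀ᶠ r : ℝ in 𝓝[>] 0,
      ‖h (z + r • u) - h z‖ ∈ Icc (‖A u‖ / 2 * r) (2 * ‖A u‖ * r) := by
  have hpos : 0 < ‖A u‖ := norm_pos_iff.2 hAu
  have hslope := (hA.hasLineDerivAt u).tendsto_slope_zero_right.norm.eventually
    (Icc_mem_nhds (half_lt_self hpos) (lt_two_mul_self hpos))
  filter_upwards [self_mem_nhdsWithin, hslope] with r hr hslope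
  have hr : 0 < r := hr
  rw [norm_smul, norm_inv, Real.norm_of_nonneg hr.le, ← div_eq_inv_mul] at hslope
  exact ⟨(le_div_iff₀ hr).1 hslope.1, (div_le_iff₀ hr).1 hslope.2⟩

theorem _root_.BiLip.exists_dist_vertical_le (hH : BiLip K H)
    (hinf : bdry H OnePoint.infty = OnePoint.infty) {z : ℂ} {A : ℂ →L[ℝ] ℂ}
    (hA : HasFDerivAt (hH.planar hinf) A z) (hA0 : A ≠ 0) :
    ∃ R, ∀ᶠ s in atBot, dist (H (vertical z s)) (vertical (hH.planar hinf z) s) ≤ R := by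
  obtain ⟨C₁, _, hupper⟩ := hH.exists_norm_planar_sub_le hinf
  obtain ⟨C₂, hC₂, hlower⟩ := hH.exists_le_norm_planar_sub hinf
  obtain ⟨u, hu, hAu⟩ := exists_norm_eq_one_of_ne_zero hA0
  set h := hH.planar hinf
  set a := ‖A u‖
  have ha : 0 < a := norm_pos_iff.2 hAu
  set M := max (2 * C₂ * a) (4 * C₁ / a)
  refine ⟨(C₁ ^ 2 + 1) * M + M, ?_⟩
  filter_upwards [Real.tendsto_exp_atBot_nhdsGT.eventually (eventually_norm_sub_mem_Icc hA hAu)]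
    with s ⟨hs₁, hs₂⟩
  set r := Real.exp s
  have hr0 : 0 < r := Real.exp_pos s
  set p := vertical z s
  set q := H p
  have hq := q.t_pos
  have hnorm : ‖z + r • u - p.z‖ = p.t := by
    rw [vertical_z, vertical_t, add_sub_cancel_left, norm_smul, hu, mul_one,
      Real.norm_of_nonneg hr0.le]
  have hz : ‖h z - q.z‖ ≤ C₁ * q.t := hupper p z (by simpa [p, vertical_z] using p.t_pos.le)
  have hzu : ‖h (z + r • u) - q.z‖ ≤ C₁ * q.t := hupper p _ hnorm.le
  have hqt : q.t ≤ C₂ * ‖h (z + r • u) - h z‖ := hlower p _ hnorm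
  refine dist_le_of_comparable ((norm_sub_rev _ _).trans_le hz) ?_ ?_
  · calc q.t ≤ C₂ * (2 * a * r) := hqt.trans (by gcongr)
      _ = 2 * C₂ * a * r := by ring
      _ ≤ M * r := mul_le_mul_of_nonneg_right (le_max_left _ _) hr0.le
  · have hdiff : a / 2 * r ≤ 2 * C₁ * q.t := by
      have := norm_sub_le_norm_sub_add_norm_sub (h (z + r • u)) q.z (h z)
      rw [norm_sub_rev q.z] at this
      linarith
    calc r = (a / 2 * r) * (2 / a) := by field_simp
      _ ≤ (2 * C₁ * q.t) * (2 / a) := by gcongr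
      _ = 4 * C₁ / a * q.t := by ring
      _ ≤ M * q.t := mul_le_mul_of_nonneg_right (le_max_right _ _) hq.le

/-- Equivariance turns `rescale H p q` into `H` composed with two isometries; when `q` stays close
to `H p` these isometries move the base point a bounded amount, hence subconverge. -/
theorem _root_.BiLip.exists_tendsto_bdry_rescale (hH : BiLip K H) {D R : ℝ}
    (hco : ∀ p, ∃ γ δ : Hyp3 ≃ᵢ Hyp3, dist (γ base) p ≤ D ∧ ∀ x, H (γ x) = δ (H x))
    {ι : Type*} (l : Ultrafilter ι) {P Q : ι → Hyp3} (hPQ : ∀ᶠ i in l, dist (H (P i)) (Q i) ≤ R) :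
    ∃ ε κ : Hyp3 ≃ᵢ Hyp3, ∀ ξ, Tendsto (fun i => bdry (rescale H (P i) (Q i)) ξ) l
      (𝓝 (bdry ε (bdry H (bdry κ ξ)))) := by
  choose γ δ hγ hγδ using hco
  let k (i : ι) : Hyp3 ≃ᵢ Hyp3 := (fromBase (P i)).trans (γ (P i)).symm
  let e (i : ι) : Hyp3 ≃ᵢ Hyp3 := (δ (P i)).trans (fromBase (Q i)).symm
  have hδ (p x : Hyp3) : δ p (H ((γ p).symm x)) = H x := by
    rw [← hγδ, IsometryEquiv.apply_symm_apply]
  have hfac (i : ι) : rescale H (P i) (Q i) =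
      (k i).toEquiv.trans (H.trans (e i).toEquiv) := by
    ext1 x
    exact congrArg (fromBase (Q i)).symm (hδ _ _).symm
  have hk (i : ι) : dist (k i base) base ≤ D := by
    simp only [k, IsometryEquiv.trans_apply, fromBase_base]
    rw [← (γ (P i)).dist_eq, IsometryEquiv.apply_symm_apply, dist_comm]
    exact hγ (P i)
  have he : ∀ᶠ i in l, dist (e i (H base)) base ≤ K * D + R := by
    filter_upwards [hPQ] with i hi
    have hq : dist (e i (H base)) base = dist (δ (P i) (H base)) (Q i) := by
      rw [← fromBase_symm_self (Q i)]
      exact (fromBase (Q i)).symm.dist_eq _ _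
    rw [hq, ← hγδ]
    refine (dist_triangle _ (H (P i)) _).trans (add_le_add ((hH.le _ _).trans ?_) hi)
    exact mul_le_mul_of_nonneg_left (hγ _) hH.pos.le
  obtain ⟨κ, hκ, hκlim⟩ := BiLip.exists_ultralimit l (F := fun i => (k i).toEquiv)
    (.of_forall fun i => .of_isometry (k i)) (.of_forall hk)
  obtain ⟨ε, hε, hεlim⟩ := BiLip.exists_ultralimit l (F := fun i => (e i).toEquiv)
    (.of_forall fun i => .of_isometry (e i)) he
  refine ⟨hε.toIsometry, hκ.toIsometry, fun ξ => ?_⟩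
  have hcomp (i : ι) : bdry (rescale H (P i) (Q i)) ξ = bdry (e i) (bdry H (bdry (k i) ξ)) := by
    rw [← bdry_comp (hH.tendsto_bdry _) (tendsto_bdry_isometry _ _), hfac]
    exact bdry_comp (H := H.trans (e i).toEquiv) (tendsto_bdry_isometry _ _)
      ((hH.trans_isometry (e i)).tendsto_bdry _)
  simp only [hcomp]
  exact tendsto_bdry (.of_forall fun i => .of_isometry (e i)) hε hεlim <|
    (hH.continuous_bdry.tendsto _).comp <|
      tendsto_bdry (.of_forall fun i => .of_isometry (k i)) hκ hκlim tendsto_const_nhds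

/-- The linear map is a derivative of the planar boundary map, obtained by zooming in. -/
theorem _root_.BiLip.exists_linear_bdry (hH : BiLip K H)
    (hinf : bdry H OnePoint.infty = OnePoint.infty) {D : ℝ}
    (hco : ∀ p, ∃ γ δ : Hyp3 ≃ᵢ Hyp3, dist (γ base) p ≤ D ∧ ∀ x, H (γ x) = δ (H x)) :
    ∃ (A : ℂ →L[ℝ] ℂ) (ε κ : Hyp3 ≃ᵢ Hyp3),
      ∀ ξ, bdry ε (bdry H (bdry κ ξ)) = OnePoint.map A ξ := by
  obtain ⟨C, hqs⟩ := hH.exists_isQuasisymmetric hinf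
  obtain ⟨z, A, hA, hA0⟩ := hqs.exists_hasFDerivAt_ne_zero
  obtain ⟨R, hR⟩ := hH.exists_dist_vertical_le hinf hA hA0
  set h := hH.planar hinf
  have hl : (Ultrafilter.of (atBot : Filter ℝ) : Filter ℝ) ≤ atBot := Ultrafilter.of_le _
  obtain ⟨ε, κ, hlim⟩ := hH.exists_tendsto_bdry_rescale hco (Ultrafilter.of atBot)
    (P := vertical z) (Q := vertical (h z)) (hl hR)
  refine ⟨A, ε, κ, fun ξ => tendsto_nhds_unique (hlim ξ) ?_⟩
  induction ξ using OnePoint.rec with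
  | infty => exact tendsto_const_nhds.congr fun s => (hH.bdry_rescale_infty hinf _ _).symm
  | coe η =>
    have hslope := ((hA.hasLineDerivAt η).tendsto_slope_zero_right.comp
      Real.tendsto_exp_atBot_nhdsGT).mono_left hl
    refine ((OnePoint.continuous_coe.tendsto _).comp hslope).congr fun s => ?_
    have hη : ((z + Real.exp s • η - (vertical z s).z) / (vertical z s).t : ℂ) = η := by
      rw [vertical_z, add_sub_cancel_left, Complex.real_smul]
      exact mul_div_cancel_left₀ _ (Complex.ofReal_ne_zero.2 (Real.exp_pos s).ne')
    conv_rhs => rw [← hη]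
    rw [hH.bdry_rescale_div hinf, Function.comp_apply, Function.comp_apply, Complex.real_smul,
      Complex.ofReal_inv, ← div_eq_inv_mul]
    rfl

end Hyp3

/-! ### Conformality of the derivative -/

theorem sum_norm_sq_map_eq {E F ι : Type*} [NormedAddCommGroup E] [InnerProductSpace ℝ E]
    [FiniteDimensional ℝ E] [NormedAddCommGroup F] [InnerProductSpace ℝ F] [CompleteSpace F]
    [Fintype ι] (A : E →L[ℝ] F) (b b' : OrthonormalBasis ι ℝ E) :
    ∑ i, ‖A (b i)‖ ^ 2 = ∑ i, ‖A (b' i)‖ ^ 2 := by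
  have := FiniteDimensional.complete ℝ E
  have htrace (b : OrthonormalBasis ι ℝ E) :
      ∑ i, ‖A (b i)‖ ^ 2 = LinearMap.trace ℝ E (A.adjoint ∘L A : E →L[ℝ] E) := by
    simp [LinearMap.trace_eq_sum_inner _ b, ContinuousLinearMap.adjoint_inner_right]
  rw [htrace, htrace]

theorem exists_orthonormalBasis_complex {u v : ℂ} (hu : ‖u‖ = 1) (hv : ‖v‖ = 1)
    (huv : inner ℝ u v = 0) : ∃ b : OrthonormalBasis (Fin 2) ℝ ℂ, b 0 = u ∧ b 1 = v := by
  have hon : Orthonormal ℝ ![u, v] := by simp [orthonormal_vecCons_iff, hu, hv, huv]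
  let b := basisOfOrthonormalOfCardEqFinrank hon (by simp)
  have hb : ⇑b = ![u, v] := coe_basisOfOrthonormalOfCardEqFinrank hon _
  exact ⟨b.toOrthonormalBasis (hb ▸ hon), by simp [hb], by simp [hb]⟩

theorem norm_sq_map_add_norm_sq_map_eq (A : ℂ →L[ℝ] ℂ) {u v u' v' : ℂ} (hu : ‖u‖ = 1)
    (hv : ‖v‖ = 1) (huv : inner ℝ u v = 0) (hu' : ‖u'‖ = 1) (hv' : ‖v'‖ = 1)
    (huv' : inner ℝ u' v' = 0) : ‖A u‖ ^ 2 + ‖A v‖ ^ 2 = ‖A u'‖ ^ 2 + ‖A v'‖ ^ 2 := by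
  obtain ⟨b, rfl, rfl⟩ := exists_orthonormalBasis_complex hu hv huv
  obtain ⟨b', rfl, rfl⟩ := exists_orthonormalBasis_complex hu' hv' huv'
  simpa only [Fin.sum_univ_two] using sum_norm_sq_map_eq A b b'

theorem inner_self_I_mul (u : ℂ) : inner ℝ u (Complex.I * u) = 0 := by
  simp [Complex.inner]
  ring

/-- The values of `‖A u‖ ^ 2` and `‖A (I * u)‖ ^ 2` have constant sum and constant product, so
`‖A u‖ ^ 2` takes at most two values on the unit circle, which is connected. -/
theorem exists_norm_map_eq_mul_norm {A : ℂ →L[ℝ] ℂ} (hA : A ≠ 0) {k : ℝ}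
    (hk : ∀ u, ‖u‖ = 1 → ‖A u‖ ^ 2 * ‖A (Complex.I * u)‖ ^ 2 = k) :
    ∃ l : ℝ, 0 < l ∧ ∀ v, ‖A v‖ = l * ‖v‖ := by
  let T : Set ℝ := {‖A 1‖ ^ 2, ‖A Complex.I‖ ^ 2}
  have hmaps : MapsTo (fun u => ‖A u‖ ^ 2) (Metric.sphere 0 1) T := by
    intro u hu
    have hu : ‖u‖ = 1 := mem_sphere_zero_iff_norm.1 hu
    have hsum := norm_sq_map_add_norm_sq_map_eq A hu (by simpa) (inner_self_I_mul u)
      norm_one (by simp) (inner_self_I_mul 1)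
    have hprod := (hk u hu).trans (hk 1 norm_one).symm
    rw [mul_one] at hsum hprod
    have hroot : (‖A u‖ ^ 2 - ‖A 1‖ ^ 2) * (‖A u‖ ^ 2 - ‖A Complex.I‖ ^ 2) = 0 := by
      linear_combination ‖A u‖ ^ 2 * hsum - hprod
    exact (mul_eq_zero.1 hroot).imp sub_eq_zero.1 sub_eq_zero.1
  have hconn : IsPreconnected (Metric.sphere (0 : ℂ) 1) :=
    isPreconnected_sphere (by simp [Complex.rank_real_complex]) _ _
  obtain ⟨u, hu, hAu⟩ := Hyp3.exists_norm_eq_one_of_ne_zero hA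
  have hconst (v : ℂ) (hv : ‖v‖ = 1) : ‖A v‖ = ‖A u‖ :=
    (sq_eq_sq₀ (norm_nonneg _) (norm_nonneg _)).1 <|
      hconn.constant_of_mapsTo (T := T) (toFinite T).isDiscrete (by fun_prop) hmaps
        (by simpa) (by simpa)
  refine ⟨‖A u‖, norm_pos_iff.2 hAu, fun v => ?_⟩
  rcases eq_or_ne v 0 with rfl | hv
  · simp
  have hv := norm_ne_zero_iff.2 hv
  have hunit := hconst (‖v‖⁻¹ • v) (by rw [norm_smul, norm_inv, norm_norm, inv_mul_cancel₀ hv])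
  rw [map_smul, norm_smul, norm_inv, norm_norm, inv_mul_eq_iff_eq_mul₀ hv] at hunit
  rw [hunit, mul_comm]

namespace Hyp3

theorem exists_bdry_eq_infty {g : Hyp3 ≃ᵢ Hyp3} (hg : bdry g OnePoint.infty ≠ OnePoint.infty) :
    ∃ w : ℂ, bdry g w = OnePoint.infty := by
  have hsymm : bdry g.symm OnePoint.infty ≠ OnePoint.infty := fun h => hg <| by
    conv_lhs => rw [← h]
    exact bdry_bdry_symm_isometry g _
  obtain ⟨w, hw⟩ := OnePoint.ne_infty_iff_exists.1 hsymm
  exact ⟨w, hw ▸ bdry_bdry_symm_isometry g _⟩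

variable {A : ℂ →L[ℝ] ℂ} {g g' : Hyp3 ≃ᵢ Hyp3}

/-- With `w` the pole of `g` and `c = g ∞`, the map `V u` is proportional to `g (w + u) - c`; it is
isometric on the unit circle because `g` is an inversion up to similarities. -/
theorem exists_norm_map_mul_norm_map (hA : Function.Injective A)
    (hconj : ∀ ξ, bdry g' (OnePoint.map A ξ) = OnePoint.map A (bdry g ξ))
    (hg : bdry g OnePoint.infty ≠ OnePoint.infty) : ∃ (k : ℝ) (V : ℂ → ℂ),
      (∀ u, ‖u‖ = 1 → ‖V u‖ = 1) ∧ (∀ u v, ‖u‖ = 1 → ‖v‖ = 1 → ‖V u - V v‖ = ‖u - v‖) ∧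
      ∀ u, ‖u‖ = 1 → ‖A (V u)‖ * ‖A u‖ = k := by
  obtain ⟨c, hc⟩ := OnePoint.ne_infty_iff_exists.1 hg
  obtain ⟨w, hw⟩ := exists_bdry_eq_infty hg
  have hc' : bdry g' OnePoint.infty = (A c : ℂ) := by
    simpa only [← hc, OnePoint.map_infty, OnePoint.map_some] using hconj OnePoint.infty
  have hw' : bdry g' (A w : ℂ) = OnePoint.infty := by
    simpa only [hw, OnePoint.map_infty, OnePoint.map_some] using hconj w
  obtain ⟨m, hm, f, hf, hfc, hff⟩ := exists_norm_bdry g hc.symm hw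
  obtain ⟨m', -, f', hf', hfc', -⟩ := exists_norm_bdry g' hc' hw'
  have hAf (x : ℂ) (hx : x ≠ w) : f' (A x) = A (f x) := OnePoint.coe_injective <| by
    simpa only [OnePoint.map_some, hf x hx, hf' (A x) (hA.ne hx)] using hconj x
  have hne {u : ℂ} (hu : ‖u‖ = 1) : w + u ≠ w := by
    rw [Ne, add_eq_left, ← norm_eq_zero, hu]
    exact one_ne_zero
  have hm_norm : ‖m⁻¹‖ = m⁻¹ := Real.norm_of_nonneg (inv_nonneg.2 hm.le)
  refine ⟨m' / m, fun u => m⁻¹ • (f (w + u) - c), fun u hu => ?_, fun u v hu hv => ?_,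
    fun u hu => ?_⟩
  · rw [norm_smul, hfc _ (hne hu), add_sub_cancel_left, hu, div_one, hm_norm,
      inv_mul_cancel₀ hm.ne']
  · rw [← smul_sub, sub_sub_sub_cancel_right, norm_smul, hff _ _ (hne hu) (hne hv),
      add_sub_cancel_left, add_sub_cancel_left, hu, hv, hm_norm, add_sub_add_left_eq_sub, mul_one,
      div_one, inv_mul_cancel_left₀ hm.ne']
  · have hAu : ‖A u‖ ≠ 0 := norm_ne_zero_iff.2 fun h => by
      rw [hA (h.trans A.map_zero.symm), norm_zero] at hu
      exact zero_ne_one hu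
    rw [map_smul, norm_smul, hm_norm, map_sub, ← hAf _ (hne hu), hfc' _ (hA.ne (hne hu)),
      ← map_sub, add_sub_cancel_left]
    field_simp

theorem exists_norm_map_eq_mul_norm_of_conj (hA : Function.Injective A)
    (hconj : ∀ ξ, bdry g' (OnePoint.map A ξ) = OnePoint.map A (bdry g ξ))
    (hg : bdry g OnePoint.infty ≠ OnePoint.infty) :
    ∃ l : ℝ, 0 < l ∧ ∀ v, ‖A v‖ = l * ‖v‖ := by
  obtain ⟨k, V, hV, hVV, hk⟩ := exists_norm_map_mul_norm_map hA hconj hg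
  have hpos {u : ℂ} (hu : ‖u‖ = 1) : 0 < ‖A u‖ ^ 2 := by
    have hu0 : u ≠ 0 := fun h => by simp [h] at hu
    have : ‖A u‖ ≠ 0 := norm_ne_zero_iff.2 fun h => hu0 (hA (h.trans A.map_zero.symm))
    positivity
  have hA0 : A ≠ 0 := fun h => one_ne_zero (hA (by simp [h]) : (1 : ℂ) = 0)
  refine exists_norm_map_eq_mul_norm hA0 (k := k ^ 2) fun u hu => ?_
  have hIu : ‖Complex.I * u‖ = 1 := by simpa
  have horth : inner ℝ (V u) (V (Complex.I * u)) = 0 := by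
    rw [← inner_self_I_mul u]
    simp only [real_inner_eq_norm_mul_self_add_norm_mul_self_sub_norm_sub_mul_self_div_two,
      hVV u _ hu hIu, hV u hu, hV _ hIu, hu, hIu]
  have hsum := norm_sq_map_add_norm_sq_map_eq A hu hIu (inner_self_I_mul u) (hV u hu)
    (hV _ hIu) horth
  have hku : ‖A (V u)‖ ^ 2 * ‖A u‖ ^ 2 = k ^ 2 := by rw [← mul_pow, hk u hu]
  have hkIu : ‖A (V (Complex.I * u))‖ ^ 2 * ‖A (Complex.I * u)‖ ^ 2 = k ^ 2 := by
    rw [← mul_pow, hk _ hIu]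
  refine mul_right_cancel₀ (add_pos (hpos hu) (hpos hIu)).ne' ?_
  linear_combination ‖A u‖ ^ 2 * ‖A (Complex.I * u)‖ ^ 2 * hsum +
    ‖A (Complex.I * u)‖ ^ 2 * hku + ‖A u‖ ^ 2 * hkIu

/-! ### The action of a lattice on the ideal boundary -/

section Similarity

variable {Ψ : ℂ ≃ ℂ} {l : ℝ} {hl : 0 < l} {hΨ : ∀ z w, ‖Ψ z - Ψ w‖ = l * ‖z - w‖} {w : ℂ}

theorem similarity_pow_t (n : ℕ) (p : Hyp3) : ((similarity Ψ l hl hΨ ^ n) p).t = l ^ n * p.t := by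
  induction n with
  | zero => simp
  | succ n ih =>
    rw [pow_succ', IsometryEquiv.mul_apply, similarity_t, ih, pow_succ', mul_assoc]

theorem norm_similarity_pow_z_sub (hw : Ψ w = w) (n : ℕ) (p : Hyp3) :
    ‖((similarity Ψ l hl hΨ ^ n) p).z - w‖ = l ^ n * ‖p.z - w‖ := by
  induction n with
  | zero => simp
  | succ n ih =>
    rw [pow_succ', IsometryEquiv.mul_apply, similarity_z]
    nth_rewrite 1 [← hw]
    rw [hΨ, ih, pow_succ', mul_assoc]

theorem similarity_pow_symm_z (hw : Ψ w = w) (n : ℕ) {p : Hyp3} (hp : p.z = w) :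
    ((similarity Ψ l hl hΨ ^ n).symm p).z = w := by
  have h := norm_similarity_pow_z_sub (hl := hl) (hΨ := hΨ) hw n
    ((similarity Ψ l hl hΨ ^ n).symm p)
  rw [IsometryEquiv.apply_symm_apply, hp, sub_self, norm_zero, eq_comm] at h
  exact sub_eq_zero.1 <| norm_eq_zero.1 <| (mul_eq_zero.1 h).resolve_left (pow_pos hl n).ne'

theorem norm_conj_similarity_pow_z_sub (hw : Ψ w = w) {g : Hyp3 ≃ᵢ Hyp3}
    (hg : bdry g OnePoint.infty = OnePoint.infty) {p : Hyp3} (hp : p.z = w) (n : ℕ) :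
    ‖((similarity Ψ l hl hΨ ^ n * g * (similarity Ψ l hl hΨ ^ n)⁻¹) p).z - w‖ =
      l ^ n * ‖(g p).z - w‖ := by
  simp only [IsometryEquiv.mul_apply]
  rw [norm_similarity_pow_z_sub hw, z_eq_of_bdry_infty hg]
  exact (similarity_pow_symm_z hw n hp).trans hp.symm

theorem conj_similarity_pow_t {g : Hyp3 ≃ᵢ Hyp3} (hg : bdry g OnePoint.infty = OnePoint.infty)
    (p : Hyp3) (n : ℕ) :
    ((similarity Ψ l hl hΨ ^ n * g * (similarity Ψ l hl hΨ ^ n)⁻¹) p).t = (g p).t := by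
  obtain ⟨Θ, m, hm, hΘ, rfl⟩ := exists_eq_similarity hg
  have h := similarity_pow_t (hl := hl) (hΨ := hΨ) n ((similarity Ψ l hl hΨ ^ n).symm p)
  rw [IsometryEquiv.apply_symm_apply] at h
  change (((similarity Ψ l hl hΨ ^ n) (similarity Θ m hm hΘ
    ((similarity Ψ l hl hΨ ^ n).symm p))).t) = _
  rw [similarity_pow_t, similarity_t, similarity_t, h]
  ring

end Similarity

variable {Γ : Subgroup (Hyp3 ≃ᵢ Hyp3)} {o : Hyp3} {D : ℝ}

theorem exists_similarity_mem_lt_one (hco : ∀ p, ∃ γ ∈ Γ, dist (γ o) p ≤ D)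
    (hfix : ∀ γ ∈ Γ, bdry γ OnePoint.infty = OnePoint.infty) :
    ∃ (Ψ : ℂ ≃ ℂ) (l : ℝ) (hl : 0 < l) (hΨ : ∀ z w, ‖Ψ z - Ψ w‖ = l * ‖z - w‖),
      l < 1 ∧ similarity Ψ l hl hΨ ∈ Γ := by
  have ho := o.t_pos
  let p : Hyp3 := ⟨0, o.t * Real.exp (-D - 1), by positivity⟩
  obtain ⟨γ, hγ, hdist⟩ := hco p
  obtain ⟨Ψ, l, hl, hΨ, rfl⟩ := exists_eq_similarity (hfix γ hγ)
  refine ⟨Ψ, l, hl, hΨ, ?_, hγ⟩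
  refine lt_of_mul_lt_mul_right ?_ ho.le
  calc l * o.t ≤ p.t * Real.exp (dist (similarity Ψ l hl hΨ o) p) :=
        height_le (similarity Ψ l hl hΨ o) p
    _ ≤ o.t * Real.exp (-D - 1) * Real.exp D := by gcongr
    _ = o.t * Real.exp (-1) := by
      rw [mul_assoc, ← Real.exp_add]
      ring_nf
    _ < o.t * 1 := by gcongr; simp
    _ = 1 * o.t := mul_comm _ _

theorem exists_fixedPoint_of_norm_sub_eq {Ψ : ℂ → ℂ} {l : ℝ} (hl : 0 ≤ l) (hl1 : l < 1)
    (hΨ : ∀ z w, ‖Ψ z - Ψ w‖ = l * ‖z - w‖) : ∃ w, Ψ w = w := by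
  have hcontr : ContractingWith ⟨l, hl⟩ Ψ :=
    ⟨hl1, LipschitzWith.of_dist_le_mul fun z w => by
      rw [dist_eq_norm, dist_eq_norm]
      exact (hΨ z w).le⟩
  exact ⟨hcontr.fixedPoint, hcontr.fixedPoint_isFixedPt⟩

/-- The conjugates of `g` by the powers of the contraction move `p` a bounded amount, so
discreteness leaves only finitely many of them. -/
theorem z_apply_eq_of_finite (hfin : ∀ p R, {γ | γ ∈ Γ ∧ dist (γ p) p ≤ R}.Finite)
    {Ψ : ℂ ≃ ℂ} {l : ℝ} {hl : 0 < l} {hΨ : ∀ z w, ‖Ψ z - Ψ w‖ = l * ‖z - w‖} (hl1 : l < 1)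
    (hmem : similarity Ψ l hl hΨ ∈ Γ) {p : Hyp3} (hp : Ψ p.z = p.z) {g : Hyp3 ≃ᵢ Hyp3}
    (hg : g ∈ Γ) (hginf : bdry g OnePoint.infty = OnePoint.infty) : (g p).z = p.z := by
  set φ := similarity Ψ l hl hΨ
  have hz := norm_conj_similarity_pow_z_sub (hl := hl) (hΨ := hΨ) hp hginf rfl
  have ht := conj_similarity_pow_t (hl := hl) (hΨ := hΨ) hginf p
  have hp0 := p.t_pos
  have hgp0 := (g p).t_pos
  set d := ‖(g p).z - p.z‖
  set M := max ((g p).t / p.t) (p.t / (g p).t)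
  have hbound (n : ℕ) : dist ((φ ^ n * g * (φ ^ n)⁻¹) p) p ≤ ((d / (g p).t) ^ 2 + 1) * M + M := by
    refine dist_le_of_comparable ?_ ?_ ?_
    · rw [hz, ht, div_mul_cancel₀ _ hgp0.ne']
      exact mul_le_of_le_one_left (norm_nonneg _) (pow_le_one₀ hl.le hl1.le)
    · rw [ht, ← div_le_iff₀ hp0]
      exact le_max_left _ _
    · rw [ht, ← div_le_iff₀ hgp0]
      exact le_max_right _ _
  by_contra hne
  have hd0 : d ≠ 0 := norm_ne_zero_iff.2 (sub_ne_zero.2 hne)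
  refine (Set.infinite_of_injective_forall_mem (f := fun n : ℕ => φ ^ n * g * (φ ^ n)⁻¹)
    (s := {γ | γ ∈ Γ ∧ dist (γ p) p ≤ ((d / (g p).t) ^ 2 + 1) * M + M})
    (fun n k heq => ?_) fun n => ⟨?_, hbound n⟩) (hfin p _)
  · have h := (hz n).symm.trans ((congrArg (fun γ : Hyp3 ≃ᵢ Hyp3 => ‖(γ p).z - p.z‖) heq).trans
      (hz k))
    exact pow_right_injective₀ hl hl1.ne (mul_right_cancel₀ hd0 h)
  · exact Γ.mul_mem (Γ.mul_mem (Γ.pow_mem hmem n) hg) (Γ.inv_mem (Γ.pow_mem hmem n))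

theorem exists_bdry_infty_ne_infty (hfin : ∀ p R, {γ | γ ∈ Γ ∧ dist (γ p) p ≤ R}.Finite)
    (hco : ∀ p, ∃ γ ∈ Γ, dist (γ o) p ≤ D) :
    ∃ γ ∈ Γ, bdry γ OnePoint.infty ≠ OnePoint.infty := by
  by_contra! hfix
  obtain ⟨Ψ, l, hl, hΨ, hl1, hmem⟩ := exists_similarity_mem_lt_one hco hfix
  obtain ⟨w, hw⟩ := exists_fixedPoint_of_norm_sub_eq hl.le hl1 hΨ
  let b : Hyp3 := vertical w 0
  set D' := dist b o + D
  obtain ⟨g, hg, hdist⟩ := hco (vertical (w + (Real.exp D' + 1 : ℝ)) 0)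
  have hgb : (g b).z = w := z_apply_eq_of_finite (p := b) hfin hl1 hmem hw hg (hfix g hg)
  have hD' : dist (g b) (vertical (w + (Real.exp D' + 1 : ℝ)) 0) ≤ D' :=
    (dist_triangle _ (g o) _).trans (add_le_add (g.dist_eq b o).le hdist)
  have hfar := norm_z_sub_le (g b) (vertical (w + (Real.exp D' + 1 : ℝ)) 0)
  rw [hgb, vertical_z, vertical_t, Real.exp_zero, one_mul, sub_add_cancel_left, norm_neg,
    Complex.norm_real, Real.norm_of_nonneg (by positivity)] at hfar
  linarith [Real.exp_le_exp.2 hD']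

theorem exists_bdry_infty_eq (ξ : OnePoint ℂ) :
    ∃ α : Hyp3 ≃ᵢ Hyp3, bdry α OnePoint.infty = ξ := by
  induction ξ using OnePoint.rec with
  | infty => exact ⟨translation 0, bdry_translation_infty 0⟩
  | coe z =>
    refine ⟨inversion.trans (translation z), ?_⟩
    rw [bdry_trans, bdry_inversion_infty, bdry_translation_coe, zero_add]

theorem exists_bdry_ne (hfin : ∀ p R, {γ | γ ∈ Γ ∧ dist (γ p) p ≤ R}.Finite)
    (hco : ∀ p, ∃ γ ∈ Γ, dist (γ o) p ≤ D) (ξ : OnePoint ℂ) : ∃ γ ∈ Γ, bdry γ ξ ≠ ξ := by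
  obtain ⟨α, rfl⟩ := exists_bdry_infty_eq ξ
  let Γ' : Subgroup (Hyp3 ≃ᵢ Hyp3) := Γ.comap (MulAut.conj α).toMonoidHom
  have hfin' (p : Hyp3) (R : ℝ) : {γ | γ ∈ Γ' ∧ dist (γ p) p ≤ R}.Finite := by
    refine ((hfin (α p) R).preimage (MulAut.conj α).injective.injOn).subset fun γ hγ => ⟨hγ.1, ?_⟩
    change dist (α (γ (α.symm (α p)))) (α p) ≤ R
    rw [α.symm_apply_apply, α.dist_eq]
    exact hγ.2
  have hco' (p : Hyp3) : ∃ γ ∈ Γ', dist (γ (α.symm o)) p ≤ D := by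
    obtain ⟨γ, hγ, h⟩ := hco (α p)
    refine ⟨(MulAut.conj α).symm γ, ?_, ?_⟩
    · rw [Subgroup.mem_comap]
      exact ((MulAut.conj α).apply_symm_apply γ).symm ▸ hγ
    · change dist (α.symm (γ (α (α.symm o)))) p ≤ D
      rwa [α.apply_symm_apply, ← α.dist_eq, α.apply_symm_apply]
  obtain ⟨γ, hγ, hne⟩ := exists_bdry_infty_ne_infty hfin' hco'
  refine ⟨_, hγ, fun h => hne ?_⟩
  have hconj : bdry α (bdry γ (bdry α.symm (bdry α OnePoint.infty))) = bdry α OnePoint.infty := by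
    rw [← bdry_trans, ← bdry_trans]
    exact h
  rw [bdry_symm_bdry_isometry] at hconj
  exact (BiLip.of_isometry α).bdry_injective hconj

end Hyp3

namespace NiceLattice

variable (L : NiceLattice)

theorem exists_dist_le : ∃ D : ℝ, ∀ p, ∃ γ ∈ L.Γ, dist (γ Hyp3.base) p ≤ D := by
  obtain ⟨D, hD⟩ := Metric.isBounded_iff.1 (isCompact_univ (X := L.Manifold)).isBounded
  refine ⟨D + 1, fun p => ?_⟩
  have hdist := hD (mem_univ (L.proj p)) (mem_univ (L.proj Hyp3.base))
  rw [dist_eq_infDist] at hdist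
  have hne : (L.proj ⁻¹' {L.proj Hyp3.base}).Nonempty := ⟨Hyp3.base, rfl⟩
  obtain ⟨q, hq, hpq⟩ := (Metric.infDist_lt_iff hne).1 (hdist.trans_lt (lt_add_one D))
  obtain ⟨γ, rfl⟩ := L.proj_eq_iff.1 (mem_singleton_iff.1 hq)
  exact ⟨γ.1, γ.2, (dist_comm _ _).trans_le hpq.le⟩

theorem finite_setOf_dist_le (p : Hyp3) (R : ℝ) : {γ | γ ∈ L.Γ ∧ dist (γ p) p ≤ R}.Finite := by
  have hK := isCompact_closedBall p R
  refine ((ProperlyDiscontinuousSMul.finite_disjoint_inter_image (Γ := L.Γ) hK hK).image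
    Subtype.val).subset ?_
  rintro γ ⟨hγ, hdist⟩
  exact ⟨⟨γ, hγ⟩, ⟨γ p, ⟨p, Metric.mem_closedBall_self (dist_nonneg.trans hdist), rfl⟩, hdist⟩, rfl⟩

end NiceLattice

/-! ### Rigidity of the boundary map -/

namespace Hyp3

theorem exists_bdry_eq_map_of_norm_eq {A : ℂ →L[ℝ] ℂ} {l : ℝ} (hl : 0 < l)
    (hA : ∀ v, ‖A v‖ = l * ‖v‖) : ∃ Θ : Hyp3 ≃ᵢ Hyp3, ∀ ξ, bdry Θ ξ = OnePoint.map A ξ := by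
  have hinj : Function.Injective A := (injective_iff_map_eq_zero A).2 fun v hv => by
    have hlv := hA v
    rw [hv, norm_zero, eq_comm] at hlv
    exact norm_eq_zero.1 ((mul_eq_zero.1 hlv).resolve_left hl.ne')
  let Ψ : ℂ ≃ ℂ := (LinearEquiv.ofInjectiveEndo A.toLinearMap hinj).toEquiv
  refine ⟨similarity Ψ l hl fun z w => (congrArg norm (map_sub A z w)).symm.trans (hA _),
    fun ξ => ?_⟩
  induction ξ using OnePoint.rec with
  | infty => exact bdry_similarity_infty _ _ _ _
  | coe z => exact bdry_similarity_coe _ _ _ _ z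

variable {K : ℝ} {H : Hyp3 ≃ Hyp3}

theorem _root_.BiLip.bdry_bdry_of_semiconj (hH : BiLip K H) {γ δ : Hyp3 ≃ᵢ Hyp3}
    (h : Function.Semiconj H γ δ) (ξ : OnePoint ℂ) :
    bdry H (bdry γ ξ) = bdry δ (bdry H ξ) := by
  rw [← bdry_comp (tendsto_bdry_isometry γ ξ) (hH.tendsto_bdry _), h.comp_eq,
    bdry_comp (hH.tendsto_bdry ξ) (tendsto_bdry_isometry δ _)]

variable {Γ : Subgroup (Hyp3 ≃ᵢ Hyp3)} {o : Hyp3} {D : ℝ}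

theorem _root_.BiLip.exists_isometry_bdry_eq_of_bdry_infty (hH : BiLip K H)
    (hfin : ∀ p R, {γ | γ ∈ Γ ∧ dist (γ p) p ≤ R}.Finite)
    (hco : ∀ p, ∃ γ ∈ Γ, dist (γ base) p ≤ D)
    (hequi : ∀ γ ∈ Γ, ∃ δ : Hyp3 ≃ᵢ Hyp3, Function.Semiconj H γ δ)
    (hinf : bdry H OnePoint.infty = OnePoint.infty) :
    ∃ Φ : Hyp3 ≃ᵢ Hyp3, ∀ ξ, bdry Φ ξ = bdry H ξ := by
  obtain ⟨A, ε, κ, hA⟩ := hH.exists_linear_bdry hinf fun p => by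
    obtain ⟨γ, hγ, hdist⟩ := hco p
    obtain ⟨δ, hδ⟩ := hequi γ hγ
    exact ⟨γ, δ, hdist, hδ⟩
  have hinj : Function.Injective A := fun x y hxy => by
    have hmap : OnePoint.map A (x : OnePoint ℂ) = OnePoint.map A (y : OnePoint ℂ) := by
      rw [OnePoint.map_some, OnePoint.map_some, hxy]
    rw [← hA, ← hA] at hmap
    exact OnePoint.coe_injective ((BiLip.of_isometry κ).bdry_injective
      (hH.bdry_injective ((BiLip.of_isometry ε).bdry_injective hmap)))
  obtain ⟨γ, hγ, hne⟩ := exists_bdry_ne hfin hco (bdry κ OnePoint.infty)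
  obtain ⟨δ, hδ⟩ := hequi γ hγ
  have hconj (ξ : OnePoint ℂ) : bdry ((ε.symm.trans δ).trans ε) (OnePoint.map A ξ) =
      OnePoint.map A (bdry ((κ.trans γ).trans κ.symm) ξ) := by
    simp only [← hA, bdry_trans, bdry_symm_bdry_isometry, bdry_bdry_symm_isometry,
      hH.bdry_bdry_of_semiconj hδ]
  have hpole : bdry ((κ.trans γ).trans κ.symm) OnePoint.infty ≠ OnePoint.infty := fun h => by
    rw [bdry_trans, bdry_trans] at h
    refine hne ?_
    rw [← bdry_bdry_symm_isometry κ (bdry γ _), h]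
  obtain ⟨l, hl, hAl⟩ := exists_norm_map_eq_mul_norm_of_conj hinj hconj hpole
  obtain ⟨Θ, hΘ⟩ := exists_bdry_eq_map_of_norm_eq hl hAl
  refine ⟨(κ.symm.trans Θ).trans ε.symm, fun ξ => ?_⟩
  rw [bdry_trans, bdry_trans, hΘ, ← hA, bdry_symm_bdry_isometry, bdry_bdry_symm_isometry]

theorem _root_.BiLip.exists_isometry_bdry_eq (hH : BiLip K H)
    (hfin : ∀ p R, {γ | γ ∈ Γ ∧ dist (γ p) p ≤ R}.Finite)
    (hco : ∀ p, ∃ γ ∈ Γ, dist (γ base) p ≤ D)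
    (hequi : ∀ γ ∈ Γ, ∃ δ : Hyp3 ≃ᵢ Hyp3, Function.Semiconj H γ δ) :
    ∃ Φ : Hyp3 ≃ᵢ Hyp3, ∀ ξ, bdry Φ ξ = bdry H ξ := by
  obtain ⟨β, hβ⟩ := exists_bdry_infty_eq (bdry H OnePoint.infty)
  let G : Hyp3 ≃ Hyp3 := H.trans β.symm.toEquiv
  have hG (ξ : OnePoint ℂ) : bdry G ξ = bdry β.symm (bdry H ξ) :=
    bdry_comp (hH.tendsto_bdry _) (tendsto_bdry_isometry β.symm _)
  have hGequi : ∀ γ ∈ Γ, ∃ δ : Hyp3 ≃ᵢ Hyp3, Function.Semiconj G γ δ := fun γ hγ => by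
    obtain ⟨δ, hδ⟩ := hequi γ hγ
    refine ⟨(β.trans δ).trans β.symm, fun x => ?_⟩
    change β.symm (H (γ x)) = β.symm (δ (β (β.symm (H x))))
    rw [hδ x, β.apply_symm_apply]
  obtain ⟨Φ, hΦ⟩ := (hH.trans_isometry β.symm).exists_isometry_bdry_eq_of_bdry_infty hfin hco hGequi
    (by rw [hG, ← hβ, bdry_symm_bdry_isometry])
  exact ⟨Φ.trans β, fun ξ => by rw [bdry_trans, hΦ, hG, bdry_bdry_symm_isometry]⟩

theorem semiconj_isometry_of_bdry_eq (hH : BiLip K H) {Φ γ δ : Hyp3 ≃ᵢ Hyp3}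
    (hΦ : ∀ ξ, bdry Φ ξ = bdry H ξ) (h : Function.Semiconj H γ δ) : Function.Semiconj Φ γ δ := by
  intro p
  have hid := apply_eq_self_of_bdry_eq (((γ.trans Φ).trans δ.symm).trans Φ.symm) (fun ξ => by
    rw [bdry_trans, bdry_trans, bdry_trans, hΦ, hH.bdry_bdry_of_semiconj h, ← hΦ,
      bdry_symm_bdry_isometry, bdry_symm_bdry_isometry]) p
  simp only [IsometryEquiv.trans_apply] at hid
  rwa [IsometryEquiv.symm_apply_eq, IsometryEquiv.symm_apply_eq] at hid

end Hyp3

variable {L₁ L₂ : NiceLattice}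

theorem Conjugates.exists_semiconj {H : Hyp3 → Hyp3} (h : Conjugates L₁ L₂ H) {γ : Hyp3 ≃ᵢ Hyp3}
    (hγ : γ ∈ L₁.Γ) : ∃ δ : Hyp3 ≃ᵢ Hyp3, Function.Semiconj H γ δ := by
  obtain ⟨δ, -, hδ⟩ := h.1 γ hγ
  exact ⟨δ, congrFun hδ⟩

theorem Conjugates.of_semiconj {H Φ : Hyp3 → Hyp3} (h : Conjugates L₁ L₂ H)
    (hΦ : ∀ γ δ : Hyp3 ≃ᵢ Hyp3, Function.Semiconj H γ δ → Function.Semiconj Φ γ δ) :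
    Conjugates L₁ L₂ Φ := by
  refine ⟨fun γ₁ h₁ => ?_, fun γ₂ h₂ => ?_⟩
  · obtain ⟨γ₂, h₂, he⟩ := h.1 γ₁ h₁
    exact ⟨γ₂, h₂, (hΦ _ _ (congrFun he)).comp_eq⟩
  · obtain ⟨γ₁, h₁, he⟩ := h.2 γ₂ h₂
    exact ⟨γ₁, h₁, (hΦ _ _ (congrFun he)).comp_eq⟩

theorem Conjugates.proj_eq_proj_iff {H : Hyp3 → Hyp3} (h : Conjugates L₁ L₂ H)
    (hH : Function.Injective H) (p q : Hyp3) :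
    L₂.proj (H p) = L₂.proj (H q) ↔ L₁.proj p = L₁.proj q := by
  rw [L₁.proj_eq_iff, L₂.proj_eq_iff]
  constructor
  · rintro ⟨γ, hγ⟩
    obtain ⟨γ₁, h₁, he⟩ := h.2 γ.1 γ.2
    exact ⟨⟨γ₁, h₁⟩, hH ((congrFun he q).trans hγ)⟩
  · rintro ⟨γ, rfl⟩
    obtain ⟨γ₂, h₂, he⟩ := h.1 γ.1 γ.2
    exact ⟨⟨γ₂, h₂⟩, (congrFun he q).symm⟩

theorem Conjugates.preimage_proj {Φ : Hyp3 ≃ Hyp3} (h : Conjugates L₁ L₂ Φ) (q : Hyp3) :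
    L₂.proj ⁻¹' {L₂.proj (Φ q)} = Φ '' (L₁.proj ⁻¹' {L₁.proj q}) := by
  ext x
  rw [Φ.image_eq_preimage_symm]
  simp only [mem_preimage, mem_singleton_iff]
  rw [← h.proj_eq_proj_iff Φ.injective, Φ.apply_symm_apply]

theorem Conjugates.nonempty_isometryEquiv {Φ : Hyp3 ≃ᵢ Hyp3}
    (h : Conjugates L₁ L₂ Φ) : Nonempty (L₁.Manifold ≃ᵢ L₂.Manifold) := by
  let F : L₁.Manifold → L₂.Manifold := fun a =>
    L₂.proj (Φ (Function.surjInv L₁.proj_surjective a))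
  have hF (p : Hyp3) : F (L₁.proj p) = L₂.proj (Φ p) :=
    (h.proj_eq_proj_iff Φ.injective _ _).2 (Function.surjInv_eq L₁.proj_surjective _)
  have hiso : Isometry F := by
    refine Isometry.of_dist_eq fun a b => ?_
    obtain ⟨p, rfl⟩ := L₁.proj_surjective a
    obtain ⟨q, rfl⟩ := L₁.proj_surjective b
    rw [hF, hF, NiceLattice.dist_eq_infDist, NiceLattice.dist_eq_infDist]
    exact (congrArg _ (h.preimage_proj (Φ := Φ.toEquiv) q)).trans (Metric.infDist_image Φ.isometry)
  have hsurj : Function.Surjective F := fun b => by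
    obtain ⟨q, rfl⟩ := L₂.proj_surjective b
    exact ⟨L₁.proj (Φ.symm q), by rw [hF, Φ.apply_symm_apply]⟩
  exact ⟨⟨Equiv.ofBijective F ⟨hiso.injective, hsurj⟩, hiso⟩⟩

/-! ### Lifting bi-Lipschitz maps -/

namespace Hyp3

theorem dist_le_of_eventually {X : Type*} [PseudoMetricSpace X] {f : Hyp3 → X} {K : ℝ}
    (hf : Continuous f) (h : ∀ p, ∀ᶠ q in 𝓝 p, dist (f q) (f p) ≤ K * dist q p) (p q : Hyp3) :
    dist (f p) (f q) ≤ K * dist p q := by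
  obtain ⟨γ, hγ, hp, hq⟩ := exists_isometry_real p q
  have hcont : Continuous fun s => dist (f p) (f (γ s)) := by
    have := hγ.continuous
    fun_prop
  have hslope (x r : ℝ) (hr : K < r) :
      ∀ᶠ s in 𝓝[>] x, slope (fun s => dist (f p) (f (γ s))) x s < r := by
    have hnear : ∀ᶠ s in 𝓝[>] x, dist (f (γ s)) (f (γ x)) ≤ K * dist (γ s) (γ x) :=
      (hγ.continuous.continuousAt.tendsto.eventually (h (γ x))).filter_mono nhdsWithin_le_nhds
    filter_upwards [hnear, self_mem_nhdsWithin] with s hs hsx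
    have hsx' : 0 < s - x := sub_pos.2 hsx
    rw [hγ.dist_eq, Real.dist_eq, abs_of_pos hsx', dist_comm] at hs
    rw [slope_def_field, div_lt_iff₀ hsx']
    calc _ ≤ dist (f (γ x)) (f (γ s)) := sub_le_iff_le_add'.2 (dist_triangle _ _ _)
      _ ≤ K * (s - x) := hs
      _ < r * (s - x) := mul_lt_mul_of_pos_right hr hsx'
  have hle := image_le_of_liminf_slope_right_le_deriv_boundary (b := dist p q)
    (B := fun s => K * s) (B' := fun _ => K) hcont.continuousOn
    (by rw [hp, dist_self, mul_zero]) (by fun_prop)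
    (fun x _ => by simpa using ((hasDerivAt_id x).const_mul K).hasDerivWithinAt)
    (fun x _ r hr => (hslope x r hr).frequently) (right_mem_Icc.2 dist_nonneg)
  rwa [hq] at hle

instance : ContractibleSpace Hyp3 := by
  have hc : Convex ℝ (range coord) := by
    rw [range_coord]
    exact convex_halfSpace_gt ⟨fun _ _ => rfl, fun _ _ => rfl⟩ 0
  have := hc.contractibleSpace (range_nonempty coord)
  exact isOpenEmbedding_coord.toIsEmbedding.toHomeomorph.contractibleSpace

instance : LocallyPathConnectedSpace Hyp3 := isOpenEmbedding_coord.locallyPathConnectedSpace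

end Hyp3

namespace NiceLattice

variable (L : NiceLattice)

theorem dist_proj_le (p q : Hyp3) : dist (L.proj p) (L.proj q) ≤ dist p q := by
  rw [dist_eq_infDist]
  exact Metric.infDist_le_dist_of_mem rfl

theorem exists_dist_proj_eq (p : Hyp3) : ∃ r > 0, ∀ x ∈ Metric.ball p r, ∀ y ∈ Metric.ball p r,
    dist (L.proj x) (L.proj y) = dist x y := by
  have hloc : IsLocalHomeomorph L.proj :=
    L.isQuotientCoveringMap_proj.isCoveringMap.isLocalHomeomorph
  obtain ⟨R, hR, hball⟩ := Metric.isOpen_iff.1 (hloc.localInverseAt p).open_target p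
    hloc.self_mem_localInverseAt_target
  have hinj : InjOn L.proj (Metric.ball p R) := hloc.injOn_localInverseAt_target.mono hball
  refine ⟨R / 3, by positivity, fun x hx y hy => le_antisymm (L.dist_proj_le x y) ?_⟩
  rw [dist_eq_infDist, Metric.le_infDist (show (L.proj ⁻¹' {L.proj y}).Nonempty from ⟨y, rfl⟩)]
  intro q hq
  -- A point of the fibre of `y` closer to `x` than `y` lies in the ball of radius `R`.
  by_contra! hlt
  rw [Metric.mem_ball] at hx hy
  have hxy : dist x y < R / 3 + R / 3 := (dist_triangle_right x y p).trans_lt (add_lt_add hx hy)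
  have hqp : dist q p < R := by linarith [dist_triangle_left q p x]
  rw [hinj hqp (show dist y p < R by linarith) hq] at hlt
  exact lt_irrefl _ hlt

variable {L₁ L₂ : NiceLattice}

theorem eq_of_proj_comp_eq {F G : Hyp3 → Hyp3} (hF : Continuous F) (hG : Continuous G)
    (h : ∀ p, L.proj (F p) = L.proj (G p)) {p₀ : Hyp3} (h₀ : F p₀ = G p₀) : F = G :=
  L.isQuotientCoveringMap_proj.isCoveringMap.eq_of_comp_eq hF hG (funext h) p₀ h₀

theorem exists_lift {f : L₁.Manifold → L₂.Manifold} (hf : Continuous f) {p₀ q₀ : Hyp3}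
    (h₀ : L₂.proj q₀ = f (L₁.proj p₀)) :
    ∃ H : Hyp3 → Hyp3, Continuous H ∧ H p₀ = q₀ ∧ ∀ p, L₂.proj (H p) = f (L₁.proj p) := by
  obtain ⟨F, ⟨hF₀, hF⟩, -⟩ :=
    L₂.isQuotientCoveringMap_proj.isCoveringMap.existsUnique_continuousMap_lifts
      ⟨f ∘ L₁.proj, hf.comp L₁.continuous_proj⟩ p₀ q₀ h₀
  exact ⟨F, F.continuous, hF₀, congrFun hF⟩

theorem leftInverse_of_lifts {f : L₁.Manifold → L₂.Manifold} {g : L₂.Manifold → L₁.Manifold}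
    (hgf : Function.LeftInverse g f) {F G : Hyp3 → Hyp3} (hF : Continuous F) (hG : Continuous G)
    (hfF : ∀ p, L₂.proj (F p) = f (L₁.proj p)) (hgG : ∀ p, L₁.proj (G p) = g (L₂.proj p))
    {p₀ : Hyp3} (h₀ : G (F p₀) = p₀) : Function.LeftInverse G F :=
  congrFun <| L₁.eq_of_proj_comp_eq (hG.comp hF) continuous_id
    (fun p => (hgG _).trans ((congrArg g (hfF p)).trans (hgf _))) h₀

theorem exists_comp_eq_of_lift {f : L₁.Manifold → L₂.Manifold} {H : Hyp3 → Hyp3}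
    (hH : Continuous H) (h : ∀ p, L₂.proj (H p) = f (L₁.proj p)) {γ₁ : Hyp3 ≃ᵢ Hyp3}
    (h₁ : γ₁ ∈ L₁.Γ) : ∃ γ₂ ∈ L₂.Γ, H ∘ γ₁ = γ₂ ∘ H := by
  have hproj (p : Hyp3) : L₂.proj (H (γ₁ p)) = L₂.proj (H p) := by
    rw [h, h]
    exact congrArg f (L₁.proj_smul ⟨γ₁, h₁⟩ p)
  obtain ⟨γ₂, hγ₂⟩ := L₂.proj_eq_iff.1 (hproj Hyp3.base)
  refine ⟨γ₂.1, γ₂.2, L₂.eq_of_proj_comp_eq (hH.comp γ₁.continuous)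
    (γ₂.1.continuous.comp hH) (fun p => ?_) hγ₂.symm⟩
  exact (hproj p).trans (L₂.proj_smul γ₂ (H p)).symm

theorem dist_lift_le {f : L₁.Manifold → L₂.Manifold} {K : ℝ}
    (hf : ∀ x y, dist (f x) (f y) ≤ K * dist x y) (hK : 0 ≤ K) {H : Hyp3 → Hyp3}
    (hH : Continuous H) (h : ∀ p, L₂.proj (H p) = f (L₁.proj p)) (p q : Hyp3) :
    dist (H p) (H q) ≤ K * dist p q := by
  refine Hyp3.dist_le_of_eventually hH (fun p => ?_) p q
  obtain ⟨r, hr, hiso⟩ := L₂.exists_dist_proj_eq (H p)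
  filter_upwards [hH.continuousAt.preimage_mem_nhds (Metric.ball_mem_nhds (H p) hr)] with q hq
  rw [← hiso _ hq _ (Metric.mem_ball_self hr), h, h]
  exact (hf _ _).trans (mul_le_mul_of_nonneg_left (L₁.dist_proj_le q p) hK)

end NiceLattice

section IsBL

variable {X Y : Type*} [MetricSpace X] [MetricSpace Y]

theorem BiLip.isBL {K : ℝ} {e : X ≃ Y} (he : BiLip K e) : IsBL e :=
  ⟨e.bijective, K, he.one_le, fun x y =>
    ⟨(inv_mul_le_iff₀ (one_pos.trans_le he.one_le)).2 (he.ge x y), he.le x y⟩⟩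

theorem IsBL.exists_biLip {f : X → Y} (hf : IsBL f) :
    ∃ (e : X ≃ Y) (K : ℝ), (e : X → Y) = f ∧ BiLip K e := by
  obtain ⟨hbij, K, hK, h⟩ := hf
  exact ⟨Equiv.ofBijective f hbij, K, rfl, hK, fun x y => (h x y).2,
    fun x y => (inv_mul_le_iff₀ (one_pos.trans_le hK)).1 (h x y).1⟩

end IsBL

theorem IsBL.exists_isEquivariantLift {L₁ L₂ : NiceLattice} {f : L₁.Manifold → L₂.Manifold}
    (hf : IsBL f) : ∃ H, IsEquivariantLift f H := by
  obtain ⟨e, K, rfl, he⟩ := hf.exists_biLip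
  obtain ⟨q₀, hq₀⟩ := L₂.proj_surjective (e (L₁.proj Hyp3.base))
  obtain ⟨F, hFc, hF0, hF⟩ := NiceLattice.exists_lift he.continuous hq₀
  obtain ⟨G, hGc, hG0, hG⟩ := NiceLattice.exists_lift he.symm.continuous
    (show L₁.proj Hyp3.base = e.symm (L₂.proj q₀) by rw [hq₀, e.symm_apply_apply])
  have hGF : Function.LeftInverse G F :=
    NiceLattice.leftInverse_of_lifts e.symm_apply_apply hFc hGc hF hG (by rw [hF0, hG0])
  have hFG : Function.LeftInverse F G :=
    NiceLattice.leftInverse_of_lifts e.apply_symm_apply hGc hFc hG hF (by rw [hG0, hF0])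
  have hH : BiLip K (⟨F, G, hGF, hFG⟩ : Hyp3 ≃ Hyp3) :=
    { one_le := he.one_le
      le := NiceLattice.dist_lift_le he.le he.pos.le hFc hF
      ge := fun p q => by
        have h := NiceLattice.dist_lift_le he.symm.le he.pos.le hGc hG (F p) (F q)
        rwa [hGF p, hGF q] at h }
  refine ⟨F, hH.isBL, hF, fun γ hγ => NiceLattice.exists_comp_eq_of_lift hFc hF hγ,
    fun γ hγ => ?_⟩
  obtain ⟨γ₁, h₁, h⟩ := NiceLattice.exists_comp_eq_of_lift hGc hG hγ
  refine ⟨γ₁, h₁, funext fun p => ?_⟩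
  have hp : G (γ (F p)) = γ₁ p := (congrFun h (F p)).trans (congrArg γ₁ (hGF p))
  rw [Function.comp_apply, Function.comp_apply, ← hp, hFG]

/-! ### Smooth maps -/

namespace Hyp3

theorem dist_coord_le_mul_dist {p q : Hyp3} (h : dist p q ≤ 1) :
    dist p.coord q.coord ≤ 2 * q.t * dist p q := by
  have hexp := Real.abs_exp_sub_one_le (x := dist p q) (by rwa [abs_of_nonneg dist_nonneg])
  rw [abs_of_nonneg dist_nonneg] at hexp
  calc _ ≤ q.t * (Real.exp (dist p q) - 1) := euclidean_le p q
    _ ≤ q.t * (2 * dist p q) :=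
        mul_le_mul_of_nonneg_left ((le_abs_self _).trans hexp) q.t_pos.le
    _ = _ := by ring

theorem dist_euclid_le_two_mul (p q : Hyp3) :
    dist (euclid p) (euclid q) ≤ 2 * dist p.coord q.coord := by
  have hz : ‖p.z - q.z‖ ≤ dist p.coord q.coord := (dist_eq_norm p.z q.z).ge.trans (le_max_left _ _)
  have ht : |p.t - q.t| ≤ dist p.coord q.coord := le_max_right _ _
  rw [dist_euclid]
  refine Real.sqrt_le_iff.2 ⟨by positivity, ?_⟩
  rw [← sq_abs (p.t - q.t)]
  nlinarith [norm_nonneg (p.z - q.z), abs_nonneg (p.t - q.t)]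

theorem dist_le_div_mul_dist_coord {p q : Hyp3} {r : ℝ} (hr : 0 < r) (hp : r ≤ p.t)
    (hq : r ≤ q.t) : dist p q ≤ 2 / r * dist p.coord q.coord := by
  have harsinh {v : ℝ} (hv : 0 ≤ v) : Real.arsinh v ≤ v := by
    rw [← Real.sinh_le_sinh, Real.sinh_arsinh]
    exact Real.self_le_sinh_iff.2 hv
  have hsqrt : r ≤ √(p.t * q.t) :=
    Real.le_sqrt_of_sq_le (by nlinarith)
  rw [dist_eq_euclid]
  calc _ ≤ 2 * (dist (euclid p) (euclid q) / (2 * √(p.t * q.t))) := by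
        gcongr
        exact harsinh (by positivity)
    _ ≤ 2 * (2 * dist p.coord q.coord / (2 * r)) := by
        gcongr
        exact dist_euclid_le_two_mul p q
    _ = _ := by ring

theorem exists_dist_coord_le (p : Hyp3) : ∃ C : ℝ, 0 ≤ C ∧ ∃ U ∈ 𝓝 p, ∀ x ∈ U, ∀ y ∈ U,
    dist x.coord y.coord ≤ C * dist x y ∧ dist x y ≤ C * dist x.coord y.coord := by
  have hp := p.t_pos
  refine ⟨max (2 * (2 * p.t)) (2 / (p.t / 2)), by positivity,
    Metric.ball p (1 / 2) ∩ Hyp3.t ⁻¹' Ioo (p.t / 2) (2 * p.t),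
    inter_mem (Metric.ball_mem_nhds _ (by norm_num)) (continuous_t.continuousAt.preimage_mem_nhds
      (Ioo_mem_nhds (by linarith) (by linarith))), ?_⟩
  rintro x ⟨hx, hxt⟩ y ⟨hy, hyt⟩
  rw [Metric.mem_ball] at hx hy
  have hxy : dist x y ≤ 1 := by linarith [dist_triangle_right x y p]
  constructor
  · calc _ ≤ 2 * y.t * dist x y := dist_coord_le_mul_dist hxy
      _ ≤ 2 * (2 * p.t) * dist x y := by
          gcongr
          exact hyt.2.le
      _ ≤ _ := mul_le_mul_of_nonneg_right (le_max_left _ _) dist_nonneg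
  · exact (dist_le_div_mul_dist_coord (half_pos hp) hxt.1.le hyt.1.le).trans
      (mul_le_mul_of_nonneg_right (le_max_right _ _) dist_nonneg)

end Hyp3

namespace NiceLattice

theorem exists_dist_chartAt_le (L : NiceLattice) (a : L.Manifold) :
    ∃ C : ℝ, 0 ≤ C ∧ ∃ U ∈ 𝓝 a, ∀ x ∈ U, ∀ y ∈ U,
      dist (chartAt (ℂ × ℝ) a x) (chartAt (ℂ × ℝ) a y) ≤ C * dist x y ∧
        dist x y ≤ C * dist (chartAt (ℂ × ℝ) a x) (chartAt (ℂ × ℝ) a y) := by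
  have hloc : IsLocalHomeomorph L.proj :=
    L.isQuotientCoveringMap_proj.isCoveringMap.isLocalHomeomorph
  obtain ⟨b, hb⟩ : ∃ b : Hyp3, chartAt (ℂ × ℝ) a = (hloc.localInverseAt b).trans
      (Hyp3.isOpenEmbedding_coord.toOpenPartialHomeomorph Hyp3.coord) := by
    obtain ⟨x, hx⟩ := chart_mem_atlas (ℂ × ℝ) a
    exact ⟨_, hx.symm⟩
  set s := hloc.localInverseAt b
  have hchart (x : L.Manifold) : chartAt (ℂ × ℝ) a x = (s x).coord := by
    rw [hb]
    rfl
  have ha : a ∈ s.source := by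
    have h := mem_chart_source (ℂ × ℝ) a
    rw [hb, OpenPartialHomeomorph.trans_source] at h
    exact h.1
  obtain ⟨C, hC, V, hV, hcoord⟩ := Hyp3.exists_dist_coord_le (s a)
  obtain ⟨r, hr, hiso⟩ := L.exists_dist_proj_eq (s a)
  refine ⟨C, hC, s.source ∩ s ⁻¹' (V ∩ Metric.ball (s a) r),
    inter_mem (s.open_source.mem_nhds ha) ((s.continuousAt ha).preimage_mem_nhds
      (inter_mem hV (Metric.ball_mem_nhds _ hr))), ?_⟩
  rintro x ⟨hx, hxV, hxr⟩ y ⟨hy, hyV, hyr⟩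
  have hxy : dist x y = dist (s x) (s y) := by
    rw [← hiso _ hxr _ hyr, hloc.apply_localInverseAt_of_mem hx,
      hloc.apply_localInverseAt_of_mem hy]
  rw [hxy, hchart, hchart]
  exact hcoord _ hxV _ hyV

variable {L₁ L₂ : NiceLattice} {f : L₁.Manifold → L₂.Manifold}

theorem locallyLipschitz_of_contMDiff (hf : ContMDiff 𝓘(ℝ, ℂ × ℝ) 𝓘(ℝ, ℂ × ℝ) 1 f) :
    LocallyLipschitz f := by
  intro a
  obtain ⟨hc, hd⟩ := contMDiffAt_iff.1 (hf a)
  rw [modelWithCornersSelf_coe, range_id, contDiffWithinAt_univ] at hd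
  obtain ⟨K, t, ht, hK⟩ := hd.exists_lipschitzOnWith
  obtain ⟨C₁, hC₁, U₁, hU₁, h₁⟩ := L₁.exists_dist_chartAt_le a
  obtain ⟨C₂, hC₂, U₂, hU₂, h₂⟩ := L₂.exists_dist_chartAt_le (f a)
  have hmem : (chartAt (ℂ × ℝ) a) ⁻¹' t ∈ 𝓝 a :=
    ((chartAt (ℂ × ℝ) a).continuousAt (mem_chart_source _ a)).preimage_mem_nhds
      (by simpa using ht)
  refine ⟨Real.toNNReal (C₂ * (K * C₁)), U₁ ∩ f ⁻¹' U₂ ∩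
    ((chartAt (ℂ × ℝ) a).source ∩ (chartAt (ℂ × ℝ) a) ⁻¹' t),
    inter_mem (inter_mem hU₁ (hc.preimage_mem_nhds hU₂))
      (inter_mem ((chartAt (ℂ × ℝ) a).open_source.mem_nhds (mem_chart_source _ a)) hmem), ?_⟩
  refine LipschitzOnWith.of_dist_le_mul ?_
  rintro x ⟨⟨hx₁, hx₂⟩, hxs, hxt⟩ y ⟨⟨hy₁, hy₂⟩, hys, hyt⟩
  rw [Real.coe_toNNReal _ (by positivity)]
  have hchart := hK.dist_le_mul _ hxt _ hyt
  simp only [extChartAt, mfld_simps, OpenPartialHomeomorph.left_inv _ hxs,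
    OpenPartialHomeomorph.left_inv _ hys] at hchart
  calc _ ≤ _ := (h₂ _ hx₂ _ hy₂).2
    _ ≤ C₂ * (K * (C₁ * dist x y)) := by
        gcongr
        exact hchart.trans (mul_le_mul_of_nonneg_left (h₁ _ hx₁ _ hy₁).1 K.2)
    _ = _ := by ring

theorem exists_lipschitzWith_of_contMDiff (hf : ContMDiff 𝓘(ℝ, ℂ × ℝ) 𝓘(ℝ, ℂ × ℝ) 1 f) :
    ∃ K, LipschitzWith K f := by
  obtain ⟨K, hK⟩ := (locallyLipschitz_of_contMDiff hf).locallyLipschitzOn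
    |>.exists_lipschitzOnWith_of_compact (s := univ) isCompact_univ
  exact ⟨K, lipschitzOnWith_univ.1 hK⟩

end NiceLattice

theorem isBL_of_diffeomorph {L₁ L₂ : NiceLattice} {n : WithTop ℕ∞} (hn : 1 ≤ n)
    (f : L₁.Manifold ≃ₘ^n⟮𝓘(ℝ, ℂ × ℝ), 𝓘(ℝ, ℂ × ℝ)⟯ L₂.Manifold) : IsBL f := by
  obtain ⟨K, hK⟩ := NiceLattice.exists_lipschitzWith_of_contMDiff (f.contMDiff.of_le hn)
  obtain ⟨K', hK'⟩ := NiceLattice.exists_lipschitzWith_of_contMDiff (f.symm.contMDiff.of_le hn)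
  have hf : BiLip (max 1 (max K K')) f.toEquiv :=
    { one_le := le_max_left _ _
      le := fun x y => (hK.dist_le_mul x y).trans
        (mul_le_mul_of_nonneg_right (by simp) dist_nonneg)
      ge := fun x y => by
        have h := hK'.dist_le_mul (f x) (f y)
        rw [f.symm_apply_apply, f.symm_apply_apply] at h
        exact h.trans (mul_le_mul_of_nonneg_right (by simp) dist_nonneg) }
  exact hf.isBL

section IsEquivariantLift

variable {L₁ L₂ : NiceLattice} {f : L₁.Manifold → L₂.Manifold}

theorem Conjugates.exists_isometry_bdry_eq {K : ℝ} {e : Hyp3 ≃ Hyp3} (h : Conjugates L₁ L₂ e)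
    (he : BiLip K e) : ∃ Φ : Hyp3 ≃ᵢ Hyp3, ∀ ξ, Hyp3.bdry Φ ξ = Hyp3.bdry e ξ := by
  obtain ⟨D, hD⟩ := L₁.exists_dist_le
  exact he.exists_isometry_bdry_eq L₁.finite_setOf_dist_le hD fun γ hγ => h.exists_semiconj hγ

theorem IsEquivariantLift.nonempty_isometryEquiv {H : Hyp3 → Hyp3} (hH : IsEquivariantLift f H) :
    Nonempty (L₁.Manifold ≃ᵢ L₂.Manifold) := by
  obtain ⟨e, K, rfl, he⟩ := hH.isBL.exists_biLip
  obtain ⟨Φ, hΦ⟩ := hH.conjugates.exists_isometry_bdry_eq he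
  exact (hH.conjugates.of_semiconj fun γ δ =>
    Hyp3.semiconj_isometry_of_bdry_eq he hΦ).nonempty_isometryEquiv

theorem IsEquivariantLift.exists_isMoebius {H : Hyp3 → Hyp3} (hH : IsEquivariantLift f H) :
    ∃ h : OnePoint ℂ ≃ₜ OnePoint ℂ, IsBoundaryExtension H h ∧ IsMoebius h := by
  obtain ⟨e, K, rfl, he⟩ := hH.isBL.exists_biLip
  obtain ⟨Φ, hΦ⟩ := hH.conjugates.exists_isometry_bdry_eq he
  refine ⟨he.bdryHomeo, he.isBoundaryExtension, ?_⟩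
  have hbdry : (he.bdryHomeo : OnePoint ℂ → OnePoint ℂ) = Hyp3.bdry Φ :=
    funext fun ξ => (hΦ ξ).symm
  rw [hbdry]
  exact Hyp3.isMoebius_bdry Φ

end IsEquivariantLift

end

theorem theorem1_general (L₁ L₂ : NiceLattice) {n : WithTop ℕ∞} (hn : 1 ≤ n) :
    (∀ f : L₁.Manifold → L₂.Manifold, IsBL f →
      Nonempty (L₁.Manifold ≃ᵢ L₂.Manifold) ∧
      (∃ H : Hyp3 → Hyp3, IsEquivariantLift f H) ∧
      ∀ H : Hyp3 → Hyp3, IsEquivariantLift f H →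
        ∃ h : OnePoint ℂ ≃ₜ OnePoint ℂ, IsBoundaryExtension H h ∧ IsMoebius h) ∧
    (Nonempty (L₁.Manifold ≃ₘ^n⟮𝓘(ℝ, ℂ × ℝ), 𝓘(ℝ, ℂ × ℝ)⟯ L₂.Manifold) →
      Nonempty (L₁.Manifold ≃ᵢ L₂.Manifold)) := by
  refine ⟨fun f hf => ⟨?_, hf.exists_isEquivariantLift, fun H hH => hH.exists_isMoebius⟩, ?_⟩
  · obtain ⟨H, hH⟩ := hf.exists_isEquivariantLift
    exact hH.nonempty_isometryEquiv
  · rintro ⟨f⟩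
    obtain ⟨H, hH⟩ := (isBL_of_diffeomorph hn f).exists_isEquivariantLift
    exact hH.nonempty_isometryEquiv

theorem theorem1 (L₁ L₂ : NiceLattice) :
    (∀ f : L₁.Manifold → L₂.Manifold, IsBL f →
      Nonempty (L₁.Manifold ≃ᵢ L₂.Manifold) ∧
      (∃ H : Hyp3 → Hyp3, IsEquivariantLift f H) ∧
      ∀ H : Hyp3 → Hyp3, IsEquivariantLift f H →
        ∃ h : OnePoint ℂ ≃ₜ OnePoint ℂ, IsBoundaryExtension H h ∧ IsMoebius h) ∧
    (Nonempty (L₁.Manifold ≃ₘ^∞⟮𝓘(ℝ, ℂ × ℝ), 𝓘(ℝ, ℂ × ℝ)⟯ L₂.Manifold) →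
      Nonempty (L₁.Manifold ≃ᵢ L₂.Manifold)) :=
  theorem1_general L₁ L₂ (by exact_mod_cast le_top)
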